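/- All manifolds are smooth, finite-dimensional, Hausdorff and second countable. A Lie algebroid $(A,[\![\cdot,\cdot]\!],\rho)$ over $M$ is a vector bundle $\tau:A\to M$ with a bundle map $\rho:A\to TM$ and a Lie bracket on $\Gamma(A)$ such that $[\![X,fY]\!]=f[\![X,Y]\!]+\rho(X)(f)Y$; its differential $d^A:\Gamma(\Lambda^kA^*)\to\Gamma(\Lambda^{k+1}A^*)$ is given by $$(d^A\alpha)(X_0,\dots,X_k)=\sum_i(-1)^i\rho(X_i)\big(\alpha(\dots,\widehat{X_i},\dots)\big)+\sum_{i<j}(-1)^{i+j}\alpha([\![X_i,X_j]\!],\dots,\widehat{X_i},\dots,\widehat{X_j},\dots).$$ A vector bundle map $F:A\to A'$ over $f:M\to M'$ between Lie algebroids is a morphism if $d^A F^*\alpha=F^*d^{A'}\alpha$ for all $\alpha\in\Gamma(\Lambda^k(A')^*)$ and all $k$; if moreover $f$ is an injective immersion and $F$ is injective on fibres, $A$ is a Lie subalgebroid of $A'$. The complete lift of $X\in\Gamma(A)$ is the vector field $X^c$ on $A$ that is $\tau$-projectable onto $\rho(X)$ and satisfies $X^c(\widehat\alpha)=\widehat{\mathcal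 L^A_X\alpha}$ for all $\alpha\in\Gamma(A^*)$, where $\mathcal L^A_X=i_Xd^A+d^Ai_X$ and $\widehat\beta$ is the fibrewise linear function on $A$ defined by $\beta\in\Gamma(A^*)$. A smooth left action $\Phi:H\times A\to A$ of a Lie group $H$ with Lie algebra $\mathfrak h$ by vector bundle automorphisms, covering an action $\phi$ on $M$, is an action by complete lifts with respect to $\psi:\mathfrak h\to\Gamma(A)$ if $\psi$ is a Lie algebra anti-morphism and the infinitesimal generator of each $\xi\in\mathfrak h$ for $\Phi$ is $\psi(\xi)^c$. Let $A\to M$ be a Lie algebroid with a symplectic-like structure, i.e. a nondegenerate $\Omega\in\Gamma(\Lambda^2A^*)$ with $d^A\Omega=0$. Let $G$ be a connected Lie group with Lie algebra $\mathfrak g$, let $\Phi:G\times A\to A$ be an action by complete lifts with respect to $\psi:\mathfrak g\to\Gamma(A)$, covering $\phi$, and let $J:M\to\mathfrak g^*$ be smooth with $J\circ\phi_g=\mathrm{Coad}_g\circ J$, $\Phi_g^*\Omega=\Omega$ and $i_{\psi(\xi)}\Omega=d^AJ_\xi$ for all $g\in G$, $\xi\in\mathfrak g$, where $J_\xi(x)=J(x)(\xi)$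 and $\mathrm{Coad}_g\mu=\mu\circ \mathrm{Ad}_{g^{-1}}$. Put $J^T:A\to\mathfrak g^*\times\mathfrak g^*$, $J^T(a)=(TJ(\rho(a)),J(\tau(a)))$. Let $\mu\in\mathfrak g^*$ be a regular value of $J$ such that the rank of $T_xJ\circ\rho_x:A_x\to\mathfrak g^*$ is the same for all $x\in J^{-1}(\mu)$. Let $G_\mu=\{g\in G:\mathrm{Coad}_g\mu=\mu\}$ and $\mathfrak g_\mu=\{\xi\in\mathfrak g:\mu([\xi,\eta])=0\ \text{for all }\eta\in\mathfrak g\}$. Then: 1. $J^{-1}(\mu)$ is an embedded submanifold of $M$, and $(J^T)^{-1}(0,\mu)$ is a vector bundle over $J^{-1}(\mu)$ which carries a Lie algebroid structure making it a Lie subalgebroid of $A$ over $J^{-1}(\mu)$ by means of the inclusions. 2. For $\xi\in\mathfrak g_\mu$, the restriction of $\psi(\xi)$ to $J^{-1}(\mu)$ is a smooth section of $(J^T)^{-1}(0,\mu)$; this gives a linear map $\psi_\mu:\mathfrak g_\mu\to\Gamma((J^T)^{-1}(0,\mu))$. 3. $G_\mu$ is an embedded Lie subgroup of $G$ with Lie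 algebra $\mathfrak g_\mu$, and $\Phi$ restricts to an action $\Phi_\mu$ of $G_\mu$ on $(J^T)^{-1}(0,\mu)$ by complete lifts with respect to $\psi_\mu$. 4. The formula $\Phi^T_\mu(v_g,a_x)=(\Phi_\mu)_g\big(a_x+\psi_\mu(T l_{g^{-1}}v_g)(x)\big)$, for $v_g\in T_gG_\mu$ and $a_x\in(J^T)^{-1}(0,\mu)$ over $x$, where $l_h$ is left translation by $h$, defines a smooth action of the tangent Lie group $TG_\mu$ (whose multiplication is the tangent map of that of $G_\mu$) on $(J^T)^{-1}(0,\mu)$ by maps that are affine from fibre to fibre. -/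

import Mathlib

open Bundle Manifold Topology
open scoped ContDiff Manifold

noncomputable section

namespace LieAlgd

/-! ### Lie algebroids -/

section Algebroid

variable {E : Type*} [NormedAddCommGroup E] [NormedSpace ℝ E]
  {M : Type*} [TopologicalSpace M] [ChartedSpace E M]
  (F : Type*) [NormedAddCommGroup F] [NormedSpace ℝ F]
  (A : M → Type*) [∀ x, AddCommGroup (A x)] [∀ x, Module ℝ (A x)] [∀ x, TopologicalSpace (A x)]
  [TopologicalSpace (TotalSpace F A)] [FiberBundle F A]

/-- The derivative `v(f)` of a real function `f` along a tangent vector `v` at `x`. -/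
def dirDeriv {E : Type*} [NormedAddCommGroup E] [NormedSpace ℝ E]
    {H : Type*} [TopologicalSpace H] (I : ModelWithCorners ℝ E H)
    {M : Type*} [TopologicalSpace M] [ChartedSpace H M]
    (f : M → ℝ) (x : M) (v : TangentSpace I x) : ℝ :=
  mfderiv I 𝓘(ℝ, ℝ) f x v

variable [VectorBundle ℝ F A]

/-- The space `Γ(A)` of smooth sections of a vector bundle `A → M`. -/
abbrev Sec : Type _ := ContMDiffSection 𝓘(ℝ, E) F ∞ A

variable {F A} in
/-- The section `f X`, for a smooth function `f` and a section `X`. -/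
def funSMul (f : M → ℝ) (hf : ContMDiff 𝓘(ℝ, E) 𝓘(ℝ, ℝ) ∞ f) (X : Sec (E := E) F A) :
    Sec (E := E) F A :=
  ⟨fun x => f x • X x, hf.smul_section X.contMDiff⟩

/-- A Lie algebroid structure on the vector bundle `A → M`: a bundle map `ρ : A → TM` and a Lie
bracket on `Γ(A)` with `⟦X, f Y⟧ = f ⟦X, Y⟧ + ρ(X)(f) Y`. -/
structure LieAlgebroid [IsManifold 𝓘(ℝ, E) ∞ M] where
  anchor : ∀ x, A x →ₗ[ℝ] TangentSpace 𝓘(ℝ, E) x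
  contMDiff_anchor : ContMDiff (𝓘(ℝ, E).prod 𝓘(ℝ, F)) 𝓘(ℝ, E).tangent ∞
    (fun a : TotalSpace F A => (⟨a.1, anchor a.1 a.2⟩ : TangentBundle 𝓘(ℝ, E) M))
  bracket : Sec (E := E) F A →ₗ[ℝ] Sec (E := E) F A →ₗ[ℝ] Sec (E := E) F A
  bracket_self : ∀ X, bracket X X = 0
  jacobi : ∀ X Y Z, bracket X (bracket Y Z) = bracket (bracket X Y) Z + bracket Y (bracket X Z)
  leibniz : ∀ (X Y : Sec (E := E) F A) (f : M → ℝ) (hf : ContMDiff 𝓘(ℝ, E) 𝓘(ℝ, ℝ) ∞ f) (x : M),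
    bracket X (funSMul f hf Y) x =
      f x • bracket X Y x + dirDeriv 𝓘(ℝ, E) f x (anchor x (X x)) • Y x

/-- Families of alternating `k`-forms on the fibres, i.e. (not necessarily smooth) sections of
`Λ^k A^*`. -/
abbrev Form (k : ℕ) : Type _ := ∀ x, A x [⋀^Fin k]→ₗ[ℝ] ℝ

variable {F A}

variable (F) in
/-- `α` is a smooth section of `Λ^k A^*`. -/
def IsSmoothForm {k : ℕ} (α : Form A k) : Prop :=
  ∀ X : Fin k → Sec (E := E) F A,
    ContMDiff 𝓘(ℝ, E) 𝓘(ℝ, ℝ) ∞ (fun x => α x (fun i => X i x))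

/-- The linear function on the total space of `A` defined by a section of `A^*`. -/
def linFun (α : Form A 1) (a : TotalSpace F A) : ℝ := α a.1 (fun _ => a.2)

variable [IsManifold 𝓘(ℝ, E) ∞ M]

namespace LieAlgebroid

variable (L : LieAlgebroid (E := E) F A)

/-- The sum
`∑_{i<j} (-1)^(i+j) α(⟦X_i, X_j⟧, X_0, …, X̂_i, …, X̂_j, …, X_k)` at the point `x`. It is empty for
`k = 0`; for `k = n + 1`, the pair `i ≤ j` in `Fin (n + 1)` stands for the pair of indices
`i < j + 1` in `Fin (n + 2)`. -/
def bracketSum : {k : ℕ} → Form A k → (Fin (k + 1) → Sec (E := E) F A) → M → ℝ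
  | 0, _, _, _ => 0
  | n + 1, α, X, x => ∑ i : Fin (n + 1), ∑ j ∈ Finset.Ici i,
      (-1 : ℝ) ^ ((i : ℕ) + ((j : ℕ) + 1)) *
        α x (Matrix.vecCons (L.bracket (X i.castSucc) (X j.succ) x)
          (j.removeNth (i.castSucc.removeNth (fun l => X l x))))

/-- `β = d^A α`. -/
def IsDifferential {k : ℕ} (α : Form A k) (β : Form A (k + 1)) : Prop :=
  ∀ (X : Fin (k + 1) → Sec (E := E) F A) (x : M),
    β x (fun i => X i x) =
      (∑ i : Fin (k + 1), (-1 : ℝ) ^ (i : ℕ) *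
        dirDeriv 𝓘(ℝ, E) (fun y => α y (i.removeNth (fun l => X l y))) x (L.anchor x (X i x)))
      + L.bracketSum α X x

/-- `Ω` is a symplectic-like structure: a smooth, nondegenerate section of `Λ² A^*` with
`d^A Ω = 0`. -/
structure IsSymplectic (Ω : Form A 2) : Prop where
  smooth : IsSmoothForm (E := E) F Ω
  nondegenerate : ∀ x (a : A x), (∀ b : A x, Ω x ![a, b] = 0) → a = 0
  closed : L.IsDifferential Ω (fun _ => 0)

/-- The vector field `W` on the total space of `A` is the complete lift `X^c` of `X`: it projects
to `ρ(X)`, and `W(α̂)` is the linear function of the Lie derivative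
`𝓛_X α = i_X (d^A α) + d^A (i_X α)`, for every `α ∈ Γ(A^*)`. -/
def IsCompleteLift (X : Sec (E := E) F A)
    (W : ∀ a : TotalSpace F A, TangentSpace (𝓘(ℝ, E).prod 𝓘(ℝ, F)) a) : Prop :=
  (∀ a : TotalSpace F A,
    mfderiv (𝓘(ℝ, E).prod 𝓘(ℝ, F)) 𝓘(ℝ, E) (fun b : TotalSpace F A => b.1) a (W a) =
      L.anchor a.1 (X a.1)) ∧
  ∀ (α : Form A 1) (β : Form A 2), IsSmoothForm (E := E) F α → L.IsDifferential α β →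
    ∀ a : TotalSpace F A,
      dirDeriv (𝓘(ℝ, E).prod 𝓘(ℝ, F)) (linFun (F := F) α) a (W a) =
        β a.1 ![X a.1, a.2] +
          dirDeriv 𝓘(ℝ, E) (fun y => α y (fun _ => X y)) a.1 (L.anchor a.1 a.2)

end LieAlgebroid

/-! ### Morphisms and Lie subalgebroids -/

variable {E' : Type*} [NormedAddCommGroup E'] [NormedSpace ℝ E']
  {M' : Type*} [TopologicalSpace M'] [ChartedSpace E' M'] [IsManifold 𝓘(ℝ, E') ∞ M']
  {F' : Type*} [NormedAddCommGroup F'] [NormedSpace ℝ F']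
  {A' : M' → Type*} [∀ x, AddCommGroup (A' x)] [∀ x, Module ℝ (A' x)]
  [∀ x, TopologicalSpace (A' x)]
  [TopologicalSpace (TotalSpace F' A')] [FiberBundle F' A'] [VectorBundle ℝ F' A']

/-- A smooth vector bundle map over `f`, given by linear maps `T x : A x → A' (f x)`, is a Lie
algebroid morphism if it commutes with the differentials: `d^A (T^* α) = T^* (d^{A'} α)`. -/
structure IsLieAlgebroidMorphism (L : LieAlgebroid (E := E) F A)
    (L' : LieAlgebroid (E := E') F' A') (f : M → M') (T : ∀ x, A x →ₗ[ℝ] A' (f x)) : Prop where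
  contMDiff : ContMDiff (𝓘(ℝ, E).prod 𝓘(ℝ, F)) (𝓘(ℝ, E').prod 𝓘(ℝ, F')) ∞
    (fun a : TotalSpace F A => (⟨f a.1, T a.1 a.2⟩ : TotalSpace F' A'))
  differential : ∀ (k : ℕ) (α : Form A' k) (β : Form A' (k + 1)),
    IsSmoothForm (E := E') F' α → L'.IsDifferential α β →
      L.IsDifferential (fun x => (α (f x)).compLinearMap (T x))
        (fun x => (β (f x)).compLinearMap (T x))

/-- `(A, L)` is a Lie subalgebroid of `(A', L')` by means of the bundle map `T` over `f`. -/
structure IsLieSubalgebroid (L : LieAlgebroid (E := E) F A)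
    (L' : LieAlgebroid (E := E') F' A') (f : M → M') (T : ∀ x, A x →ₗ[ℝ] A' (f x)) : Prop
    extends IsLieAlgebroidMorphism L L' f T where
  injective : Function.Injective f
  isImmersion : IsImmersion 𝓘(ℝ, E) 𝓘(ℝ, E') ∞ f
  injective_fiber : ∀ x, Function.Injective (T x)

end Algebroid

/-! ### The adjoint and coadjoint actions, and the tangent group -/

section LieGroup

variable {EG : Type*} [NormedAddCommGroup EG] [NormedSpace ℝ EG]
  {G : Type*} [Group G] [TopologicalSpace G] [ChartedSpace EG G]

/-- The adjoint action `Ad_g : 𝔤 → 𝔤`, the derivative of `h ↦ g h g⁻¹` at `1`. The vector space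
underlying `𝔤 = T_1 G` is `EG`. -/
def Ad (g : G) : EG →L[ℝ] EG :=
  mfderiv 𝓘(ℝ, EG) 𝓘(ℝ, EG) (fun h : G => g * h * g⁻¹) 1

theorem Ad_one : Ad (EG := EG) (1 : G) = ContinuousLinearMap.id ℝ EG := by
  have h : (fun h : G => (1 : G) * h * (1 : G)⁻¹) = id := by funext h; simp
  unfold Ad
  rw [h]
  exact mfderiv_id

/-- The left coadjoint action of `G` on `𝔤^*`, `Coad_g μ = μ ∘ Ad_{g⁻¹}`. -/
def Coad (g : G) (μ : EG →L[ℝ] ℝ) : EG →L[ℝ] ℝ := μ.comp (Ad g⁻¹)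

/-- The multiplication of the tangent group `TG`, the tangent map of the multiplication of `G`. -/
def tangentMul (v w : TangentBundle 𝓘(ℝ, EG) G) : TangentBundle 𝓘(ℝ, EG) G :=
  ⟨v.1 * w.1, mfderiv (𝓘(ℝ, EG).prod 𝓘(ℝ, EG)) 𝓘(ℝ, EG) (fun p : G × G => p.1 * p.2) (v.1, w.1)
    ((v.2, w.2) : EG × EG)⟩

/-- The `𝔤`-component of the left trivialization `TG ≅ G × 𝔤`, `v_g ↦ (T l_{g⁻¹}) v_g`. -/
def leftTriv (v : TangentBundle 𝓘(ℝ, EG) G) : GroupLieAlgebra 𝓘(ℝ, EG) G :=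
  (mfderiv 𝓘(ℝ, EG) 𝓘(ℝ, EG) (fun h : G => v.1⁻¹ * h) v.1 v.2 : EG)

variable [LieGroup 𝓘(ℝ, EG) ∞ G]

instance instLieGroupMinSmoothness : LieGroup 𝓘(ℝ, EG) (minSmoothness ℝ 3) G := by
  rw [minSmoothness_of_isRCLikeNormedField]; infer_instance

theorem Ad_mul (g h : G) : Ad (EG := EG) (g * h) = (Ad g).comp (Ad h) := by
  have hd : ∀ (k x : G),
      MDifferentiableAt 𝓘(ℝ, EG) 𝓘(ℝ, EG) (fun y : G => k * y * k⁻¹) x := by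
    intro k x
    have hc : ContMDiff 𝓘(ℝ, EG) 𝓘(ℝ, EG) ∞ (fun y : G => k * y * k⁻¹) :=
      (contMDiff_const.mul contMDiff_id).mul contMDiff_const
    exact (hc x).mdifferentiableAt (by simp)
  have h1 : (fun y : G => g * h * y * (g * h)⁻¹) =
      (fun y : G => g * y * g⁻¹) ∘ (fun y : G => h * y * h⁻¹) := by
    funext y; simp [mul_assoc]
  have h2 : h * 1 * h⁻¹ = 1 := by simp
  unfold Ad
  rw [h1, mfderiv_comp (I' := 𝓘(ℝ, EG)) (1 : G) (hd g _) (hd h 1)]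
  rw [h2]
  rfl

variable (G) in
/-- The isotropy group `G_μ` of `μ` for the coadjoint action. -/
def isotropyGroup (μ : EG →L[ℝ] ℝ) : Subgroup G where
  carrier := {g | Coad g μ = μ}
  one_mem' := by
    change μ.comp (Ad ((1 : G)⁻¹)) = μ
    rw [inv_one, Ad_one]; rfl
  mul_mem' {g h} hg hh := by
    change μ.comp (Ad ((g * h)⁻¹)) = μ
    change μ.comp (Ad g⁻¹) = μ at hg
    change μ.comp (Ad h⁻¹) = μ at hh
    rw [mul_inv_rev, Ad_mul, ← ContinuousLinearMap.comp_assoc, hh, hg]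
  inv_mem' {g} hg := by
    change μ.comp (Ad ((g⁻¹)⁻¹)) = μ
    change μ.comp (Ad g⁻¹) = μ at hg
    conv_lhs => rw [← hg, ContinuousLinearMap.comp_assoc, ← Ad_mul]
    rw [mul_inv_cancel, Ad_one]; rfl

variable [CompleteSpace EG]

variable (G) in
/-- The isotropy algebra `𝔤_μ = {ξ | coad_ξ μ = 0}`, where `(coad_ξ μ)(η) = -μ([ξ, η])`. -/
def isotropyAlgebra (μ : EG →L[ℝ] ℝ) : LieSubalgebra ℝ (GroupLieAlgebra 𝓘(ℝ, EG) G) where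
  carrier := {ξ | ∀ η : GroupLieAlgebra 𝓘(ℝ, EG) G, μ (⁅ξ, η⁆ : GroupLieAlgebra 𝓘(ℝ, EG) G) = 0}
  zero_mem' η := by rw [zero_lie]; exact map_zero μ
  add_mem' {ξ ζ} hξ hζ η := by
    rw [add_lie]
    exact (map_add μ _ _).trans ((congrArg₂ (· + ·) (hξ η) (hζ η)).trans (add_zero 0))
  smul_mem' c ξ hξ η := by
    rw [smul_lie]
    exact (map_smul μ c _).trans ((congrArg (c • ·) (hξ η)).trans (smul_zero c))
  lie_mem' {ξ ζ} hξ hζ η := by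
    rw [lie_lie]
    exact (map_sub μ _ _).trans
      ((congrArg₂ (· - ·) (hξ ⁅ζ, η⁆) (hζ ⁅ξ, η⁆)).trans (sub_zero 0))

end LieGroup

/-! ### Actions -/

section Actions

variable {E : Type*} [NormedAddCommGroup E] [NormedSpace ℝ E]
  {M : Type*} [TopologicalSpace M] [ChartedSpace E M] [IsManifold 𝓘(ℝ, E) ∞ M]
  (F : Type*) [NormedAddCommGroup F] [NormedSpace ℝ F]
  (A : M → Type*) [∀ x, AddCommGroup (A x)] [∀ x, Module ℝ (A x)] [∀ x, TopologicalSpace (A x)]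
  [TopologicalSpace (TotalSpace F A)] [FiberBundle F A] [VectorBundle ℝ F A]
  {EG : Type*} [NormedAddCommGroup EG] [NormedSpace ℝ EG]
  (G : Type*) [Group G] [TopologicalSpace G] [ChartedSpace EG G]

/-- A smooth left action `Φ` of a Lie group `G` on the vector bundle `A → M` by vector bundle
automorphisms: `Φ_g` covers `φ_g = base g : M → M` and is the linear map `fib g x` on `A x`. -/
structure BundleAction where
  base : G → M → M
  fib : ∀ (g : G) (x : M), A x →ₗ[ℝ] A (base g x)
  contMDiff : ContMDiff (𝓘(ℝ, EG).prod (𝓘(ℝ, E).prod 𝓘(ℝ, F))) (𝓘(ℝ, E).prod 𝓘(ℝ, F)) ∞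
    (fun p : G × TotalSpace F A =>
      (⟨base p.1 p.2.1, fib p.1 p.2.1 p.2.2⟩ : TotalSpace F A))
  map_one : ∀ a : TotalSpace F A, (⟨base 1 a.1, fib 1 a.1 a.2⟩ : TotalSpace F A) = a
  map_mul : ∀ (g h : G) (a : TotalSpace F A),
    (⟨base (g * h) a.1, fib (g * h) a.1 a.2⟩ : TotalSpace F A) =
      ⟨base g (base h a.1), fib g (base h a.1) (fib h a.1 a.2)⟩

/-- A smooth action of the tangent group `TG` on the total space of `A → M` by maps that are affine
maps from fibres to fibres. -/
structure TangentAffineAction [LieGroup 𝓘(ℝ, EG) ∞ G] where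
  base : TangentBundle 𝓘(ℝ, EG) G → M → M
  fib : ∀ (v : TangentBundle 𝓘(ℝ, EG) G) (x : M), A x →ᵃ[ℝ] A (base v x)
  contMDiff : ContMDiff (𝓘(ℝ, EG).tangent.prod (𝓘(ℝ, E).prod 𝓘(ℝ, F)))
    (𝓘(ℝ, E).prod 𝓘(ℝ, F)) ∞
    (fun p : TangentBundle 𝓘(ℝ, EG) G × TotalSpace F A =>
      (⟨base p.1 p.2.1, fib p.1 p.2.1 p.2.2⟩ : TotalSpace F A))
  map_one : ∀ a : TotalSpace F A,
    (⟨base ⟨1, 0⟩ a.1, fib ⟨1, 0⟩ a.1 a.2⟩ : TotalSpace F A) = a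
  map_mul : ∀ (v w : TangentBundle 𝓘(ℝ, EG) G) (a : TotalSpace F A),
    (⟨base (tangentMul v w) a.1, fib (tangentMul v w) a.1 a.2⟩ : TotalSpace F A) =
      ⟨base v (base w a.1), fib v (base w a.1) (fib w a.1 a.2)⟩

variable {F A G}

/-- The map `Φ_g : A → A`. -/
def BundleAction.map (Φ : BundleAction (E := E) (EG := EG) F A G) (g : G) (a : TotalSpace F A) :
    TotalSpace F A :=
  ⟨Φ.base g a.1, Φ.fib g a.1 a.2⟩

/-- The map `Φ^T_v : A → A`, for `v ∈ TG`. -/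
def TangentAffineAction.map [LieGroup 𝓘(ℝ, EG) ∞ G]
    (Θ : TangentAffineAction (E := E) (EG := EG) F A G)
    (v : TangentBundle 𝓘(ℝ, EG) G) (a : TotalSpace F A) : TotalSpace F A :=
  ⟨Θ.base v a.1, Θ.fib v a.1 a.2⟩

/-- The infinitesimal generator `ξ_A` of `ξ ∈ 𝔤`, i.e. the derivative of `g ↦ Φ_g(a)` at `1` in
the direction `ξ`; it is a tangent vector at `Φ_1(a) = a`. -/
def BundleAction.generator (Φ : BundleAction (E := E) (EG := EG) F A G)
    (ξ : GroupLieAlgebra 𝓘(ℝ, EG) G) (a : TotalSpace F A) :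
    TangentSpace (𝓘(ℝ, E).prod 𝓘(ℝ, F)) a :=
  (mfderiv 𝓘(ℝ, EG) (𝓘(ℝ, E).prod 𝓘(ℝ, F)) (fun g : G => Φ.map g a) 1 ξ : E × F)

/-- `Φ` is an action by complete lifts with respect to `ψ : 𝔤 → Γ(A)`: the map `ψ` is a Lie algebra
anti-morphism and the infinitesimal generator of every `ξ ∈ 𝔤` is the complete lift of `ψ(ξ)`. -/
structure IsActionByCompleteLifts (L : LieAlgebroid (E := E) F A)
    (Φ : BundleAction (E := E) (EG := EG) F A G)
    (ψ : GroupLieAlgebra 𝓘(ℝ, EG) G →ₗ[ℝ] Sec (E := E) F A) : Prop where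
  anti : ∀ ξ η : GroupLieAlgebra 𝓘(ℝ, EG) G, ψ ⁅ξ, η⁆ = -L.bracket (ψ ξ) (ψ η)
  generator : ∀ ξ, L.IsCompleteLift (ψ ξ) (Φ.generator ξ)

/-- The action `Φ` is Hamiltonian with equivariant momentum map `J : M → 𝔤^*`:
`Φ_g^* Ω = Ω` and `i_{ψ(ξ)} Ω = d^A J_ξ` with `J_ξ(x) = J(x)(ξ)`; recall that
`(d^A f)(a) = ρ(a)(f)` for a function `f`. -/
structure IsEquivariantMomentumMap (L : LieAlgebroid (E := E) F A) (Ω : Form A 2)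
    (Φ : BundleAction (E := E) (EG := EG) F A G)
    (ψ : GroupLieAlgebra 𝓘(ℝ, EG) G →ₗ[ℝ] Sec (E := E) F A)
    (J : M → (EG →L[ℝ] ℝ)) : Prop where
  contMDiff : ContMDiff 𝓘(ℝ, E) 𝓘(ℝ, EG →L[ℝ] ℝ) ∞ J
  equivariant : ∀ (g : G) (x : M), J (Φ.base g x) = Coad g (J x)
  invariant : ∀ (g : G) (x : M) (a b : A x),
    Ω (Φ.base g x) ![Φ.fib g x a, Φ.fib g x b] = Ω x ![a, b]
  contraction : ∀ (ξ : GroupLieAlgebra 𝓘(ℝ, EG) G) (x : M) (a : A x),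
    Ω x ![ψ ξ x, a] = dirDeriv 𝓘(ℝ, E) (fun y => J y ξ) x (L.anchor x a)

/-! ### The level set of the momentum map -/

/-- The differential `T_x J : T_x M → 𝔤^*`. -/
def tangentJ (J : M → (EG →L[ℝ] ℝ)) (x : M) :
    TangentSpace 𝓘(ℝ, E) x →ₗ[ℝ] (EG →L[ℝ] ℝ) :=
  (mfderiv 𝓘(ℝ, E) 𝓘(ℝ, EG →L[ℝ] ℝ) J x).toLinearMap

/-- The map `J^T : A → 𝔤^* × 𝔤^*`, `a ↦ (TJ(ρ(a)), J(τ(a)))`. -/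
def JT (L : LieAlgebroid (E := E) F A) (J : M → (EG →L[ℝ] ℝ)) (a : TotalSpace F A) :
    (EG →L[ℝ] ℝ) × (EG →L[ℝ] ℝ) :=
  (tangentJ J a.1 (L.anchor a.1 a.2), J a.1)

/-- The fibre of `(J^T)⁻¹(0, μ)` over a point `x` of `J⁻¹(μ)`. -/
def levelFiber (L : LieAlgebroid (E := E) F A) (J : M → (EG →L[ℝ] ℝ)) (μ : EG →L[ℝ] ℝ)
    (x : J ⁻¹' {μ}) : Submodule ℝ (A x) where
  carrier := {a | JT L J ⟨x, a⟩ = (0, μ)}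
  zero_mem' := by
    have hx : J x = μ := x.2
    simp [JT, hx]
  add_mem' {a b} ha hb := by
    simp only [JT, Set.mem_ofPred_eq, Prod.mk.injEq, map_add] at *
    exact ⟨by rw [ha.1, hb.1, add_zero], ha.2⟩
  smul_mem' c a ha := by
    simp only [JT, Set.mem_ofPred_eq, Prod.mk.injEq, map_smul] at *
    exact ⟨by rw [ha.1, smul_zero], ha.2⟩

/-- The family of vector spaces `(J^T)⁻¹(0, μ)` over `J⁻¹(μ)`. -/
abbrev LevelBundle (L : LieAlgebroid (E := E) F A) (J : M → (EG →L[ℝ] ℝ)) (μ : EG →L[ℝ] ℝ)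
    (x : J ⁻¹' {μ}) : Type _ :=
  ↥(levelFiber L J μ x)

/-- The inclusion `(J^T)⁻¹(0, μ) → A` of total spaces. -/
def levelIncl (F' : Type*) (L : LieAlgebroid (E := E) F A) (J : M → (EG →L[ℝ] ℝ))
    (μ : EG →L[ℝ] ℝ) (a : TotalSpace F' (LevelBundle L J μ)) : TotalSpace F A :=
  ⟨a.1, a.2⟩

end Actions

end LieAlgd

end

noncomputable section
namespace LieAlgd

/-! Write S = J⁻¹(μ). Over x ∈ S the fibre B of (J^T)⁻¹(0, μ) is the kernel of T_xJ ∘ ρ. By the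
momentum equation i_{ψ(ξ)}Ω = d^A J_ξ it is also the Ω-orthogonal of the vectors ψ(ξ)(x). The first
description gives the Lie algebroid, the second the action.

Algebroid. S is a regular level set with tangent spaces ker TJ, and constant rank along S makes the
kernels a smooth subbundle, which ρ maps into TS. If X and Y take values in B over S, then
ρ(⟦X,Y⟧)(J_η) is a difference of derivatives along S of functions that vanish on S; so ⟦X,Y⟧ lies in
B (`isInvolutive_levelFiber`). By the Leibniz rule ⟦X,Z⟧ vanishes on S if Z does and ρ(X) is tangent
to S. Hence the bracket of sections of B may be computed with arbitrary extensions to M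
(`IsInvolutive.bracket_congr`), and the axioms are inherited (`exists_isRestriction`).

Action. A generator is the complete lift of X exactly when it covers ρ(X) and the derivative of the
pull-backs of every section Y is ⟦X,Y⟧ (`dotPullback_eq_bracket`, `isCompleteLift_generator`). So g
↦ Φ_{g⁻¹} ψ(Ad_g ξ) has derivative ⟦ψη,ψξ⟧ + ψ[η,ξ] = 0 at 1, and by translation derivative zero
everywhere. As G is connected, Φ_g ψ(ξ) = ψ(Ad_g ξ) (`map_psi`). With the invariance of Ω this shows
that G_μ preserves B. Differentiating the constant J(φ_g x)(Ad_g η) shows that ψ(ξ) lies in B for ξ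
∈ 𝔤_μ. The criterion by pull-backs passes to the restricted action.

Group. The map g ↦ μ ∘ Ad_g has constant rank by translation, so its level G_μ is an embedded
submanifold, with tangent space at 1 the kernel of ξ ↦ μ([ξ,·]), which is 𝔤_μ. Here and in the
previous paragraph the derivative of Ad must be the bracket (`mfderiv_Ad_apply`); this is computed
from the second derivative of the multiplication in a chart.

Tangent group. In the left trivialization the product is (g,ξ)(h,ζ) = (gh, Ad_{h⁻¹}ξ + ζ), and the
equivariance of ψ_μ is what makes the affine formula an action (`exists_tangentAffineAction`). -/

theorem one_add_one_le_infty : (1 + 1 : WithTop ℕ∞) ≤ ∞ := by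
  rw [one_add_one_eq_two]
  exact WithTop.coe_le_coe.2 (le_top : (2 : ℕ∞) ≤ ⊤)

/-! ### Charts at their base point -/

section Chart

variable {E : Type*} [NormedAddCommGroup E] [NormedSpace ℝ E]
  {M : Type*} [TopologicalSpace M] [ChartedSpace E M] [IsManifold 𝓘(ℝ, E) ∞ M]

theorem isManifold_one_of_infty : IsManifold 𝓘(ℝ, E) 1 M :=
  IsManifold.of_le (n := ∞) (by exact_mod_cast le_top)

/-- Tangent vectors at x are by definition written in the preferred chart at x, so this chart has
the identity as derivative there. It allows derivatives at x to be computed in the model space with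
no correction. -/
theorem hasMFDerivAt_extChartAt_self (x : M) :
    HasMFDerivAt 𝓘(ℝ, E) 𝓘(ℝ, E) (extChartAt 𝓘(ℝ, E) x) x (ContinuousLinearMap.id ℝ E) := by
  have : IsManifold 𝓘(ℝ, E) 1 M := isManifold_one_of_infty
  have h := (mdifferentiableAt_extChartAt (I := 𝓘(ℝ, E)) (mem_chart_source E x)).hasMFDerivAt
  rwa [mfderiv_extChartAt_self] at h

theorem hasMFDerivAt_extChartAt_symm_self (x : M) :
    HasMFDerivAt 𝓘(ℝ, E) 𝓘(ℝ, E) (extChartAt 𝓘(ℝ, E) x).symm (extChartAt 𝓘(ℝ, E) x x)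
      (ContinuousLinearMap.id ℝ E) := by
  have : IsManifold 𝓘(ℝ, E) 1 M := isManifold_one_of_infty
  have h := (mdifferentiableWithinAt_extChartAt_symm (I := 𝓘(ℝ, E))
    (mem_extChartAt_target (I := 𝓘(ℝ, E)) x)).hasMFDerivWithinAt
  rw [modelWithCornersSelf_coe, Set.range_id, hasMFDerivWithinAt_univ] at h
  have e : mfderivWithin 𝓘(ℝ, E) 𝓘(ℝ, E) (extChartAt 𝓘(ℝ, E) x).symm (Set.range 𝓘(ℝ, E))
    (extChartAt 𝓘(ℝ, E) x x) = _ := mfderivWithin_range_extChartAt_symm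
  rw [modelWithCornersSelf_coe, Set.range_id] at e
  exact e ▸ h

theorem contMDiffAt_extChartAt_symm_of_mem {x : M} {u : E}
    (hu : u ∈ (extChartAt 𝓘(ℝ, E) x).target) :
    ContMDiffAt 𝓘(ℝ, E) 𝓘(ℝ, E) ∞ (extChartAt 𝓘(ℝ, E) x).symm u :=
  (contMDiffOn_extChartAt_symm x).contMDiffAt ((isOpen_extChartAt_target x).mem_nhds hu)

end Chart

/-! ### The adjoint action and its derivative -/

section Ad

variable {EG : Type*} [NormedAddCommGroup EG] [NormedSpace ℝ EG]
  {G : Type*} [Group G] [TopologicalSpace G] [ChartedSpace EG G]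

variable (G) in
/-- The multiplication of `G` in the chart at `1`. -/
def chartMul (p : EG × EG) : EG :=
  extChartAt 𝓘(ℝ, EG) (1 : G)
    ((extChartAt 𝓘(ℝ, EG) (1 : G)).symm p.1 * (extChartAt 𝓘(ℝ, EG) (1 : G)).symm p.2)

variable (G) in
/-- The coordinates of `1` in the chart at `1`. -/
def chartOne : EG := extChartAt 𝓘(ℝ, EG) (1 : G) 1

theorem chartOne_mem_target : chartOne G ∈ (extChartAt 𝓘(ℝ, EG) (1 : G)).target :=
  mem_extChartAt_target (I := 𝓘(ℝ, EG)) (1 : G)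

theorem extChartAt_symm_chartOne :
    (extChartAt 𝓘(ℝ, EG) (1 : G)).symm (chartOne G) = 1 :=
  extChartAt_to_inv (I := 𝓘(ℝ, EG)) (1 : G)

theorem eventually_mem_target :
    ∀ᶠ u in 𝓝 (chartOne G), u ∈ (extChartAt 𝓘(ℝ, EG) (1 : G)).target :=
  (isOpen_extChartAt_target (I := 𝓘(ℝ, EG)) (1 : G)).mem_nhds chartOne_mem_target

theorem chartMul_one_right {u : EG} (hu : u ∈ (extChartAt 𝓘(ℝ, EG) (1 : G)).target) :
    chartMul G (u, chartOne G) = u := by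
  simp only [chartMul, extChartAt_symm_chartOne, mul_one]
  exact (extChartAt 𝓘(ℝ, EG) (1 : G)).right_inv hu

theorem chartMul_one_left {u : EG} (hu : u ∈ (extChartAt 𝓘(ℝ, EG) (1 : G)).target) :
    chartMul G (chartOne G, u) = u := by
  simp only [chartMul, extChartAt_symm_chartOne, one_mul]
  exact (extChartAt 𝓘(ℝ, EG) (1 : G)).right_inv hu

variable [LieGroup 𝓘(ℝ, EG) ∞ G]

theorem contDiffAt_chartMul {a b : EG} (ha : a ∈ (extChartAt 𝓘(ℝ, EG) (1 : G)).target)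
    (hb : b ∈ (extChartAt 𝓘(ℝ, EG) (1 : G)).target)
    (hab : (extChartAt 𝓘(ℝ, EG) (1 : G)).symm a * (extChartAt 𝓘(ℝ, EG) (1 : G)).symm b ∈
      (extChartAt 𝓘(ℝ, EG) (1 : G)).source) :
    ContDiffAt ℝ ∞ (chartMul G) (a, b) := by
  rw [← contMDiffAt_iff_contDiffAt]
  have h1 : ContMDiffAt 𝓘(ℝ, EG × EG) 𝓘(ℝ, EG) ∞
      (fun p : EG × EG => (extChartAt 𝓘(ℝ, EG) (1 : G)).symm p.1) (a, b) :=
    (contMDiffAt_extChartAt_symm_of_mem ha).comp (a, b) contDiffAt_fst.contMDiffAt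
  have h2 : ContMDiffAt 𝓘(ℝ, EG × EG) 𝓘(ℝ, EG) ∞
      (fun p : EG × EG => (extChartAt 𝓘(ℝ, EG) (1 : G)).symm p.2) (a, b) :=
    (contMDiffAt_extChartAt_symm_of_mem hb).comp (a, b) contDiffAt_snd.contMDiffAt
  rw [extChartAt_source] at hab
  exact (contMDiffAt_extChartAt' hab).comp (a, b) (h1.mul h2)

theorem contDiffAt_chartMul_left {u : EG} (hu : u ∈ (extChartAt 𝓘(ℝ, EG) (1 : G)).target) :
    ContDiffAt ℝ ∞ (chartMul G) (u, chartOne G) := by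
  refine contDiffAt_chartMul hu chartOne_mem_target ?_
  rw [extChartAt_symm_chartOne, mul_one]
  exact (extChartAt 𝓘(ℝ, EG) (1 : G)).map_target hu

theorem contDiffAt_chartMul_right {u : EG} (hu : u ∈ (extChartAt 𝓘(ℝ, EG) (1 : G)).target) :
    ContDiffAt ℝ ∞ (chartMul G) (chartOne G, u) := by
  refine contDiffAt_chartMul chartOne_mem_target hu ?_
  rw [extChartAt_symm_chartOne, one_mul]
  exact (extChartAt 𝓘(ℝ, EG) (1 : G)).map_target hu

/-- The left invariant vector field of `w` in the chart at `1`. -/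
theorem mpullbackWithin_mulInvariantVectorField (w : GroupLieAlgebra 𝓘(ℝ, EG) G) {u : EG}
    (hu : u ∈ (extChartAt 𝓘(ℝ, EG) (1 : G)).target) :
    VectorField.mpullbackWithin 𝓘(ℝ, EG) 𝓘(ℝ, EG) (extChartAt 𝓘(ℝ, EG) (1 : G)).symm
      (mulInvariantVectorField w) (Set.range 𝓘(ℝ, EG)) u =
      (fderiv ℝ (chartMul G) (u, chartOne G) ((0 : EG), (w : EG)) : EG) := by
  have : IsManifold 𝓘(ℝ, EG) 1 G := isManifold_one_of_infty
  set φ := extChartAt 𝓘(ℝ, EG) (1 : G) with hφ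
  set g : G := φ.symm u with hg
  -- the map `b ↦ g * φ⁻¹ b`
  have h1 : HasMFDerivAt 𝓘(ℝ, EG) 𝓘(ℝ, EG) (fun h : G => g * h) (φ.symm (chartOne G))
      (mfderiv 𝓘(ℝ, EG) 𝓘(ℝ, EG) (fun h : G => g * h) 1 : EG →L[ℝ] EG) := by
    rw [extChartAt_symm_chartOne]
    exact ((contMDiff_mul_left (I := 𝓘(ℝ, EG)) (n := ∞) (a := g)).mdifferentiableAt
      (by simp)).hasMFDerivAt
  have h2 := h1.comp (chartOne G) (hasMFDerivAt_extChartAt_symm_self (1 : G))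
  -- the map `b ↦ φ⁻¹ (m (u, b))`
  have h3 : HasFDerivAt (fun b : EG => chartMul G (u, b))
      ((fderiv ℝ (chartMul G) (u, chartOne G)).comp (ContinuousLinearMap.inr ℝ EG EG))
      (chartOne G) :=
    ((contDiffAt_chartMul_left hu).differentiableAt (by simp)).hasFDerivAt.comp (chartOne G)
      (hasFDerivAt_prodMk_right u (chartOne G))
  have h4 : HasMFDerivAt 𝓘(ℝ, EG) 𝓘(ℝ, EG) φ.symm (chartMul G (u, chartOne G))
      (mfderiv 𝓘(ℝ, EG) 𝓘(ℝ, EG) φ.symm u : EG →L[ℝ] EG) := by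
    rw [chartMul_one_right hu]
    exact ((contMDiffAt_extChartAt_symm_of_mem hu).mdifferentiableAt (by simp)).hasMFDerivAt
  have h5 := h4.comp (chartOne G) h3.hasMFDerivAt
  have h6 : (φ.symm ∘ fun b : EG => chartMul G (u, b)) =ᶠ[𝓝 (chartOne G)]
      ((fun h : G => g * h) ∘ φ.symm) := by
    have hc : ContinuousAt (fun b : EG => g * φ.symm b) (chartOne G) := h2.continuousAt
    have hs : φ.source ∈ 𝓝 (g * φ.symm (chartOne G)) := by
      rw [extChartAt_symm_chartOne, mul_one]
      exact (isOpen_extChartAt_source (I := 𝓘(ℝ, EG)) (1 : G)).mem_nhds (φ.map_target hu)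
    filter_upwards [hc.preimage_mem_nhds hs] with b hb
    exact φ.left_inv hb
  have h7 := hasMFDerivAt_unique (h5.congr_of_eventuallyEq h6.symm) h2
  have h8 : (mfderiv 𝓘(ℝ, EG) 𝓘(ℝ, EG) φ.symm u : EG →L[ℝ] EG)
      (fderiv ℝ (chartMul G) (u, chartOne G) ((0 : EG), (w : EG))) =
      (mulInvariantVectorField w g : EG) := by
    have := congrArg (fun T : EG →L[ℝ] EG => T w) h7
    exact this
  have h9 : (mfderivWithin 𝓘(ℝ, EG) 𝓘(ℝ, EG) φ.symm (Set.range 𝓘(ℝ, EG)) u).IsInvertible :=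
    isInvertible_mfderivWithin_extChartAt_symm hu
  have h10 : (mfderivWithin 𝓘(ℝ, EG) 𝓘(ℝ, EG) φ.symm (Set.range 𝓘(ℝ, EG)) u) =
      mfderiv 𝓘(ℝ, EG) 𝓘(ℝ, EG) φ.symm u := by
    rw [modelWithCornersSelf_coe, Set.range_id, mfderivWithin_univ]
  rw [VectorField.mpullbackWithin_apply]
  rw [h10] at h9 ⊢
  refine Eq.trans ?_ (ContinuousLinearMap.IsInvertible.inverse_apply_eq h9 |>.2 h8.symm)
  rfl

/-- The mixed derivative of the multiplication in the chart at `1`. -/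
theorem hasFDerivAt_chartMul_right (w : EG) :
    HasFDerivAt (fun u : EG => fderiv ℝ (chartMul G) (u, chartOne G) ((0 : EG), w))
      (((ContinuousLinearMap.apply ℝ EG ((0 : EG), w)).comp
        (fderiv ℝ (fderiv ℝ (chartMul G)) (chartOne G, chartOne G))).comp
          (ContinuousLinearMap.inl ℝ EG EG)) (chartOne G) := by
  have h1 : ContDiffAt ℝ 1 (fderiv ℝ (chartMul G)) (chartOne G, chartOne G) :=
    (contDiffAt_chartMul_left (chartOne_mem_target (EG := EG) (G := G))).fderiv_right (m := 1)
      one_add_one_le_infty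
  have h2 : HasFDerivAt (fderiv ℝ (chartMul G))
    (fderiv ℝ (fderiv ℝ (chartMul G)) (chartOne G, chartOne G)) (chartOne G, chartOne G) :=
    (h1.differentiableAt (by simp)).hasFDerivAt
  exact ((ContinuousLinearMap.apply ℝ EG ((0 : EG), w)).hasFDerivAt.comp _ h2).comp (chartOne G)
    (f := fun e => (e, chartOne G)) (hasFDerivAt_prodMk_left (chartOne G) (chartOne G))

/-- The bracket of the Lie algebra of `G` in the chart at `1`. -/
theorem bracket_eq_chartMul (v w : GroupLieAlgebra 𝓘(ℝ, EG) G) :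
    (⁅v, w⁆ : GroupLieAlgebra 𝓘(ℝ, EG) G) =
      ((fderiv ℝ (fderiv ℝ (chartMul G)) (chartOne G, chartOne G) ((v, 0) : EG × EG)
          ((0, w) : EG × EG) : EG) -
        (fderiv ℝ (fderiv ℝ (chartMul G)) (chartOne G, chartOne G) ((w, 0) : EG × EG)
          ((0, v) : EG × EG) : EG) : EG) := by
  have : IsManifold 𝓘(ℝ, EG) 1 G := isManifold_one_of_infty
  have hv : ∀ x : GroupLieAlgebra 𝓘(ℝ, EG) G,
      VectorField.mpullbackWithin 𝓘(ℝ, EG) 𝓘(ℝ, EG) (extChartAt 𝓘(ℝ, EG) (1 : G)).symm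
      (mulInvariantVectorField x) (Set.range 𝓘(ℝ, EG)) =ᶠ[𝓝 (chartOne G)]
        fun u => (fderiv ℝ (chartMul G) (u, chartOne G) ((0 : EG), (x : EG)) : EG) := by
    intro x
    filter_upwards [eventually_mem_target (G := G)] with u hu
    exact mpullbackWithin_mulInvariantVectorField x hu
  have hval : ∀ x : EG, fderiv ℝ (chartMul G) (chartOne G, chartOne G) ((0 : EG), x) = x := by
    intro x
    have h1 : HasFDerivAt (fun b : EG => chartMul G (chartOne G, b))
        ((fderiv ℝ (chartMul G) (chartOne G, chartOne G)).comp
          (ContinuousLinearMap.inr ℝ EG EG)) (chartOne G) :=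
      ((contDiffAt_chartMul_left (chartOne_mem_target (EG := EG) (G := G))).differentiableAt
        (by simp)).hasFDerivAt.comp (chartOne G)
        (hasFDerivAt_prodMk_right (chartOne G) (chartOne G))
    have h2 : HasFDerivAt (fun b : EG => chartMul G (chartOne G, b))
        (ContinuousLinearMap.id ℝ EG) (chartOne G) := by
      refine (hasFDerivAt_id _).congr_of_eventuallyEq ?_
      filter_upwards [eventually_mem_target (G := G)] with u hu
      exact chartMul_one_left hu
    exact congrArg (fun T : EG →L[ℝ] EG => T x) (h1.unique h2)
  rw [GroupLieAlgebra.bracket_def, ← VectorField.mlieBracketWithin_univ,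
    VectorField.mlieBracketWithin_apply]
  have hinv : ∀ (T : EG →L[ℝ] EG), T = ContinuousLinearMap.id ℝ EG → ∀ x, T.inverse x = x := by
    rintro _ rfl x
    rw [ContinuousLinearMap.inverse_id]; rfl
  refine Eq.trans (hinv _ (mfderiv_extChartAt_self (I := 𝓘(ℝ, EG)) (x := (1 : G))) _) ?_
  have hset : ((extChartAt 𝓘(ℝ, EG) (1 : G)).symm ⁻¹' Set.univ ∩ Set.range 𝓘(ℝ, EG)) =
      Set.univ := by simp
  have key : ∀ (V W V' W' : EG → EG), V =ᶠ[𝓝 (chartOne G)] V' → W =ᶠ[𝓝 (chartOne G)] W' →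
      ∀ s : Set EG, s = Set.univ → VectorField.lieBracketWithin ℝ V W s (chartOne G) =
        fderiv ℝ W' (chartOne G) (V' (chartOne G)) -
          fderiv ℝ V' (chartOne G) (W' (chartOne G)) := by
    rintro V W V' W' hV hW _ rfl
    rw [VectorField.lieBracketWithin_univ, hV.lieBracket_vectorField_eq hW,
      VectorField.lieBracket_eq]
  refine Eq.trans (key _ _ _ _ (hv v) (hv w) _ hset) ?_
  -- In the chart, the invariant field of y is u ↦ ∂₂m(u, 1)y for the multiplication m. Its
  -- derivative along x is a mixed second derivative of m, and the bracket antisymmetrizes it.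
  have key' : ∀ x y : EG,
      fderiv ℝ (fun u : EG => fderiv ℝ (chartMul G) (u, chartOne G) ((0 : EG), y)) (chartOne G)
          (fderiv ℝ (chartMul G) (chartOne G, chartOne G) ((0 : EG), x)) =
        fderiv ℝ (fderiv ℝ (chartMul G)) (chartOne G, chartOne G) (x, 0) (0, y) := by
    intro x y
    rw [(hasFDerivAt_chartMul_right (G := G) y).fderiv, hval]
    rfl
  exact congrArg₂ (fun a b : EG => a - b) (key' v w) (key' w v)

variable (G) in
/-- Conjugation in the chart at `1`. -/
def chartConj (u b : EG) : EG :=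
  extChartAt 𝓘(ℝ, EG) (1 : G)
    ((extChartAt 𝓘(ℝ, EG) (1 : G)).symm u * (extChartAt 𝓘(ℝ, EG) (1 : G)).symm b *
      ((extChartAt 𝓘(ℝ, EG) (1 : G)).symm u)⁻¹)

theorem hasMFDerivAt_conj (g : G) :
    HasMFDerivAt 𝓘(ℝ, EG) 𝓘(ℝ, EG) (fun h : G => g * h * g⁻¹) 1 (Ad (EG := EG) g) := by
  have hc : ContMDiff 𝓘(ℝ, EG) 𝓘(ℝ, EG) ∞ (fun y : G => g * y * g⁻¹) :=
    (contMDiff_const.mul contMDiff_id).mul contMDiff_const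
  exact ((hc 1).mdifferentiableAt (by simp)).hasMFDerivAt

/-- Conjugation fixes 1, where the chart and its inverse have identity derivative. No condition on u
is needed. -/
theorem hasFDerivAt_chartConj (u : EG) :
    HasFDerivAt (chartConj G u)
      (Ad (EG := EG) ((extChartAt 𝓘(ℝ, EG) (1 : G)).symm u)) (chartOne G) := by
  set g : G := (extChartAt 𝓘(ℝ, EG) (1 : G)).symm u with hg
  have h1 : HasMFDerivAt 𝓘(ℝ, EG) 𝓘(ℝ, EG) (fun h : G => g * h * g⁻¹)
      ((extChartAt 𝓘(ℝ, EG) (1 : G)).symm (chartOne G)) (Ad (EG := EG) g : EG →L[ℝ] EG) := by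
    rw [extChartAt_symm_chartOne]
    exact hasMFDerivAt_conj g
  have h2 := h1.comp (chartOne G) (hasMFDerivAt_extChartAt_symm_self (1 : G))
  have h3 : ∀ x : G, x = 1 → HasMFDerivAt 𝓘(ℝ, EG) 𝓘(ℝ, EG) (extChartAt 𝓘(ℝ, EG) (1 : G)) x
      (ContinuousLinearMap.id ℝ EG) := by
    rintro _ rfl
    exact hasMFDerivAt_extChartAt_self 1
  have h4 := (h3 (g * (extChartAt 𝓘(ℝ, EG) (1 : G)).symm (chartOne G) * g⁻¹)
    (by rw [extChartAt_symm_chartOne]; simp)).comp (chartOne G) h2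
  exact hasMFDerivAt_iff_hasFDerivAt.1 h4

theorem contDiffAt_chartConj :
    ContDiffAt ℝ ∞ (Function.uncurry (chartConj (EG := EG) G)) (chartOne G, chartOne G) := by
  rw [← contMDiffAt_iff_contDiffAt]
  have h1 : ContMDiffAt 𝓘(ℝ, EG × EG) 𝓘(ℝ, EG) ∞
      (fun p : EG × EG => (extChartAt 𝓘(ℝ, EG) (1 : G)).symm p.1) (chartOne G, chartOne G) :=
    (contMDiffAt_extChartAt_symm_of_mem (chartOne_mem_target (EG := EG) (G := G))).comp (chartOne G, chartOne G)
      contDiffAt_fst.contMDiffAt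
  have h2 : ContMDiffAt 𝓘(ℝ, EG × EG) 𝓘(ℝ, EG) ∞
      (fun p : EG × EG => (extChartAt 𝓘(ℝ, EG) (1 : G)).symm p.2) (chartOne G, chartOne G) :=
    (contMDiffAt_extChartAt_symm_of_mem (chartOne_mem_target (EG := EG) (G := G))).comp (chartOne G, chartOne G)
      contDiffAt_snd.contMDiffAt
  refine (contMDiffAt_extChartAt' ?_).comp (chartOne G, chartOne G) ((h1.mul h2).mul h1.inv)
  simp only [extChartAt_symm_chartOne]
  simp

/-- The adjoint action is smooth near `1`. -/
theorem contDiffAt_Ad_chart :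
    ContDiffAt ℝ ∞ (fun u : EG => Ad (EG := EG) ((extChartAt 𝓘(ℝ, EG) (1 : G)).symm u))
      (chartOne G) := by
  have h : ContDiffAt ℝ ∞ (fun u : EG => fderiv ℝ (chartConj G u) (chartOne G)) (chartOne G) :=
    (contDiffAt_chartConj (G := G)).fderiv contDiffAt_const le_rfl
  exact h.congr_of_eventuallyEq
    (Filter.Eventually.of_forall fun u => ((hasFDerivAt_chartConj u).fderiv).symm)

/-- Smoothness at 1 comes from joint smoothness of conjugation in the chart; it is carried to g by
Ad_h = Ad_g ∘ Ad_{g⁻¹h}. -/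
theorem contMDiff_Ad : ContMDiff 𝓘(ℝ, EG) 𝓘(ℝ, EG →L[ℝ] EG) ∞ (fun g : G => Ad (EG := EG) g) := by
  have h1 : ContMDiffAt 𝓘(ℝ, EG) 𝓘(ℝ, EG →L[ℝ] EG) ∞ (fun g : G => Ad (EG := EG) g) 1 := by
    have h := (contMDiffAt_iff_contDiffAt.2 (contDiffAt_Ad_chart (G := G))).comp (1 : G)
      (contMDiffAt_extChartAt (I := 𝓘(ℝ, EG)) (n := ∞) (x := (1 : G)))
    refine h.congr_of_eventuallyEq ?_
    filter_upwards [extChartAt_source_mem_nhds (I := 𝓘(ℝ, EG)) (1 : G)] with g hg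
    simp only [Function.comp_apply]
    rw [(extChartAt 𝓘(ℝ, EG) (1 : G)).left_inv hg]
  intro g
  have h2 : ContMDiffAt 𝓘(ℝ, EG) 𝓘(ℝ, EG) ∞ (fun h : G => g⁻¹ * h) g :=
    contMDiff_mul_left.contMDiffAt
  have h3 : ContMDiffAt 𝓘(ℝ, EG) 𝓘(ℝ, EG →L[ℝ] EG) ∞ (fun h : G => Ad (EG := EG) (g⁻¹ * h)) g :=
    ContMDiffAt.comp g (by rwa [inv_mul_cancel]) h2
  have h4 := (contMDiffAt_const (c := Ad (EG := EG) g)).clm_comp h3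
  refine h4.congr_of_eventuallyEq (Filter.Eventually.of_forall fun h => ?_)
  simp only
  rw [← Ad_mul, mul_inv_cancel_left]

/-- Both sides are derivatives at b = 1 of the product ub, written once as (ubu⁻¹)u. Differentiated
in u, this identity relates the derivative of Ad to second derivatives of the multiplication. -/
theorem fderiv_chartMul_Ad (w : EG) {u : EG}
    (hu : u ∈ (extChartAt 𝓘(ℝ, EG) (1 : G)).target) :
    fderiv ℝ (chartMul G) (chartOne G, u)
        (Ad (EG := EG) ((extChartAt 𝓘(ℝ, EG) (1 : G)).symm u) w, (0 : EG)) =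
      fderiv ℝ (chartMul G) (u, chartOne G) ((0 : EG), w) := by
  set φ := extChartAt 𝓘(ℝ, EG) (1 : G) with hφ
  have hone : chartConj G u (chartOne G) = chartOne G := by
    simp only [chartConj, extChartAt_symm_chartOne, mul_one, mul_inv_cancel]
    rfl
  have h1 : HasFDerivAt (fun b : EG => chartMul G (chartConj G u b, u))
      ((fderiv ℝ (chartMul G) (chartOne G, u)).comp
        ((ContinuousLinearMap.inl ℝ EG EG).comp (Ad (EG := EG) (φ.symm u)))) (chartOne G) := by
    have h := ((contDiffAt_chartMul_right hu).differentiableAt (by simp)).hasFDerivAt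
    rw [← hone] at h
    have h' := h.comp (chartOne G) ((hasFDerivAt_prodMk_left (𝕜 := ℝ) (chartConj G u (chartOne G))
      u).comp (chartOne G) (hasFDerivAt_chartConj u))
    rwa [hone] at h'
  have h2 : HasFDerivAt (fun b : EG => chartMul G (u, b))
      ((fderiv ℝ (chartMul G) (u, chartOne G)).comp (ContinuousLinearMap.inr ℝ EG EG))
      (chartOne G) :=
    ((contDiffAt_chartMul_left hu).differentiableAt (by simp)).hasFDerivAt.comp (chartOne G)
      (hasFDerivAt_prodMk_right u (chartOne G))
  have h3 : (fun b : EG => chartMul G (u, b)) =ᶠ[𝓝 (chartOne G)]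
      fun b : EG => chartMul G (chartConj G u b, u) := by
    have hc : ContinuousAt (fun b : EG => φ.symm u * φ.symm b * (φ.symm u)⁻¹) (chartOne G) := by
      have h : ContMDiffAt 𝓘(ℝ, EG) 𝓘(ℝ, EG) ∞
          (fun b : EG => φ.symm u * φ.symm b * (φ.symm u)⁻¹) (chartOne G) :=
        (contMDiffAt_const.mul (contMDiffAt_extChartAt_symm_of_mem (chartOne_mem_target (EG := EG) (G := G)))).mul
          contMDiffAt_const
      exact h.continuousAt
    have hs : φ.source ∈ 𝓝 (φ.symm u * φ.symm (chartOne G) * (φ.symm u)⁻¹) := by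
      rw [extChartAt_symm_chartOne, mul_one, mul_inv_cancel]
      exact extChartAt_source_mem_nhds (I := 𝓘(ℝ, EG)) (1 : G)
    filter_upwards [hc.preimage_mem_nhds hs] with b hb
    simp only [chartMul, chartConj]
    rw [φ.left_inv hb, inv_mul_cancel_right]
  exact congrArg (fun T : EG →L[ℝ] EG => T w) (h1.unique (h2.congr_of_eventuallyEq h3.symm))

/-- The derivative of the adjoint action at `1` is the bracket. -/
theorem mfderiv_Ad_apply (v w : EG) :
    (mfderiv 𝓘(ℝ, EG) 𝓘(ℝ, EG) (fun g : G => (Ad (EG := EG) g w : EG)) 1 v : EG) =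
      Bracket.bracket (L := GroupLieAlgebra 𝓘(ℝ, EG) G) (M := GroupLieAlgebra 𝓘(ℝ, EG) G)
        v w := by
  set φ := extChartAt 𝓘(ℝ, EG) (1 : G) with hφ
  set M2 := fderiv ℝ (fderiv ℝ (chartMul (EG := EG) G)) (chartOne G, chartOne G) with hM2
  obtain ⟨A', hA'⟩ : ∃ A' : EG →L[ℝ] EG,
      HasFDerivAt (fun u : EG => (Ad (EG := EG) (φ.symm u) w : EG)) A' (chartOne G) :=
    ⟨_, (((contDiffAt_Ad_chart (G := G)).clm_apply (contDiffAt_const (c := (w : EG)))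
      ).differentiableAt (by simp)).hasFDerivAt⟩
  have hA0 : (Ad (EG := EG) (φ.symm (chartOne G)) w : EG) = w := by
    rw [extChartAt_symm_chartOne, Ad_one]; rfl
  have hd : HasMFDerivAt 𝓘(ℝ, EG) 𝓘(ℝ, EG) (fun g : G => (Ad (EG := EG) g w : EG)) 1 A' := by
    have h := (hA'.hasMFDerivAt).comp (1 : G) (hasMFDerivAt_extChartAt_self (1 : G))
    refine HasMFDerivAt.congr_of_eventuallyEq (f' := A') h ?_
    filter_upwards [extChartAt_source_mem_nhds (I := 𝓘(ℝ, EG)) (1 : G)] with g hg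
    simp only [Function.comp_apply]
    rw [← hφ, φ.left_inv hg]
  have h1 : ContDiffAt ℝ 1 (fderiv ℝ (chartMul G)) (chartOne G, chartOne G) :=
    (contDiffAt_chartMul_left (chartOne_mem_target (EG := EG) (G := G))).fderiv_right (m := 1)
      one_add_one_le_infty
  have h2 : HasFDerivAt (fun u : EG => fderiv ℝ (chartMul G) (chartOne G, u))
      (M2.comp (ContinuousLinearMap.inr ℝ EG EG)) (chartOne G) :=
    ((h1.differentiableAt (by simp)).hasFDerivAt).comp (chartOne G)
      (hasFDerivAt_prodMk_right (chartOne G) (chartOne G))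
  -- The two sides of `fderiv_chartMul_Ad` are now differentiated at u = 1. On the left, u occurs
  -- both in the derivative of the multiplication and in Ad, which gives A' v and a
  -- second-derivative term.
  have h3 := h2.clm_apply ((ContinuousLinearMap.inl ℝ EG EG).hasFDerivAt.comp (chartOne G) hA')
  have h4 := (hasFDerivAt_chartMul_right (G := G) w).congr_of_eventuallyEq
    (f₁ := fun u => fderiv ℝ (chartMul G) (chartOne G, u)
      ((ContinuousLinearMap.inl ℝ EG EG) (Ad (EG := EG) (φ.symm u) w))) (by
      filter_upwards [eventually_mem_target (G := G)] with u hu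
      exact fderiv_chartMul_Ad w hu)
  have h5 := congrArg (fun T : EG →L[ℝ] EG => T v) (h3.unique h4)
  have hval : ∀ x : EG, fderiv ℝ (chartMul G) (chartOne G, chartOne G) (x, (0 : EG)) = x := by
    intro x
    have h1 : HasFDerivAt (fun b : EG => chartMul G (b, chartOne G))
        ((fderiv ℝ (chartMul G) (chartOne G, chartOne G)).comp
          (ContinuousLinearMap.inl ℝ EG EG)) (chartOne G) :=
      ((contDiffAt_chartMul_left (chartOne_mem_target (EG := EG) (G := G))).differentiableAt
        (by simp)).hasFDerivAt.comp (chartOne G)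
        (f := fun e => (e, chartOne G)) (hasFDerivAt_prodMk_left (chartOne G) (chartOne G))
    have h2 : HasFDerivAt (fun b : EG => chartMul G (b, chartOne G))
        (ContinuousLinearMap.id ℝ EG) (chartOne G) := by
      refine (hasFDerivAt_id _).congr_of_eventuallyEq ?_
      filter_upwards [eventually_mem_target (G := G)] with u hu
      exact chartMul_one_right hu
    exact congrArg (fun T : EG →L[ℝ] EG => T x) (h1.unique h2)
  -- Symmetry of the second derivative identifies the extra term with the second term of the
  -- bracket.
  have hsymm : M2 ((0, v) : EG × EG) ((w, 0) : EG × EG) =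
      M2 ((w, 0) : EG × EG) ((0, v) : EG × EG) := by
    refine ((contDiffAt_chartMul_left (chartOne_mem_target (EG := EG) (G := G))).isSymmSndFDerivAt ?_).eq _ _
    rw [minSmoothness_of_isRCLikeNormedField, ← one_add_one_eq_two]
    exact one_add_one_le_infty
  have h6 : A' v + M2 ((0, v) : EG × EG) ((w, 0) : EG × EG) =
      M2 ((v, 0) : EG × EG) ((0, w) : EG × EG) := by
    have h7 : fderiv ℝ (chartMul G) (chartOne G, chartOne G) ((A' v, 0) : EG × EG) +
        M2 ((0, v) : EG × EG) ((Ad (EG := EG) (φ.symm (chartOne G)) w, 0) : EG × EG) =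
          M2 ((v, 0) : EG × EG) ((0, w) : EG × EG) := h5
    rwa [hval, hA0] at h7
  refine Eq.trans ?_ (bracket_eq_chartMul (G := G) v w).symm
  refine (congrArg (fun T : EG →L[ℝ] EG => T v) hd.mfderiv).trans ?_
  rw [← hM2, eq_sub_iff_add_eq, ← h6, hsymm]

end Ad

/-! ### The inverse function theorem on an open set -/

section InverseFunction

variable {E : Type*} [NormedAddCommGroup E] [NormedSpace ℝ E] [CompleteSpace E]
  {E' : Type*} [NormedAddCommGroup E'] [NormedSpace ℝ E']

/-- The inverse function theorem, with smooth local inverse on an open set. -/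
theorem exists_openPartialHomeomorph_contDiffOn {f : E → E'} {U : Set E} (hU : IsOpen U)
    (hf : ContDiffOn ℝ ∞ f U) {a : E} (ha : a ∈ U) {e : E ≃L[ℝ] E'}
    (he : HasFDerivAt f (e : E →L[ℝ] E') a) :
    ∃ θ : OpenPartialHomeomorph E E', a ∈ θ.source ∧ θ.source ⊆ U ∧ ⇑θ = f ∧
      ContDiffOn ℝ ∞ θ.symm θ.target := by
  have hfa : ContDiffAt ℝ ∞ f a := hf.contDiffAt (hU.mem_nhds ha)
  set θ₀ := hfa.toOpenPartialHomeomorph f he (by simp) with hθ₀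
  have hcont : ContinuousOn (fderiv ℝ f) U :=
    hf.continuousOn_fderiv_of_isOpen hU (by simp)
  -- Invertibility of the derivative at a alone gives smoothness of the inverse at f(a) only. On the
  -- open set V the derivative is invertible everywhere, so the inverse is smooth on its whole
  -- domain.
  set V : Set E := U ∩ fderiv ℝ f ⁻¹' Set.range ((↑) : (E ≃L[ℝ] E') → E →L[ℝ] E') with hV
  have hVo : IsOpen V := hcont.isOpen_inter_preimage hU ContinuousLinearEquiv.isOpen
  have haV : a ∈ V := ⟨ha, e, he.fderiv.symm⟩
  refine ⟨θ₀.restrOpen V hVo, ⟨hfa.mem_toOpenPartialHomeomorph_source he (by simp), haV⟩,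
    fun x hx => hx.2.1, rfl, ?_⟩
  intro y hy
  have hy' : (θ₀.restrOpen V hVo).symm y ∈ (θ₀.restrOpen V hVo).source :=
    (θ₀.restrOpen V hVo).map_target hy
  obtain ⟨e', he'⟩ := hy'.2.2
  have hxU : (θ₀.restrOpen V hVo).symm y ∈ U := hy'.2.1
  have hd : ContDiffAt ℝ ∞ f ((θ₀.restrOpen V hVo).symm y) := hf.contDiffAt (hU.mem_nhds hxU)
  refine ContDiffAt.contDiffWithinAt ?_
  refine (θ₀.restrOpen V hVo).contDiffAt_symm (f₀' := e') hy ?_ hd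
  rw [he']
  exact (hd.differentiableAt (by simp)).hasFDerivAt

end InverseFunction

/-! ### Slice charts and embedded submanifolds -/

section Slice

variable {E : Type*} [NormedAddCommGroup E] [NormedSpace ℝ E]
  {M : Type*} [TopologicalSpace M] [ChartedSpace E M]
  {E₁ : Type*} [NormedAddCommGroup E₁] [NormedSpace ℝ E₁]
  {W : Type*} [NormedAddCommGroup W] [NormedSpace ℝ W]

variable (E₁ W) in
/-- A smooth chart of `M` with values in `E₁ × W` in which `S` is the slice `E₁ × 0`. -/
structure SliceChart (S : Set M) where
  chart : OpenPartialHomeomorph M (E₁ × W)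
  contMDiffOn : ContMDiffOn 𝓘(ℝ, E) 𝓘(ℝ, E₁ × W) ∞ chart chart.source
  contMDiffOn_symm : ContMDiffOn 𝓘(ℝ, E₁ × W) 𝓘(ℝ, E) ∞ chart.symm chart.target
  mem_iff : ∀ y ∈ chart.source, y ∈ S ↔ (chart y).2 = 0

/-- A local homeomorphism to the model space that is smooth in both directions is a chart. -/
theorem mem_maximalAtlas_of_contMDiffOn [IsManifold 𝓘(ℝ, E) ∞ M] {e : OpenPartialHomeomorph M E}
    (h : ContMDiffOn 𝓘(ℝ, E) 𝓘(ℝ, E) ∞ e e.source)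
    (h' : ContMDiffOn 𝓘(ℝ, E) 𝓘(ℝ, E) ∞ e.symm e.target) :
    e ∈ IsManifold.maximalAtlas 𝓘(ℝ, E) ∞ M := by
  have key : ∀ g : OpenPartialHomeomorph E E, ContMDiffOn 𝓘(ℝ, E) 𝓘(ℝ, E) ∞ g g.source →
      ContMDiffOn 𝓘(ℝ, E) 𝓘(ℝ, E) ∞ g.symm g.target → g ∈ contDiffGroupoid ∞ 𝓘(ℝ, E) := by
    intro g h1 h2
    rw [contMDiffOn_iff_contDiffOn] at h1 h2
    rw [contDiffGroupoid, mem_groupoid_of_pregroupoid]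
    exact ⟨h1.mono (fun x hx => hx.1), h2.mono (fun x hx => hx.1)⟩
  rw [IsManifold.mem_maximalAtlas_iff]
  intro e' he'
  have h1 : ContMDiffOn 𝓘(ℝ, E) 𝓘(ℝ, E) ∞ e' e'.source :=
    contMDiffOn_of_mem_maximalAtlas (IsManifold.subset_maximalAtlas he')
  have h2 : ContMDiffOn 𝓘(ℝ, E) 𝓘(ℝ, E) ∞ e'.symm e'.target :=
    contMDiffOn_symm_of_mem_maximalAtlas (IsManifold.subset_maximalAtlas he')
  have k1 : ContMDiffOn 𝓘(ℝ, E) 𝓘(ℝ, E) ∞ (e.symm.trans e') (e.symm.trans e').source :=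
    h1.comp (h'.mono fun x hx => hx.1) fun x hx => hx.2
  have k2 : ContMDiffOn 𝓘(ℝ, E) 𝓘(ℝ, E) ∞ (e'.symm.trans e) (e'.symm.trans e).source :=
    h.comp (h2.mono fun x hx => hx.1) fun x hx => hx.2
  refine ⟨key _ k1 ?_, key _ k2 ?_⟩
  · exact k2
  · exact k1

/-- A smooth function with surjective derivative that locally cuts out `S` gives a slice chart. -/
theorem exists_sliceChart [IsManifold 𝓘(ℝ, E) ∞ M] [FiniteDimensional ℝ E]
    [FiniteDimensional ℝ E₁] [FiniteDimensional ℝ W] {S : Set M} {x : M} {h : M → W} {U : Set M}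
    (hU : IsOpen U) (hx : x ∈ U) (hh : ContMDiffOn 𝓘(ℝ, E) 𝓘(ℝ, W) ∞ h U)
    (hS : ∀ y ∈ U, y ∈ S ↔ h y = 0) {h' : E →L[ℝ] W}
    (hd : HasMFDerivAt 𝓘(ℝ, E) 𝓘(ℝ, W) h x h') (hsurj : Function.Surjective h')
    (hdim : Module.finrank ℝ E₁ + Module.finrank ℝ W = Module.finrank ℝ E) :
    ∃ c : SliceChart (E := E) E₁ W S, x ∈ c.chart.source ∧ c.chart.source ⊆ U := by
  have : CompleteSpace E := FiniteDimensional.complete ℝ E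
  have : CompleteSpace E₁ := FiniteDimensional.complete ℝ E₁
  have : CompleteSpace W := FiniteDimensional.complete ℝ W
  -- a linear map `P : E → E₁` that is an isomorphism on the kernel of `h'`
  obtain ⟨P, hP⟩ : ∃ P : E →L[ℝ] E₁, ∀ v, P v = 0 → h' v = 0 → v = 0 := by
    have hk : Module.finrank ℝ (LinearMap.ker (h' : E →ₗ[ℝ] W)) = Module.finrank ℝ E₁ := by
      have := LinearMap.finrank_range_add_finrank_ker (h' : E →ₗ[ℝ] W)
      rw [LinearMap.range_eq_top.2 hsurj, finrank_top] at this
      omega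
    obtain ⟨p, hp⟩ := (LinearMap.ker (h' : E →ₗ[ℝ] W)).subtype.exists_leftInverse_of_injective
      (Submodule.ker_subtype _)
    let ℓ := LinearEquiv.ofFinrankEq _ _ hk
    refine ⟨LinearMap.toContinuousLinearMap (ℓ.toLinearMap ∘ₗ p), fun v hv hv' => ?_⟩
    have h1 : p v = 0 := ℓ.injective (by simpa using hv)
    have h2 : p v = ⟨v, hv'⟩ := LinearMap.congr_fun hp ⟨v, hv'⟩
    exact congrArg Subtype.val (h2.symm.trans h1)
  have hinj : Function.Injective (P.prod h') := by
    rw [injective_iff_map_eq_zero]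
    intro v hv
    exact hP v (congrArg Prod.fst hv) (congrArg Prod.snd hv)
  let e : E ≃L[ℝ] E₁ × W := (LinearEquiv.ofInjectiveOfFinrankEq
    ((P.prod h' : E →L[ℝ] E₁ × W) : E →ₗ[ℝ] E₁ × W) hinj
    (by rw [Module.finrank_prod, hdim])).toContinuousLinearEquiv
  have hee : (e : E →L[ℝ] E₁ × W) = P.prod h' := by ext v <;> rfl
  set χ := chartAt E x with hχ
  have hχs : ContMDiffOn 𝓘(ℝ, E) 𝓘(ℝ, E) ∞ χ χ.source :=
    contMDiffOn_of_mem_maximalAtlas (IsManifold.chart_mem_maximalAtlas x)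
  have hχt : ContMDiffOn 𝓘(ℝ, E) 𝓘(ℝ, E) ∞ χ.symm χ.target :=
    contMDiffOn_symm_of_mem_maximalAtlas (IsManifold.chart_mem_maximalAtlas x)
  set V : Set E := χ.target ∩ χ.symm ⁻¹' U with hV
  have hVo : IsOpen V := χ.symm.isOpen_inter_preimage hU
  have hxs : x ∈ χ.source := mem_chart_source E x
  have hxV : χ x ∈ V := ⟨χ.map_source hxs, by simpa [χ.left_inv hxs] using hx⟩
  -- The slice chart is (P, h) read in a chart of M. Its derivative at the point is (P, h'),
  -- injective by the choice of P and hence invertible by dimension.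
  have hΨ : ContDiffOn ℝ ∞ (fun u : E => (P u, h (χ.symm u))) V := by
    refine (P.contDiff.contDiffOn).prodMk ?_
    rw [← contMDiffOn_iff_contDiffOn]
    exact hh.comp (hχt.mono fun u hu => hu.1) fun u hu => hu.2
  have hΨ' : HasFDerivAt (fun u : E => (P u, h (χ.symm u))) (e : E →L[ℝ] E₁ × W) (χ x) := by
    rw [hee]
    refine P.hasFDerivAt.prodMk ?_
    have h1 := hasMFDerivAt_extChartAt_symm_self (E := E) x
    have h2 : HasMFDerivAt 𝓘(ℝ, E) 𝓘(ℝ, W) h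
        ((extChartAt 𝓘(ℝ, E) x).symm (extChartAt 𝓘(ℝ, E) x x)) h' := by
      rwa [extChartAt_to_inv]
    exact hasMFDerivAt_iff_hasFDerivAt.1 (h2.comp _ h1)
  obtain ⟨θ, hθx, hθV, hθ, hθs⟩ := exists_openPartialHomeomorph_contDiffOn hVo hΨ hxV hΨ'
  refine ⟨⟨χ.trans θ, ?_, ?_, ?_⟩, ⟨hxs, hθx⟩, ?_⟩
  · refine ContMDiffOn.comp (t := V) (I' := 𝓘(ℝ, E)) ?_ (hχs.mono fun y hy => hy.1)
      fun y hy => hθV hy.2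
    rw [contMDiffOn_iff_contDiffOn]
    change ContDiffOn ℝ ∞ θ V
    rw [hθ]
    exact hΨ
  · exact hχt.comp ((contMDiffOn_iff_contDiffOn.2 hθs).mono fun y hy => hy.1) fun y hy => hy.2
  · intro y hy
    have h1 : χ.symm (χ y) = y := χ.left_inv hy.1
    have h2 : y ∈ U := by
      have : χ.symm (χ y) ∈ U := (hθV hy.2).2
      rwa [h1] at this
    rw [hS y h2]
    simp only [OpenPartialHomeomorph.coe_trans, Function.comp_apply, hθ, h1]
  · intro y hy
    have h1 : χ.symm (χ y) = y := χ.left_inv hy.1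
    have : χ.symm (χ y) ∈ U := (hθV hy.2).2
    rwa [h1] at this

namespace SliceChart

variable {S : Set M} (c : SliceChart (E := E) E₁ W S)

open Classical in
/-- The inverse of the chart of `S` induced by a slice chart. -/
def inv (x₀ : S) (u : E₁) : S :=
  -- The value x₀ is a default; it is never taken when (u, 0) lies in the target of the chart.
  if h : c.chart.symm (u, 0) ∈ S then ⟨c.chart.symm (u, 0), h⟩ else x₀

theorem symm_mem {u : E₁} (hu : (u, (0 : W)) ∈ c.chart.target) : c.chart.symm (u, 0) ∈ S := by
  rw [c.mem_iff _ (c.chart.map_target hu), c.chart.right_inv hu]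

theorem coe_inv (x₀ : S) {u : E₁} (hu : (u, (0 : W)) ∈ c.chart.target) :
    (c.inv x₀ u : M) = c.chart.symm (u, 0) := by
  rw [inv, dif_pos (c.symm_mem hu)]

theorem chart_eq {y : M} (hy : y ∈ c.chart.source) (hyS : y ∈ S) :
    ((c.chart y).1, (0 : W)) = c.chart y :=
  Prod.ext rfl ((c.mem_iff y hy).1 hyS).symm

/-- The chart of `S` induced by a slice chart. -/
def subtypeChart (x₀ : S) : OpenPartialHomeomorph S E₁ where
  toFun y := (c.chart y).1
  invFun := c.inv x₀
  source := Subtype.val ⁻¹' c.chart.source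
  target := {u | (u, (0 : W)) ∈ c.chart.target}
  map_source' y hy := by
    change ((c.chart y).1, (0 : W)) ∈ c.chart.target
    rw [c.chart_eq hy y.2]
    exact c.chart.map_source hy
  map_target' u hu := by
    change (c.inv x₀ u : M) ∈ c.chart.source
    rw [c.coe_inv x₀ hu]
    exact c.chart.map_target hu
  left_inv' y hy := by
    have hy' : ((c.chart y).1, (0 : W)) ∈ c.chart.target := by
      rw [c.chart_eq hy y.2]
      exact c.chart.map_source hy
    refine Subtype.ext ?_
    rw [c.coe_inv x₀ hy', c.chart_eq hy y.2, c.chart.left_inv hy]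
  right_inv' u hu := by
    rw [c.coe_inv x₀ hu, c.chart.right_inv hu]
  open_source := c.chart.open_source.preimage continuous_subtype_val
  open_target := c.chart.open_target.preimage (Continuous.prodMk_left 0)
  continuousOn_toFun := continuous_fst.comp_continuousOn
    (c.chart.continuousOn.comp continuous_subtype_val.continuousOn fun _ hy => hy)
  continuousOn_invFun := by
    rw [Topology.IsInducing.subtypeVal.continuousOn_iff]
    refine ContinuousOn.congr (f := fun u : E₁ => c.chart.symm (u, 0)) ?_
      fun u hu => c.coe_inv x₀ hu
    exact c.chart.continuousOn_symm.comp (Continuous.prodMk_left 0).continuousOn fun _ hu => hu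

/-- The smooth retraction onto `S` near the domain of a slice chart. -/
def retraction (x₀ : S) (y : M) : S := c.inv x₀ (c.chart y).1

end SliceChart

section Submanifold

variable {S : Set M} (c : ∀ _ : S, SliceChart (E := E) E₁ W S)
  (hc : ∀ x : S, (x : M) ∈ (c x).chart.source)

/-- The atlas of `S` induced by slice charts. -/
abbrev sliceChartedSpace : ChartedSpace E₁ S where
  atlas := Set.range fun x => (c x).subtypeChart x
  chartAt x := (c x).subtypeChart x
  mem_chart_source x := hc x
  chart_mem_atlas x := Set.mem_range_self x

theorem contMDiff_prodMk_zero :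
    ContMDiff 𝓘(ℝ, E₁) 𝓘(ℝ, E₁ × W) ∞ (fun u : E₁ => (u, (0 : W))) :=
  (contDiff_id.prodMk contDiff_const).contMDiff

theorem isManifold_sliceChartedSpace :
    letI := sliceChartedSpace c hc
    IsManifold 𝓘(ℝ, E₁) ∞ S := by
  let _ := sliceChartedSpace c hc
  refine isManifold_of_contDiffOn 𝓘(ℝ, E₁) ∞ S ?_
  rintro _ _ ⟨x, rfl⟩ ⟨y, rfl⟩
  have h1 : ContDiffOn ℝ ∞ (fun u : E₁ => ((c y).chart ((c x).chart.symm (u, 0))).1)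
      (((c x).subtypeChart x).symm.trans ((c y).subtypeChart y)).source := by
    refine contDiff_fst.comp_contDiffOn (contMDiffOn_iff_contDiffOn.1 ?_)
    refine (c y).contMDiffOn.comp (((c x).contMDiffOn_symm.comp
      (contMDiff_prodMk_zero.contMDiffOn) fun u hu => hu.1)) ?_
    intro u hu
    have h2 : (((c x).inv x u : S) : M) ∈ (c y).chart.source := hu.2
    rwa [(c x).coe_inv x hu.1] at h2
  refine (h1.mono fun u hu => hu.1).congr fun u hu => ?_
  have h3 : (((c x).inv x u : S) : M) = (c x).chart.symm (u, 0) := (c x).coe_inv x hu.1.1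
  change ((c y).chart ((c x).inv x u)).1 = _
  rw [h3]

/-- In the induced chart and the slice chart the inclusion is u ↦ (u, 0), the normal form of an
immersion with complement W. The equivalences only serve to turn slice charts into charts with
values in the model space E. -/
theorem isSmoothEmbedding_sliceChartedSpace [IsManifold 𝓘(ℝ, E) ∞ M]
    (equiv : S → (E₁ × W) ≃L[ℝ] E) :
    letI := sliceChartedSpace c hc
    IsSmoothEmbedding 𝓘(ℝ, E₁) 𝓘(ℝ, E) ∞ (Subtype.val : S → M) := by
  let _ := sliceChartedSpace c hc
  have := isManifold_sliceChartedSpace c hc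
  refine ⟨IsImmersionOfComplement.isImmersion (F := W) fun x => ?_, .subtypeVal⟩
  set ψ : OpenPartialHomeomorph M E := (c x).chart.trans
    (equiv x).toHomeomorph.toOpenPartialHomeomorph with hψ
  refine IsImmersionAtOfComplement.mk_of_charts (equiv x) (chartAt E₁ x) ψ (mem_chart_source E₁ x)
    ⟨hc x, trivial⟩ (IsManifold.chart_mem_maximalAtlas x) ?_ (fun y hy => ⟨hy, trivial⟩) ?_
  · refine mem_maximalAtlas_of_contMDiffOn ?_ ?_
    · exact ((equiv x).contDiff.contMDiff.comp_contMDiffOn (c x).contMDiffOn).mono fun y hy => hy.1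
    · exact (c x).contMDiffOn_symm.comp ((equiv x).symm.contDiff.contMDiff.contMDiffOn)
        fun u hu => hu.2
  · intro u hu
    have hu' : (u, (0 : W)) ∈ (c x).chart.target := by
      have : u ∈ ((chartAt E₁ x).extend 𝓘(ℝ, E₁)).target := hu
      rw [OpenPartialHomeomorph.extend_target] at this
      exact this.1
    change equiv x ((c x).chart ((c x).inv x u)) = equiv x (u, 0)
    rw [(c x).coe_inv x hu', (c x).chart.right_inv hu']

variable (E₁) in
/-- `S` is an embedded submanifold of `M`, and locally a smooth retract of `M`. -/
structure IsSubmanifold (S : Set M) [ChartedSpace E₁ S] : Prop where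
  isSmoothEmbedding : IsSmoothEmbedding 𝓘(ℝ, E₁) 𝓘(ℝ, E) ∞ (Subtype.val : S → M)
  exists_retraction : ∀ x : S, ∃ U : Set M, IsOpen U ∧ (x : M) ∈ U ∧ ∃ r : M → S,
    ContMDiffOn 𝓘(ℝ, E) 𝓘(ℝ, E₁) ∞ r U ∧ ∀ y : S, (y : M) ∈ U → r y = y

namespace IsSubmanifold

variable {S : Set M} [ChartedSpace E₁ S]

theorem contMDiff_val (hS : IsSubmanifold (E := E) E₁ S) :
    ContMDiff 𝓘(ℝ, E₁) 𝓘(ℝ, E) ∞ (Subtype.val : S → M) :=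
  hS.isSmoothEmbedding.contMDiff

/-- A continuous map into S is smooth if it is smooth into M, because the inclusion is an immersion;
continuity is automatic in the subspace topology. -/
theorem contMDiffAt_iff (hS : IsSubmanifold (E := E) E₁ S)
    {EN : Type*} [NormedAddCommGroup EN] [NormedSpace ℝ EN] {HN : Type*} [TopologicalSpace HN]
    {I : ModelWithCorners ℝ EN HN} {N : Type*} [TopologicalSpace N] [ChartedSpace HN N]
    {f : N → S} {p : N} :
    ContMDiffAt I 𝓘(ℝ, E₁) ∞ f p ↔ ContMDiffAt I 𝓘(ℝ, E) ∞ (fun q => (f q : M)) p := by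
  rw [ContMDiffAt.iff_comp_isImmersionAt (hS.isSmoothEmbedding.isImmersion.isImmersionAt (f p))]
  refine ⟨fun h => h.2, fun h => ⟨?_, h⟩⟩
  exact Topology.IsInducing.subtypeVal.continuousAt_iff.2 h.continuousAt

theorem contMDiff_iff (hS : IsSubmanifold (E := E) E₁ S)
    {EN : Type*} [NormedAddCommGroup EN] [NormedSpace ℝ EN] {HN : Type*} [TopologicalSpace HN]
    {I : ModelWithCorners ℝ EN HN} {N : Type*} [TopologicalSpace N] [ChartedSpace HN N]
    {f : N → S} :
    ContMDiff I 𝓘(ℝ, E₁) ∞ f ↔ ContMDiff I 𝓘(ℝ, E) ∞ (fun q => (f q : M)) :=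
  forall_congr' fun _ => hS.contMDiffAt_iff

theorem mdifferentiableAt_val (hS : IsSubmanifold (E := E) E₁ S) (x : S) :
    MDifferentiableAt 𝓘(ℝ, E₁) 𝓘(ℝ, E) (Subtype.val : S → M) x :=
  (hS.contMDiff_val x).mdifferentiableAt (by simp)

theorem mfderiv_retraction_comp (hS : IsSubmanifold (E := E) E₁ S) {U : Set M} (hU : IsOpen U)
    {r : M → S} (hr : ContMDiffOn 𝓘(ℝ, E) 𝓘(ℝ, E₁) ∞ r U)
    (hrS : ∀ y : S, (y : M) ∈ U → r y = y) {x : S} (hx : (x : M) ∈ U) (w : E₁) :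
    (mfderiv 𝓘(ℝ, E) 𝓘(ℝ, E₁) r (x : M)
      (mfderiv 𝓘(ℝ, E₁) 𝓘(ℝ, E) (Subtype.val : S → M) x w : E) : E₁) = w := by
  have h1 : MDifferentiableAt 𝓘(ℝ, E) 𝓘(ℝ, E₁) r (x : M) :=
    (hr.contMDiffAt (hU.mem_nhds hx)).mdifferentiableAt (by simp)
  have h2 := (h1.hasMFDerivAt.comp x (hS.mdifferentiableAt_val x).hasMFDerivAt)
  have h3 : HasMFDerivAt 𝓘(ℝ, E₁) 𝓘(ℝ, E₁) (r ∘ (Subtype.val : S → M)) x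
      (ContinuousLinearMap.id ℝ E₁) := by
    refine (hasMFDerivAt_id x).congr_of_eventuallyEq ?_
    filter_upwards [(hU.preimage continuous_subtype_val).mem_nhds hx] with y hy
    exact hrS y hy
  -- Tangent spaces are the model space by definition. Evaluating equal derivatives there avoids
  -- comparing base points that agree only propositionally; the same device recurs below.
  have h4 : ∀ T T' : E₁ →L[ℝ] E₁, T = T' → T w = T' w := by rintro T _ rfl; rfl
  exact h4 _ _ (hasMFDerivAt_unique h2 h3)

theorem injective_mfderiv_val (hS : IsSubmanifold (E := E) E₁ S) (x : S) :
    Function.Injective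
      (mfderiv 𝓘(ℝ, E₁) 𝓘(ℝ, E) (Subtype.val : S → M) x : E₁ →L[ℝ] E) := by
  obtain ⟨U, hU, hx, r, hr, hrS⟩ := hS.exists_retraction x
  intro v w hvw
  have hv := hS.mfderiv_retraction_comp hU hr hrS hx v
  have hw := hS.mfderiv_retraction_comp hU hr hrS hx w
  exact hv.symm.trans ((congrArg (mfderiv 𝓘(ℝ, E) 𝓘(ℝ, E₁) r (x : M) : E →L[ℝ] E₁) hvw).trans hw)

/-- A function that is constant on `S` has vanishing derivative in the directions of `S`. -/
theorem mfderiv_val_eq_zero {V : Type*} [NormedAddCommGroup V] [NormedSpace ℝ V]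
    (hS : IsSubmanifold (E := E) E₁ S) {x : S} {f : M → V} {f' : E →L[ℝ] V}
    (hf : HasMFDerivAt 𝓘(ℝ, E) 𝓘(ℝ, V) f (x : M) f') {U : Set M} (hU : U ∈ 𝓝 (x : M)) {v : V}
    (hv : ∀ y ∈ U, y ∈ S → f y = v) (w : E₁) :
    f' (mfderiv 𝓘(ℝ, E₁) 𝓘(ℝ, E) (Subtype.val : S → M) x w : E) = 0 := by
  have h1 := hf.comp x (hS.mdifferentiableAt_val x).hasMFDerivAt
  have h2 : HasMFDerivAt 𝓘(ℝ, E₁) 𝓘(ℝ, V) (f ∘ (Subtype.val : S → M)) x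
      (0 : E₁ →L[ℝ] V) := by
    refine (hasMFDerivAt_const v x).congr_of_eventuallyEq ?_
    filter_upwards [continuous_subtype_val.continuousAt.preimage_mem_nhds hU] with y hy
    exact hv y hy y.2
  have h4 : ∀ T T' : E₁ →L[ℝ] V, T = T' → T w = T' w := by rintro T _ rfl; rfl
  exact h4 _ _ (hasMFDerivAt_unique h1 h2)

/-- The tangent space of a level set is the kernel of the derivative. -/
theorem exists_mfderiv_val_eq {V : Type*} [NormedAddCommGroup V] [NormedSpace ℝ V]
    [FiniteDimensional ℝ E] [FiniteDimensional ℝ E₁]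
    (hS : IsSubmanifold (E := E) E₁ S) {x : S} {f : M → V} {f' : E →L[ℝ] V}
    (hf : HasMFDerivAt 𝓘(ℝ, E) 𝓘(ℝ, V) f (x : M) f') {U : Set M} (hU : U ∈ 𝓝 (x : M)) {v : V}
    (hv : ∀ y ∈ U, y ∈ S → f y = v)
    (hdim : Module.finrank ℝ (LinearMap.ker (f' : E →ₗ[ℝ] V)) ≤ Module.finrank ℝ E₁)
    {e : E} (he : f' e = 0) :
    ∃ w : E₁, (mfderiv 𝓘(ℝ, E₁) 𝓘(ℝ, E) (Subtype.val : S → M) x w : E) = e := by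
  let T : E₁ →L[ℝ] E := mfderiv 𝓘(ℝ, E₁) 𝓘(ℝ, E) (Subtype.val : S → M) x
  have hle : LinearMap.range (T : E₁ →ₗ[ℝ] E) ≤ LinearMap.ker (f' : E →ₗ[ℝ] V) := by
    rintro _ ⟨w, rfl⟩
    exact hS.mfderiv_val_eq_zero hf hU hv w
  have hrank : Module.finrank ℝ (LinearMap.range (T : E₁ →ₗ[ℝ] E)) = Module.finrank ℝ E₁ :=
    LinearMap.finrank_range_of_inj (hS.injective_mfderiv_val x)
  have heq := Submodule.eq_of_le_of_finrank_le hle (by rw [hrank]; exact hdim)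
  have : e ∈ LinearMap.range (T : E₁ →ₗ[ℝ] E) := by rw [heq]; exact he
  exact this

end IsSubmanifold

/-- The regular level set theorem: a subset that is locally a level set of submersions to a fixed
vector space is an embedded submanifold. -/
theorem exists_isSubmanifold [IsManifold 𝓘(ℝ, E) ∞ M] [FiniteDimensional ℝ E]
    [FiniteDimensional ℝ E₁] [FiniteDimensional ℝ W] {S : Set M}
    (hS : ∀ x ∈ S, ∃ (h : M → W) (h' : E →L[ℝ] W) (U : Set M), IsOpen U ∧ x ∈ U ∧
      ContMDiffOn 𝓘(ℝ, E) 𝓘(ℝ, W) ∞ h U ∧ (∀ y ∈ U, y ∈ S ↔ h y = 0) ∧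
      HasMFDerivAt 𝓘(ℝ, E) 𝓘(ℝ, W) h x h' ∧ Function.Surjective h' ∧
      Module.finrank ℝ E₁ + Module.finrank ℝ W = Module.finrank ℝ E) :
    ∃ (_ : ChartedSpace E₁ S) (_ : IsManifold 𝓘(ℝ, E₁) ∞ S), IsSubmanifold (E := E) E₁ S := by
  have h1 : ∀ x : S, ∃ c : SliceChart (E := E) E₁ W S, (x : M) ∈ c.chart.source := by
    intro x
    obtain ⟨h, h', U, hU, hx, hh, hSU, hd, hsurj, hdim⟩ := hS x x.2
    obtain ⟨c, hc, -⟩ := exists_sliceChart (E₁ := E₁) hU hx hh hSU hd hsurj hdim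
    exact ⟨c, hc⟩
  have h2 : ∀ x : S, Nonempty ((E₁ × W) ≃L[ℝ] E) := by
    intro x
    obtain ⟨h, h', U, hU, hx, hh, hSU, hd, hsurj, hdim⟩ := hS x x.2
    exact ⟨ContinuousLinearEquiv.ofFinrankEq (by rw [Module.finrank_prod, hdim])⟩
  choose c hc using h1
  let _ := sliceChartedSpace c hc
  have hM : IsManifold 𝓘(ℝ, E₁) ∞ S := isManifold_sliceChartedSpace c hc
  have hemb := isSmoothEmbedding_sliceChartedSpace c hc fun x => (h2 x).some
  refine ⟨sliceChartedSpace c hc, hM, hemb, fun x => ?_⟩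
  set ψ := (c x).chart with hψ
  have hcont : ContinuousOn (fun y => ((ψ y).1, (0 : W))) ψ.source :=
    (Continuous.prodMk_left (0 : W)).comp_continuousOn
      (continuous_fst.comp_continuousOn ψ.continuousOn)
  -- In the slice chart the retraction is (u, w) ↦ (u, 0). The open set consists of the points whose
  -- projection stays in the target of the chart.
  refine ⟨ψ.source ∩ (fun y => ((ψ y).1, (0 : W))) ⁻¹' ψ.target,
    hcont.isOpen_inter_preimage ψ.open_source ψ.open_target, ⟨hc x, ?_⟩, (c x).retraction x, ?_, ?_⟩
  · change ((ψ x).1, (0 : W)) ∈ ψ.target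
    rw [(c x).chart_eq (hc x) x.2]
    exact ψ.map_source (hc x)
  · have h3 : ContMDiffOn 𝓘(ℝ, E) 𝓘(ℝ, E) ∞ (fun y => ψ.symm ((ψ y).1, (0 : W)))
        (ψ.source ∩ (fun y => ((ψ y).1, (0 : W))) ⁻¹' ψ.target) := by
      refine (c x).contMDiffOn_symm.comp (contMDiff_prodMk_zero.comp_contMDiffOn
        (contDiff_fst.contMDiff.comp_contMDiffOn
          ((c x).contMDiffOn.mono fun y hy => hy.1))) fun y hy => hy.2
    have hopen := hcont.isOpen_inter_preimage ψ.open_source ψ.open_target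
    intro y hy
    refine ContMDiffAt.contMDiffWithinAt ?_
    rw [ContMDiffAt.iff_comp_isImmersionAt (hemb.isImmersion.isImmersionAt _)]
    have h4 : (Subtype.val ∘ (c x).retraction x) =ᶠ[𝓝 y] fun y => ψ.symm ((ψ y).1, (0 : W)) := by
      filter_upwards [hopen.mem_nhds hy] with z hz
      exact (c x).coe_inv x hz.2
    have h5 := (h3.contMDiffAt (hopen.mem_nhds hy)).congr_of_eventuallyEq h4
    exact ⟨Topology.IsInducing.subtypeVal.continuousAt_iff.2 h5.continuousAt, h5⟩
  · intro y hy
    refine Subtype.ext ?_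
    change ((c x).inv x (ψ y).1 : M) = y
    rw [(c x).coe_inv x hy.2, (c x).chart_eq hy.1 y.2, ψ.left_inv hy.1]

end Submanifold

end Slice

/-! ### Smooth subbundles over a submanifold -/

section Subbundle

variable {E : Type*} [NormedAddCommGroup E] [NormedSpace ℝ E]
  {M : Type*} [TopologicalSpace M] [ChartedSpace E M]
  {F : Type*} [NormedAddCommGroup F] [NormedSpace ℝ F]
  {A : M → Type*} [∀ x, AddCommGroup (A x)] [∀ x, Module ℝ (A x)] [∀ x, TopologicalSpace (A x)]
  [TopologicalSpace (TotalSpace F A)] [FiberBundle F A] [VectorBundle ℝ F A]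
  {S : Set M} {F₁ : Type*} [NormedAddCommGroup F₁] [NormedSpace ℝ F₁]

variable (E F F₁) in
/-- Smooth coordinates on a family `B` of subspaces of the fibres of `A` over a neighbourhood `U` of
a point `x₀` of `S`: in the trivialization of `A` at `x₀`, the fibre `B y` is parametrized by the
injective linear map `Q y : F₁ → F`, with left inverse `P y`. -/
structure SubbundleChart (B : ∀ x : S, Submodule ℝ (A x)) (x₀ : S) where
  U : Set M
  isOpen : IsOpen U
  mem : (x₀ : M) ∈ U
  subset : U ⊆ (trivializationAt F A (x₀ : M)).baseSet
  P : M → F →L[ℝ] F₁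
  Q : M → F₁ →L[ℝ] F
  contMDiffOn_P : ContMDiffOn 𝓘(ℝ, E) 𝓘(ℝ, F →L[ℝ] F₁) ∞ P U
  contMDiffOn_Q : ContMDiffOn 𝓘(ℝ, E) 𝓘(ℝ, F₁ →L[ℝ] F) ∞ Q U
  symm_mem : ∀ (y : S) (u : F₁), (y : M) ∈ U → (trivializationAt F A (x₀ : M)).symm y (Q y u) ∈ B y
  P_Q : ∀ (y : S) (u : F₁), (y : M) ∈ U → P y (Q y u) = u
  Q_P : ∀ (y : S) (b : B y), (y : M) ∈ U →
    Q y (P y (trivializationAt F A (x₀ : M) ⟨y, b⟩).2) = (trivializationAt F A (x₀ : M) ⟨y, b⟩).2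

namespace SubbundleChart

variable {B : ∀ x : S, Submodule ℝ (A x)} {x₀ : S} (c : SubbundleChart E F F₁ B x₀)

/-- The pretrivialization defined by smooth coordinates. -/
def pretrivialization : Pretrivialization F₁ (π F₁ (fun x : S => B x)) where
  toFun b := (b.1, c.P b.1 (trivializationAt F A (x₀ : M) ⟨b.1, b.2⟩).2)
  -- Over U the vector described lies in B and is the only candidate; elsewhere the choice is
  -- arbitrary and plays no role.
  invFun p := ⟨p.1, Classical.epsilon fun b : B p.1 =>
    (b : A p.1) = (trivializationAt F A (x₀ : M)).symm p.1 (c.Q p.1 p.2)⟩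
  source := {b | (b.1 : M) ∈ c.U}
  target := {p | (p.1 : M) ∈ c.U}
  map_source' b hb := hb
  map_target' p hp := hp
  left_inv' b hb := by
    refine congrArg (TotalSpace.mk b.1) (Subtype.ext ?_)
    refine (Classical.epsilon_spec (p := fun b' : B b.1 => (b' : A b.1) =
      (trivializationAt F A (x₀ : M)).symm b.1
        (c.Q b.1 (c.P b.1 (trivializationAt F A (x₀ : M) ⟨b.1, b.2⟩).2)))
      ⟨⟨_, c.symm_mem b.1 _ hb⟩, rfl⟩).trans ?_
    rw [c.Q_P b.1 b.2 hb]
    exact (trivializationAt F A (x₀ : M)).symm_apply_apply_mk (c.subset hb) _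
  right_inv' p hp := by
    have h := Classical.epsilon_spec (p := fun b' : B p.1 => (b' : A p.1) =
      (trivializationAt F A (x₀ : M)).symm p.1 (c.Q p.1 p.2)) ⟨⟨_, c.symm_mem p.1 _ hp⟩, rfl⟩
    refine Prod.ext rfl ?_
    dsimp only
    rw [h, (trivializationAt F A (x₀ : M)).apply_mk_symm (c.subset hp)]
    exact c.P_Q p.1 p.2 hp
  open_target := (c.isOpen.preimage continuous_subtype_val).preimage continuous_fst
  baseSet := Subtype.val ⁻¹' c.U
  open_baseSet := c.isOpen.preimage continuous_subtype_val
  source_eq := rfl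
  target_eq := by ext p; simp
  proj_toFun b hb := rfl

theorem pretrivialization_apply (b : TotalSpace F₁ (fun x : S => B x)) :
    c.pretrivialization b = (b.1, c.P b.1 (trivializationAt F A (x₀ : M) ⟨b.1, b.2⟩).2) := rfl

theorem coe_pretrivialization_symm {y : S} (hy : (y : M) ∈ c.U) (u : F₁) :
    (c.pretrivialization.symm y u : A y) =
      (trivializationAt F A (x₀ : M)).symm y (c.Q y u) := by
  have h := Classical.epsilon_spec (p := fun b' : B y => (b' : A y) =
      (trivializationAt F A (x₀ : M)).symm y (c.Q y u)) ⟨⟨_, c.symm_mem y _ hy⟩, rfl⟩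
  rw [← h]
  congr 1
  have h2 := c.pretrivialization.mk_symm (b := y) hy u
  exact eq_of_heq (TotalSpace.mk.inj h2).2

end SubbundleChart

section Prebundle

variable {B : ∀ x : S, Submodule ℝ (A x)} (c : ∀ x : S, SubbundleChart E F F₁ B x)
  [ContMDiffVectorBundle ∞ F A 𝓘(ℝ, E)]
  {E₁ : Type*} [NormedAddCommGroup E₁] [NormedSpace ℝ E₁] [ChartedSpace E₁ S]

/-- The coordinate changes between smooth coordinates on `B`. -/
def subbundleCoordChange (x x' y : S) : F₁ →L[ℝ] F₁ :=
  ((c x').P y).comp (((((trivializationAt F A (x : M)).coordChangeL ℝ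
    (trivializationAt F A (x' : M)) (y : M) : F ≃L[ℝ] F) : F →L[ℝ] F)).comp ((c x).Q y))

theorem contMDiffOn_subbundleCoordChange (hS : IsSubmanifold (E := E) E₁ S) (x x' : S) :
    ContMDiffOn 𝓘(ℝ, E₁) 𝓘(ℝ, F₁ →L[ℝ] F₁) ∞ (subbundleCoordChange c x x')
      ((c x).pretrivialization.baseSet ∩ (c x').pretrivialization.baseSet) := by
  have hv : ContMDiffOn 𝓘(ℝ, E₁) 𝓘(ℝ, E) ∞ (Subtype.val : S → M)
      ((c x).pretrivialization.baseSet ∩ (c x').pretrivialization.baseSet) :=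
    hS.contMDiff_val.contMDiffOn
  have hP := (c x').contMDiffOn_P.comp hv fun y hy => hy.2
  have hQ := (c x).contMDiffOn_Q.comp hv fun y hy => hy.1
  have hC := (contMDiffOn_coordChangeL (n := ∞) (IB := 𝓘(ℝ, E)) (𝕜 := ℝ)
    (trivializationAt F A (x : M)) (trivializationAt F A (x' : M))).comp hv
      fun y hy => ⟨(c x).subset hy.1, (c x').subset hy.2⟩
  exact hP.clm_comp (hC.clm_comp hQ)

omit [ContMDiffVectorBundle ∞ F A 𝓘(ℝ, E)] [ChartedSpace E₁ S] in
theorem subbundleCoordChange_apply (x x' y : S)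
    (hy : y ∈ (c x).pretrivialization.baseSet ∩ (c x').pretrivialization.baseSet) (u : F₁) :
    subbundleCoordChange c x x' y u =
      ((c x').pretrivialization ⟨y, (c x).pretrivialization.symm y u⟩).2 := by
  rw [SubbundleChart.pretrivialization_apply]
  dsimp only
  rw [(c x).coe_pretrivialization_symm hy.1]
  simp only [subbundleCoordChange, ContinuousLinearMap.comp_apply, ContinuousLinearEquiv.coe_coe]
  rw [(trivializationAt F A (x : M)).coordChangeL_apply (trivializationAt F A (x' : M))
    ⟨(c x).subset hy.1, (c x').subset hy.2⟩]

/-- The vector prebundle defined by smooth coordinates on `B`. -/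
abbrev subbundlePrebundle (hS : IsSubmanifold (E := E) E₁ S) :
    VectorPrebundle ℝ F₁ (fun x : S => B x) where
  pretrivializationAtlas := Set.range fun x => (c x).pretrivialization
  pretrivialization_linear' := by
    rintro _ ⟨x, rfl⟩
    refine ⟨fun y hy => ?_⟩
    have h := (trivializationAt F A (x : M)).linear ℝ ((c x).subset hy)
    constructor
    · intro a b
      change (c x).P y (trivializationAt F A (x : M) ⟨y, (a : A y) + b⟩).2 = _
      rw [h.map_add, map_add]
      rfl
    · intro r a
      change (c x).P y (trivializationAt F A (x : M) ⟨y, r • (a : A y)⟩).2 = _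
      rw [h.map_smul, map_smul]
      rfl
  pretrivializationAt x := (c x).pretrivialization
  mem_base_pretrivializationAt x := (c x).mem
  pretrivialization_mem_atlas x := Set.mem_range_self x
  exists_coordChange := by
    rintro _ ⟨x, rfl⟩ _ ⟨x', rfl⟩
    exact ⟨subbundleCoordChange c x x', (contMDiffOn_subbundleCoordChange c hS x x').continuousOn,
      fun y hy u => subbundleCoordChange_apply c x x' y hy u⟩
  totalSpaceMk_isInducing x := by
    have hx : (x : M) ∈ (trivializationAt F A (x : M)).baseSet := (c x).subset (c x).mem
    set ε := (trivializationAt F A (x : M)).continuousLinearEquivAt ℝ (x : M) hx with hε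
    have hi : IsInducing (fun b : B x => ε b) :=
      ε.toHomeomorph.isInducing.comp Topology.IsInducing.subtypeVal
    -- Followed by Q, the coordinate P recovers the trivialization of A restricted to the subspace,
    -- which is inducing. Since both maps are continuous, the first one is inducing too.
    have h1 : IsInducing ((fun p : S × F₁ => (c x).Q x p.2) ∘
        ((c x).pretrivialization ∘ TotalSpace.mk x)) := by
      have : ((fun p : S × F₁ => (c x).Q x p.2) ∘
        ((c x).pretrivialization ∘ TotalSpace.mk x)) = fun b : B x => ε b := by
        funext b
        exact (c x).Q_P x b (c x).mem
      rw [this]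
      exact hi
    refine Topology.IsInducing.of_comp ?_ ?_ h1
    · have : ((c x).pretrivialization ∘ TotalSpace.mk x) = fun b : B x => (x, (c x).P x (ε b)) := rfl
      rw [this]
      exact continuous_const.prodMk (((c x).P x).continuous.comp hi.continuous)
    · exact ((c x).Q x).continuous.comp continuous_snd

/-- The inclusion into `A` of a family `B` of subspaces of the fibres of `A` over points of `S`. -/
def subIncl (F₁ : Type*) (B : ∀ x : S, Submodule ℝ (A x)) (b : TotalSpace F₁ (fun x : S => B x)) :
    TotalSpace F A :=
  ⟨b.1, b.2⟩

variable (E F E₁) in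
/-- The vector bundle `B → S` is a smooth subbundle of `A → M`: the inclusion is smooth and the
trivializations of `B` are restrictions of smooth maps defined on open subsets of `A`. -/
structure IsSubbundle (B : ∀ x : S, Submodule ℝ (A x))
    [TopologicalSpace (TotalSpace F₁ (fun x : S => B x))] [FiberBundle F₁ (fun x : S => B x)] :
    Prop where
  contMDiff_incl : ContMDiff (𝓘(ℝ, E₁).prod 𝓘(ℝ, F₁)) (𝓘(ℝ, E).prod 𝓘(ℝ, F)) ∞
    (subIncl (F := F) F₁ B)
  exists_coord : ∀ x : S, ∃ U : Set M, IsOpen U ∧ (x : M) ∈ U ∧ ∃ K : TotalSpace F A → F₁,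
    ContMDiffOn (𝓘(ℝ, E).prod 𝓘(ℝ, F)) 𝓘(ℝ, F₁) ∞ K {a | a.1 ∈ U} ∧
      ∀ b : TotalSpace F₁ (fun x : S => B x), (b.1 : M) ∈ U →
        (trivializationAt F₁ (fun x : S => B x) x b).2 = K (subIncl F₁ B b)

/-- In coordinates the inclusion is (y, u) ↦ Q y u, and the trivialization of B is P applied to that
of A. As P and Q are smooth on open sets of M, not just along S, both are smooth in the sense
required. -/
theorem exists_isSubbundle [IsManifold 𝓘(ℝ, E₁) ∞ S]
    (c : ∀ x : S, SubbundleChart E F F₁ B x) (hS : IsSubmanifold (E := E) E₁ S) :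
    ∃ (_ : TopologicalSpace (TotalSpace F₁ (fun x : S => B x)))
      (_ : FiberBundle F₁ (fun x : S => B x)) (_ : VectorBundle ℝ F₁ (fun x : S => B x))
      (_ : ContMDiffVectorBundle ∞ F₁ (fun x : S => B x) 𝓘(ℝ, E₁)),
      IsSubbundle E F E₁ (F₁ := F₁) B := by
  set a := subbundlePrebundle c hS with ha
  have hsm : a.IsContMDiff 𝓘(ℝ, E₁) ∞ := by
    refine ⟨?_⟩
    rintro _ ⟨x, rfl⟩ _ ⟨x', rfl⟩
    exact ⟨subbundleCoordChange c x x', contMDiffOn_subbundleCoordChange c hS x x',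
      fun y hy u => subbundleCoordChange_apply c x x' y hy u⟩
  let i1 := a.totalSpaceTopology
  let i2 := a.toFiberBundle
  let i3 := a.toVectorBundle
  have i4 := a.contMDiffVectorBundle (n := ∞) 𝓘(ℝ, E₁)
  have htriv : ∀ (x : S) (b : TotalSpace F₁ (fun x : S => B x)),
      trivializationAt F₁ (fun x : S => B x) x b =
        (b.1, (c x).P b.1 (trivializationAt F A (x : M) ⟨b.1, b.2⟩).2) := fun x b => rfl
  refine ⟨i1, i2, i3, i4, ?_, ?_⟩
  · intro b₀
    have hx : (b₀.1 : M) ∈ (c b₀.1).U := (c b₀.1).mem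
    rw [(trivializationAt F A (b₀.1 : M)).contMDiffAt_iff
      ((Trivialization.mem_source _).2 ((c b₀.1).subset hx))]
    have hproj : ContMDiffAt (𝓘(ℝ, E₁).prod 𝓘(ℝ, F₁)) 𝓘(ℝ, E) ∞
        (fun b : TotalSpace F₁ (fun x : S => B x) => (b.1 : M)) b₀ :=
      (hS.contMDiff_val _).comp b₀ (contMDiffAt_proj _)
    refine ⟨hproj, ?_⟩
    have h1 : ContMDiffAt (𝓘(ℝ, E₁).prod 𝓘(ℝ, F₁)) 𝓘(ℝ, F₁) ∞
        (fun b => (trivializationAt F₁ (fun x : S => B x) b₀.1 b).2) b₀ :=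
      (contMDiffAt_totalSpace.1 contMDiffAt_id).2
    have h2 := ContMDiffAt.comp b₀ ((c b₀.1).contMDiffOn_Q.contMDiffAt
      ((c b₀.1).isOpen.mem_nhds hx)) hproj
    refine (h2.clm_apply h1).congr_of_eventuallyEq ?_
    filter_upwards [hproj.continuousAt.preimage_mem_nhds ((c b₀.1).isOpen.mem_nhds hx)] with b hb
    exact ((c b₀.1).Q_P b.1 b.2 hb).symm
  · intro x
    refine ⟨(c x).U, (c x).isOpen, (c x).mem,
      fun p => (c x).P p.1 (trivializationAt F A (x : M) p).2, ?_, fun b hb => ?_⟩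
    · have h1 := (c x).contMDiffOn_P.comp (contMDiff_proj (n := ∞) (F := F) (IB := 𝓘(ℝ, E)) A
        ).contMDiffOn (s := {p : TotalSpace F A | p.1 ∈ (c x).U}) fun p hp => hp
      have h2 := ((trivializationAt F A (x : M)).contMDiffOn (IB := 𝓘(ℝ, E)) (n := ∞)).mono
        (t := {p : TotalSpace F A | p.1 ∈ (c x).U}) fun p hp =>
          (Trivialization.mem_source _).2 ((c x).subset hp)
      exact h1.clm_apply (contMDiff_snd.comp_contMDiffOn h2)
    · rw [htriv]
      rfl

end Prebundle

namespace IsSubbundle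

variable {B : ∀ x : S, Submodule ℝ (A x)}
  {E₁ : Type*} [NormedAddCommGroup E₁] [NormedSpace ℝ E₁] [ChartedSpace E₁ S]
  [TopologicalSpace (TotalSpace F₁ (fun x : S => B x))] [FiberBundle F₁ (fun x : S => B x)]
  {EN : Type*} [NormedAddCommGroup EN] [NormedSpace ℝ EN] {HN : Type*} [TopologicalSpace HN]
  {I : ModelWithCorners ℝ EN HN} {N : Type*} [TopologicalSpace N] [ChartedSpace HN N]

/-- The fibre coordinate of a map into B is a smooth function K, defined on an open part of A, of
its image in A. So smoothness into B can be tested in A. -/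
theorem contMDiffAt_iff (hS : IsSubmanifold (E := E) E₁ S)
    (hB : IsSubbundle E F E₁ (F₁ := F₁) B) {f : N → TotalSpace F₁ (fun x : S => B x)} {p : N} :
    ContMDiffAt I (𝓘(ℝ, E₁).prod 𝓘(ℝ, F₁)) ∞ f p ↔
      ContMDiffAt I (𝓘(ℝ, E).prod 𝓘(ℝ, F)) ∞ (fun q => subIncl (F := F) F₁ B (f q)) p := by
  refine ⟨fun h => (hB.contMDiff_incl _).comp p h, fun h => ?_⟩
  have h1 : ContMDiffAt I 𝓘(ℝ, E) ∞ (fun q => ((f q).1 : M)) p :=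
    ContMDiffAt.comp (f := fun q => subIncl (F := F) F₁ B (f q)) p
      (contMDiffAt_proj (n := ∞) (F := F) (IB := 𝓘(ℝ, E)) A) h
  rw [contMDiffAt_totalSpace]
  refine ⟨hS.contMDiffAt_iff.2 h1, ?_⟩
  obtain ⟨U, hU, hpU, K, hK, hKb⟩ := hB.exists_coord (f p).1
  have hV : IsOpen {a : TotalSpace F A | a.1 ∈ U} := hU.preimage (FiberBundle.continuous_proj F A)
  refine ((hK.contMDiffAt (x := subIncl F₁ B (f p)) (hV.mem_nhds hpU)).comp p h
    ).congr_of_eventuallyEq ?_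
  filter_upwards [h1.continuousAt.preimage_mem_nhds (hU.mem_nhds hpU)] with q hq
  exact hKb (f q) hq

theorem contMDiff_iff (hS : IsSubmanifold (E := E) E₁ S)
    (hB : IsSubbundle E F E₁ (F₁ := F₁) B) {f : N → TotalSpace F₁ (fun x : S => B x)} :
    ContMDiff I (𝓘(ℝ, E₁).prod 𝓘(ℝ, F₁)) ∞ f ↔
      ContMDiff I (𝓘(ℝ, E).prod 𝓘(ℝ, F)) ∞ (fun q => subIncl (F := F) F₁ B (f q)) :=
  forall_congr' fun _ => contMDiffAt_iff hS hB

end IsSubbundle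
end Subbundle

/-! ### Rules for directional derivatives -/

section DirDeriv

variable {E : Type*} [NormedAddCommGroup E] [NormedSpace ℝ E]
  {H : Type*} [TopologicalSpace H] {I : ModelWithCorners ℝ E H}
  {M : Type*} [TopologicalSpace M] [ChartedSpace H M]

theorem dirDeriv_eq {f : M → ℝ} {x : M} {f' : E →L[ℝ] ℝ} (hf : HasMFDerivAt I 𝓘(ℝ, ℝ) f x f')
    (v : E) : dirDeriv I f x v = f' v := by
  have key : ∀ T T' : E →L[ℝ] ℝ, T = T' → T v = T' v := by rintro T _ rfl; rfl
  exact key _ _ hf.mfderiv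

theorem dirDeriv_add {f g : M → ℝ} {x : M} (hf : MDifferentiableAt I 𝓘(ℝ, ℝ) f x)
    (hg : MDifferentiableAt I 𝓘(ℝ, ℝ) g x) (v : TangentSpace I x) :
    dirDeriv I (fun y => f y + g y) x v = dirDeriv I f x v + dirDeriv I g x v :=
  dirDeriv_eq (hf.hasMFDerivAt.add hg.hasMFDerivAt) v

theorem dirDeriv_const_mul {f : M → ℝ} {x : M} (c : ℝ) (hf : MDifferentiableAt I 𝓘(ℝ, ℝ) f x)
    (v : TangentSpace I x) : dirDeriv I (fun y => c * f y) x v = c * dirDeriv I f x v :=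
  dirDeriv_eq (hf.hasMFDerivAt.const_smul c) v

theorem dirDeriv_mul {f g : M → ℝ} {x : M} (hf : MDifferentiableAt I 𝓘(ℝ, ℝ) f x)
    (hg : MDifferentiableAt I 𝓘(ℝ, ℝ) g x) (v : TangentSpace I x) :
    dirDeriv I (fun y => f y * g y) x v = f x * dirDeriv I g x v + g x * dirDeriv I f x v :=
  dirDeriv_eq (hf.hasMFDerivAt.mul hg.hasMFDerivAt) v

theorem dirDeriv_congr {f g : M → ℝ} {x : M} (h : f =ᶠ[𝓝 x] g) (v : TangentSpace I x) :
    dirDeriv I f x v = dirDeriv I g x v := by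
  have key : ∀ T T' : E →L[ℝ] ℝ, T = T' → T v = T' v := by rintro T _ rfl; rfl
  exact key _ _ h.mfderiv_eq

theorem dirDeriv_zero_right (f : M → ℝ) (x : M) : dirDeriv I f x 0 = 0 :=
  map_zero (mfderiv I 𝓘(ℝ, ℝ) f x)

theorem dirDeriv_add_right (f : M → ℝ) (x : M) (v w : TangentSpace I x) :
    dirDeriv I f x (v + w) = dirDeriv I f x v + dirDeriv I f x w :=
  map_add (mfderiv I 𝓘(ℝ, ℝ) f x) v w

theorem dirDeriv_smul_right (f : M → ℝ) (x : M) (c : ℝ) (v : TangentSpace I x) :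
    dirDeriv I f x (c • v) = c * dirDeriv I f x v :=
  map_smul (mfderiv I 𝓘(ℝ, ℝ) f x) c v

variable {E' : Type*} [NormedAddCommGroup E'] [NormedSpace ℝ E']
  {H' : Type*} [TopologicalSpace H'] {I' : ModelWithCorners ℝ E' H'}
  {N : Type*} [TopologicalSpace N] [ChartedSpace H' N]

theorem dirDeriv_comp {f : M → ℝ} {g : N → M} {p : N} {g' : E' →L[ℝ] E}
    (hf : MDifferentiableAt I 𝓘(ℝ, ℝ) f (g p)) (hg : HasMFDerivAt I' I g p g')
    (v : E') : dirDeriv I' (fun q => f (g q)) p v = dirDeriv I f (g p) (g' v) :=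
  dirDeriv_eq (hf.hasMFDerivAt.comp p hg) v

theorem contMDiff_dirDeriv [IsManifold I ∞ M] {f : M → ℝ}
    (hf : ContMDiff I 𝓘(ℝ, ℝ) ∞ f) {V : N → TangentBundle I M}
    (hV : ContMDiff I' I.tangent ∞ V) :
    ContMDiff I' 𝓘(ℝ, ℝ) ∞ (fun q => dirDeriv I f (V q).1 (V q).2) := by
  have h1 : ContMDiff I' 𝓘(ℝ, ℝ).tangent ∞ (fun q => tangentMap I 𝓘(ℝ, ℝ) f (V q)) :=
    (hf.contMDiff_tangentMap (m := ∞) (by simp)).comp hV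
  exact (contMDiff_snd_tangentBundle_modelSpace ℝ 𝓘(ℝ, ℝ)).comp h1

end DirDeriv

/-! ### Frames, extension of sections, tensoriality -/

section Sections

variable {E : Type*} [NormedAddCommGroup E] [NormedSpace ℝ E] [FiniteDimensional ℝ E]
  {M : Type*} [TopologicalSpace M] [T2Space M] [ChartedSpace E M] [IsManifold 𝓘(ℝ, E) ∞ M]

theorem exists_bump {x : M} {U : Set M} (hU : U ∈ 𝓝 x) :
    ∃ χ : M → ℝ, ContMDiff 𝓘(ℝ, E) 𝓘(ℝ, ℝ) ∞ χ ∧ tsupport χ ⊆ U ∧ χ =ᶠ[𝓝 x] 1 := by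
  obtain ⟨f, -, hf⟩ := (SmoothBumpFunction.nhds_basis_tsupport (I := 𝓘(ℝ, E)) x).mem_iff.1 hU
  exact ⟨f, f.contMDiff, hf, f.eventuallyEq_one⟩

variable {F : Type*} [NormedAddCommGroup F] [NormedSpace ℝ F]
  {A : M → Type*} [∀ x, AddCommGroup (A x)] [∀ x, Module ℝ (A x)] [∀ x, TopologicalSpace (A x)]
  [TopologicalSpace (TotalSpace F A)] [FiberBundle F A] [VectorBundle ℝ F A]
  [ContMDiffVectorBundle ∞ F A 𝓘(ℝ, E)]

omit [FiniteDimensional ℝ E] [T2Space M] [IsManifold 𝓘(ℝ, E) ∞ M] in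
theorem contMDiffOn_trivialization_symm {EN : Type*} [NormedAddCommGroup EN] [NormedSpace ℝ EN]
    {HN : Type*} [TopologicalSpace HN]
    {I : ModelWithCorners ℝ EN HN} {N : Type*} [TopologicalSpace N] [ChartedSpace HN N]
    (x : M) {U : Set N} {f : N → M} {g : N → F}
    (hf : ContMDiffOn I 𝓘(ℝ, E) ∞ f U) (hg : ContMDiffOn I 𝓘(ℝ, F) ∞ g U)
    (hU : ∀ q ∈ U, f q ∈ (trivializationAt F A x).baseSet) :
    ContMDiffOn I (𝓘(ℝ, E).prod 𝓘(ℝ, F)) ∞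
      (fun q => (⟨f q, (trivializationAt F A x).symm (f q) (g q)⟩ : TotalSpace F A)) U := by
  have h1 := ((trivializationAt F A x).contMDiffOn_symm (IB := 𝓘(ℝ, E)) (n := ∞)).comp
    (hf.prodMk hg) fun q hq => by
      rw [Set.mem_preimage, (trivializationAt F A x).mem_target]; exact hU q hq
  refine h1.congr fun q hq => ?_
  exact (trivializationAt F A x).mk_symm (hU q hq) (g q)

/-- Local frames: near each point, the identity of `A` is `∑ i, c i • e i` for finitely many smooth
sections `e i` of `A` and fibrewise linear smooth functions `c i` on `A`. -/
theorem exists_frame [FiniteDimensional ℝ F] (x : M) :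
    ∃ (n : ℕ) (U : Set M) (e : Fin n → Sec (E := E) F A) (c : Fin n → ∀ y, A y →ₗ[ℝ] ℝ),
      IsOpen U ∧ x ∈ U ∧
      (∀ i, ContMDiff (𝓘(ℝ, E).prod 𝓘(ℝ, F)) 𝓘(ℝ, ℝ) ∞
        (fun a : TotalSpace F A => c i a.1 a.2)) ∧
      ∀ y ∈ U, ∀ a : A y, a = ∑ i, c i y a • e i y := by
  set t := trivializationAt F A x with ht
  have hx : x ∈ t.baseSet := FiberBundle.mem_baseSet_trivializationAt' x
  obtain ⟨χ, hχ, hχs, hχ1⟩ := exists_bump (E := E) (t.open_baseSet.mem_nhds hx)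
  let b := Module.finBasis ℝ F
  obtain ⟨U, hUs, hU, hxU⟩ := mem_nhds_iff.1 (hχ1.and (t.open_baseSet.mem_nhds hx))
  have he : ∀ i, ContMDiff 𝓘(ℝ, E) (𝓘(ℝ, E).prod 𝓘(ℝ, F)) ∞
      (fun y => (⟨y, (χ • fun y => t.symm y (b i)) y⟩ : TotalSpace F A)) := fun i =>
    ContMDiffOn.smul_section_of_tsupport hχ.contMDiffOn t.open_baseSet hχs
      (contMDiffOn_trivialization_symm x contMDiffOn_id contMDiffOn_const fun y hy => hy)
  -- Frame and coordinate functions are both cut off by χ to make them global. They are dual to each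
  -- other only where χ = 1, hence the choice of U.
  refine ⟨_, U, fun i => ⟨_, he i⟩,
    fun i y => χ y • ((b.coord i).comp (t.linearMapAt ℝ y)), hU, hxU, fun i => ?_, ?_⟩
  · refine contMDiff_of_tsupport fun a ha => ?_
    have hproj : ContMDiff (𝓘(ℝ, E).prod 𝓘(ℝ, F)) 𝓘(ℝ, E) ∞ (fun a : TotalSpace F A => a.1) :=
      contMDiff_proj A
    have ha' : a.1 ∈ t.baseSet := by
      refine hχs (closure_minimal ?_ ((isClosed_tsupport χ).preimage hproj.continuous) ha)
      intro a ha
      refine subset_tsupport _ fun h0 => ha ?_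
      simp [h0]
    have h2 : ContMDiffAt (𝓘(ℝ, E).prod 𝓘(ℝ, F)) 𝓘(ℝ, F) ∞ (fun a : TotalSpace F A => (t a).2) a :=
      contMDiffAt_snd.comp a (((t.contMDiffOn (IB := 𝓘(ℝ, E)) (n := ∞)).contMDiffAt
        (t.open_source.mem_nhds (t.mem_source.2 ha'))))
    have h3 : ContMDiffAt (𝓘(ℝ, E).prod 𝓘(ℝ, F)) 𝓘(ℝ, ℝ) ∞
        (fun a : TotalSpace F A => χ a.1 * (b.coord i).toContinuousLinearMap (t a).2) a :=
      ((hχ _).comp a (hproj a)).mul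
        (((b.coord i).toContinuousLinearMap.contMDiff _).comp a h2)
    refine h3.congr_of_eventuallyEq ?_
    filter_upwards [hproj.continuous.continuousAt.preimage_mem_nhds
      (t.open_baseSet.mem_nhds ha')] with a' ha'
    simp only [LinearMap.smul_apply, LinearMap.comp_apply, smul_eq_mul]
    rw [t.linearMapAt_apply, if_pos (show a'.1 ∈ t.baseSet from ha')]
    rfl
  · intro y hy a
    have h1 : χ y = 1 := (hUs hy).1
    have h2 : y ∈ t.baseSet := (hUs hy).2
    simp only [LinearMap.comp_apply, h1, one_smul,
      ContMDiffSection.coeFn_mk, Pi.smul_apply', Module.Basis.coord_apply]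
    rw [t.linearMapAt_apply, if_pos h2]
    have h3 := b.sum_repr (t ⟨y, a⟩).2
    have h4 := congrArg (t.symmₗ ℝ y) h3
    rw [map_sum] at h4
    simp only [map_smul] at h4
    simp only [t.symmₗ_apply h2] at h4
    exact (h4.trans (t.symm_apply_apply_mk h2 a)).symm

omit [FiniteDimensional ℝ E] [T2Space M] [IsManifold 𝓘(ℝ, E) ∞ M]
  [ContMDiffVectorBundle ∞ F A 𝓘(ℝ, E)] in
@[simp]
theorem funSMul_apply {f : M → ℝ} (hf : ContMDiff 𝓘(ℝ, E) 𝓘(ℝ, ℝ) ∞ f) (X : Sec (E := E) F A)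
    (x : M) : funSMul f hf X x = f x • X x := rfl

omit [FiniteDimensional ℝ E] [T2Space M] [IsManifold 𝓘(ℝ, E) ∞ M]
  [ContMDiffVectorBundle ∞ F A 𝓘(ℝ, E)] in
theorem sec_sum_apply {ι : Type*} (s : Finset ι) (X : ι → Sec (E := E) F A) (x : M) :
    (∑ i ∈ s, X i) x = ∑ i ∈ s, X i x := by
  have h := map_sum (ContMDiffSection.coeAddHom 𝓘(ℝ, E) F ∞ A) X s
  simp only [ContMDiffSection.coeAddHom_apply] at h
  rw [h, Finset.sum_apply]

/-- Multiplied by a bump function, a section is a combination of finitely many global sections,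
whose coefficients vanish where the section does. -/
theorem exists_decomposition [FiniteDimensional ℝ F] (x : M) :
    ∃ (n : ℕ) (e : Fin n → Sec (E := E) F A) (χ : M → ℝ) (hχ : ContMDiff 𝓘(ℝ, E) 𝓘(ℝ, ℝ) ∞ χ),
      χ =ᶠ[𝓝 x] 1 ∧ ∀ Z : Sec (E := E) F A, ∃ (f : Fin n → M → ℝ)
        (hf : ∀ i, ContMDiff 𝓘(ℝ, E) 𝓘(ℝ, ℝ) ∞ (f i)),
        funSMul χ hχ Z = ∑ i, funSMul (f i) (hf i) (e i) ∧ ∀ y, Z y = 0 → ∀ i, f i y = 0 := by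
  obtain ⟨n, U, e, c, hU, hx, hc, he⟩ := exists_frame (E := E) (F := F) (A := A) x
  obtain ⟨χ, hχ, hχs, hχ1⟩ := exists_bump (E := E) (hU.mem_nhds hx)
  refine ⟨n, e, χ, hχ, hχ1, fun Z => ⟨fun i y => χ y * c i y (Z y),
    fun i => hχ.mul ((hc i).comp Z.contMDiff), ?_, fun y hy i => by simp [hy]⟩⟩
  ext y
  rw [sec_sum_apply]
  simp only [funSMul_apply]
  by_cases hy : y ∈ U
  · conv_lhs => rw [he y hy (Z y), Finset.smul_sum]
    simp only [smul_smul]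
  · have : χ y = 0 := image_eq_zero_of_notMem_tsupport fun h => hy (hχs h)
    simp [this]

/-- A tensorial functional on sections only depends on the value at the point. -/
theorem tensorial_eq_zero [FiniteDimensional ℝ F] {x : M} (T : Sec (E := E) F A →+ ℝ)
    (hT : ∀ (f : M → ℝ) (hf : ContMDiff 𝓘(ℝ, E) 𝓘(ℝ, ℝ) ∞ f) X, T (funSMul f hf X) = f x * T X)
    {Z : Sec (E := E) F A} (hZ : Z x = 0) : T Z = 0 := by
  obtain ⟨n, e, χ, hχ, hχ1, h⟩ := exists_decomposition (E := E) (F := F) (A := A) x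
  obtain ⟨f, hf, hfe, hf0⟩ := h Z
  have h1 := congrArg T hfe
  rw [hT, map_sum] at h1
  simp only [hT, hf0 x hZ, zero_mul, Finset.sum_const_zero] at h1
  rwa [show χ x = 1 from hχ1.self_of_nhds, one_mul] at h1

omit [ContMDiffVectorBundle ∞ F A 𝓘(ℝ, E)] in
/-- Sections defined near a closed set and prescribed on it extend to global sections. -/
theorem exists_sec_eqOn [SigmaCompactSpace M] {S : Set M} (hS : IsClosed S) (s : ∀ x : S, A x)
    (hloc : ∀ x : S, ∃ U ∈ 𝓝 (x : M), ∃ σ : ∀ y, A y,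
      ContMDiffOn 𝓘(ℝ, E) (𝓘(ℝ, E).prod 𝓘(ℝ, F)) ∞ (fun y => (⟨y, σ y⟩ : TotalSpace F A)) U ∧
        ∀ y : S, (y : M) ∈ U → σ y = s y) :
    ∃ X : Sec (E := E) F A, ∀ x : S, X x = s x := by
  -- The condition at y is a single point if y ∈ S and the whole fibre otherwise, which is convex in
  -- both cases. Local solutions can then be glued by a partition of unity; off S the zero section
  -- is one, as S is closed.
  obtain ⟨X, hX⟩ := exists_contMDiffSection_forall_mem_convex_of_local (I := 𝓘(ℝ, E)) (n := ⊤)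
    (F_fiber := F) A (fun y => {a | ∀ h : y ∈ S, a = s ⟨y, h⟩}) (fun y => by
      intro a ha b hb p q hp hq hpq h
      rw [ha h, hb h, ← add_smul, hpq, one_smul]) (fun x => by
      by_cases hx : x ∈ S
      · obtain ⟨U, hU, σ, hσ, hσs⟩ := hloc ⟨x, hx⟩
        exact ⟨U, hU, σ, hσ, fun y hy h => hσs ⟨y, h⟩ hy⟩
      · exact ⟨Sᶜ, hS.isOpen_compl.mem_nhds hx, fun y => 0,
          (contMDiff_zeroSection ℝ A).contMDiffOn, fun y hy h => absurd h hy⟩)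
  exact ⟨X, fun x => hX x x.2⟩

theorem exists_sec_apply_eq [SigmaCompactSpace M] (x : M) (a : A x) :
    ∃ X : Sec (E := E) F A, X x = a := by
  set t := trivializationAt F A x with ht
  have hx : x ∈ t.baseSet := FiberBundle.mem_baseSet_trivializationAt' x
  obtain ⟨X, hX⟩ := exists_sec_eqOn (E := E) (F := F) (A := A) (S := {x}) isClosed_singleton
    (fun y => t.symm y (t ⟨x, a⟩).2) fun y => ⟨t.baseSet, by
      obtain ⟨_, rfl⟩ := y
      exact t.open_baseSet.mem_nhds hx, fun y => t.symm y (t ⟨x, a⟩).2,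
      contMDiffOn_trivialization_symm x contMDiffOn_id contMDiffOn_const fun y hy => hy,
      fun _ _ => rfl⟩
  exact ⟨X, (hX ⟨x, rfl⟩).trans (t.symm_apply_apply_mk hx a)⟩

/-- The evaluation of sections at a point. -/
def secEval (x : M) : Sec (E := E) F A →ₗ[ℝ] A x where
  toFun X := X x
  map_add' _ _ := rfl
  map_smul' _ _ := rfl

/-- A linear choice of sections with given values at `x`. -/
theorem exists_linear_sec [SigmaCompactSpace M] (x : M) :
    ∃ σ : A x →ₗ[ℝ] Sec (E := E) F A, ∀ a, σ a x = a := by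
  obtain ⟨σ, hσ⟩ := (secEval (E := E) (F := F) (A := A) x).exists_rightInverse_of_surjective
    (LinearMap.range_eq_top.2 (exists_sec_apply_eq x))
  exact ⟨σ, fun a => LinearMap.congr_fun hσ a⟩

/-- Smoothness of a form is only known on sections. In a local frame the linear function is a sum of
the smooth fibre coordinates times the smooth functions α(eᵢ). -/
theorem contMDiff_linFun [FiniteDimensional ℝ F] {α : Form A 1}
    (hα : IsSmoothForm (E := E) F α) :
    ContMDiff (𝓘(ℝ, E).prod 𝓘(ℝ, F)) 𝓘(ℝ, ℝ) ∞ (linFun (F := F) α) := by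
  intro a₀
  obtain ⟨n, U, e, c, hU, hx, hc, he⟩ := exists_frame (E := E) (F := F) (A := A) a₀.1
  have hproj : ContMDiff (𝓘(ℝ, E).prod 𝓘(ℝ, F)) 𝓘(ℝ, E) ∞ (fun a : TotalSpace F A => a.1) :=
    contMDiff_proj A
  have h1 : ContMDiff (𝓘(ℝ, E).prod 𝓘(ℝ, F)) 𝓘(ℝ, ℝ) ∞
      (fun a : TotalSpace F A => ∑ i, c i a.1 a.2 * α a.1 (fun _ => e i a.1)) :=
    contMDiff_finsetSum fun i _ => (hc i).mul ((hα fun _ => e i).comp hproj)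
  refine (h1 a₀).congr_of_eventuallyEq ?_
  filter_upwards [hproj.continuous.continuousAt.preimage_mem_nhds (hU.mem_nhds hx)] with a ha
  let l : A a.1 →ₗ[ℝ] ℝ :=
    (α a.1).toMultilinearMap.toLinearMap (fun _ => 0) 0
  have hl : ∀ b, α a.1 (fun _ => b) = l b := fun b => by
    change _ = α a.1 (Function.update (fun _ => 0) 0 b)
    congr 1
    funext i
    rw [Subsingleton.elim i 0, Function.update_self]
  change α a.1 (fun _ => a.2) = _
  simp only [hl]
  conv_lhs => rw [he a.1 ha a.2, map_sum]
  simp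

/-- The `1`-form given by linear functionals on the fibres. -/
def oneForm (l : ∀ x, A x →ₗ[ℝ] ℝ) : Form A 1 := fun x =>
  AlternatingMap.ofSubsingleton ℝ (A x) ℝ (0 : Fin 1) (l x)

omit [TopologicalSpace M] [∀ x, TopologicalSpace (A x)] in
@[simp]
theorem oneForm_apply (l : ∀ x, A x →ₗ[ℝ] ℝ) (x : M) (v : Fin 1 → A x) :
    oneForm l x v = l x (v 0) := rfl

/-- Smooth `1`-forms separate the points of a fibre. -/
theorem eq_of_forall_isSmoothForm [FiniteDimensional ℝ F] {x : M} {a b : A x}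
    (h : ∀ l : ∀ y, A y →ₗ[ℝ] ℝ, IsSmoothForm (E := E) F (oneForm l) → l x a = l x b) : a = b := by
  obtain ⟨n, U, e, c, hU, hx, hc, he⟩ := exists_frame (E := E) (F := F) (A := A) x
  rw [he x hx a, he x hx b]
  refine Finset.sum_congr rfl fun i _ => ?_
  rw [h (c i) fun X => (hc i).comp (X 0).contMDiff]

end Sections

/-! ### Consequences of the Lie algebroid axioms -/

section AlgebroidBasics

variable {E : Type*} [NormedAddCommGroup E] [NormedSpace ℝ E] [FiniteDimensional ℝ E]
  {M : Type*} [TopologicalSpace M] [T2Space M] [ChartedSpace E M] [IsManifold 𝓘(ℝ, E) ∞ M]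
  {F : Type*} [NormedAddCommGroup F] [NormedSpace ℝ F]
  {A : M → Type*} [∀ x, AddCommGroup (A x)] [∀ x, Module ℝ (A x)] [∀ x, TopologicalSpace (A x)]
  [TopologicalSpace (TotalSpace F A)] [FiberBundle F A] [VectorBundle ℝ F A]

namespace LieAlgebroid

variable (L : LieAlgebroid (E := E) F A)

omit [FiniteDimensional ℝ E] [T2Space M] in
theorem bracket_skew (X Y : Sec (E := E) F A) : L.bracket X Y = -L.bracket Y X := by
  have h := L.bracket_self (X + Y)
  simp only [map_add, LinearMap.add_apply, L.bracket_self, zero_add, add_zero] at h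
  exact eq_neg_of_add_eq_zero_right h

omit [FiniteDimensional ℝ E] [T2Space M] in
theorem contMDiff_anchor_sec (X : Sec (E := E) F A) :
    ContMDiff 𝓘(ℝ, E) 𝓘(ℝ, E).tangent ∞
      (fun x => (⟨x, L.anchor x (X x)⟩ : TangentBundle 𝓘(ℝ, E) M)) :=
  L.contMDiff_anchor.comp X.contMDiff

omit [FiniteDimensional ℝ E] [T2Space M] in
theorem contMDiff_dirDeriv_anchor {f : M → ℝ} (hf : ContMDiff 𝓘(ℝ, E) 𝓘(ℝ, ℝ) ∞ f)
    (X : Sec (E := E) F A) :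
    ContMDiff 𝓘(ℝ, E) 𝓘(ℝ, ℝ) ∞ (fun x => dirDeriv 𝓘(ℝ, E) f x (L.anchor x (X x))) :=
  contMDiff_dirDeriv hf (L.contMDiff_anchor_sec X)

omit [FiniteDimensional ℝ E] [T2Space M] in
theorem bracket_funSMul {f : M → ℝ} (hf : ContMDiff 𝓘(ℝ, E) 𝓘(ℝ, ℝ) ∞ f)
    (X Y : Sec (E := E) F A) :
    L.bracket X (funSMul f hf Y) = funSMul f hf (L.bracket X Y) +
      funSMul _ (L.contMDiff_dirDeriv_anchor hf X) Y := by
  ext x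
  exact L.leibniz X Y f hf x

section

variable [ContMDiffVectorBundle ∞ F A 𝓘(ℝ, E)] [FiniteDimensional ℝ F]

/-- The value of `⟦X, Z⟧` at a point of `S` vanishes if `Z` vanishes on `S` and `ρ(X)` is tangent to
`S` at that point. -/
theorem bracket_apply_eq_zero {x : M} {S U : Set M} (hx : x ∈ S) (hU : U ∈ 𝓝 x)
    {X Z : Sec (E := E) F A} (hZ : ∀ y ∈ U, y ∈ S → Z y = 0)
    (hX : ∀ f : M → ℝ, ContMDiff 𝓘(ℝ, E) 𝓘(ℝ, ℝ) ∞ f → (∀ y ∈ U, y ∈ S → f y = 0) →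
      dirDeriv 𝓘(ℝ, E) f x (L.anchor x (X x)) = 0) :
    L.bracket X Z x = 0 := by
  -- Near x one has Z = ∑ fᵢ eᵢ with fᵢ zero wherever Z is. The Leibniz rule leaves fᵢ(x)⟦X, eᵢ⟧ and
  -- ρ(X)(fᵢ)eᵢ, and both coefficients vanish.
  obtain ⟨n, e, χ, hχ, hχ1, h⟩ := exists_decomposition (E := E) (F := F) (A := A) x
  obtain ⟨f, hf, hfe, hf0⟩ := h Z
  have hxU := mem_of_mem_nhds hU
  have h1 := congrArg (fun W => L.bracket X W x) hfe
  simp only [map_sum, sec_sum_apply, L.leibniz] at h1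
  rw [show χ x = 1 from hχ1.self_of_nhds, hZ x hxU hx, smul_zero, add_zero, one_smul] at h1
  rw [h1]
  refine Finset.sum_eq_zero fun i _ => ?_
  rw [hf0 x (hZ x hxU hx) i, hX (f i) (hf i) fun y hy hyS => hf0 y (hZ y hy hyS) i, zero_smul,
    zero_smul, add_zero]

omit [FiniteDimensional ℝ F] in
/-- The anchor maps brackets of sections to commutators of derivations. -/
theorem dirDeriv_anchor_bracket [SigmaCompactSpace M] {f : M → ℝ} (hf : ContMDiff 𝓘(ℝ, E) 𝓘(ℝ, ℝ) ∞ f)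
    (X Y : Sec (E := E) F A) (x : M) :
    dirDeriv 𝓘(ℝ, E) f x (L.anchor x (L.bracket X Y x)) =
      dirDeriv 𝓘(ℝ, E) (fun y => dirDeriv 𝓘(ℝ, E) f y (L.anchor y (Y y))) x (L.anchor x (X x)) -
      dirDeriv 𝓘(ℝ, E) (fun y => dirDeriv 𝓘(ℝ, E) f y (L.anchor y (X y))) x
        (L.anchor x (Y x)) := by
  -- The identity is the coefficient of Z in the Jacobi identity for X, Y, fZ, once that for X, Y, Z
  -- is subtracted. It can be read off if Z x ≠ 0; when the fibre is zero both sides vanish.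
  by_cases h0 : ∀ a : A x, a = 0
  · rw [h0 (L.bracket X Y x), h0 (X x), h0 (Y x)]
    simp [dirDeriv_zero_right]
  push Not at h0
  obtain ⟨z, hz⟩ := h0
  obtain ⟨Z, hZ⟩ := exists_sec_apply_eq (E := E) (F := F) x z
  have h := congrArg (fun W => W x) (L.jacobi X Y (funSMul f hf Z))
  simp only [L.bracket_funSMul, map_add, ContMDiffSection.coe_add, Pi.add_apply, funSMul_apply,
    hZ, L.jacobi X Y Z, smul_add] at h
  refine smul_left_injective ℝ hz ?_
  simp only [sub_smul]
  rw [eq_sub_iff_add_eq]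
  have h' := sub_eq_zero.2 h.symm
  rw [← sub_eq_zero, ← h']
  module

omit [FiniteDimensional ℝ E] [T2Space M] [ContMDiffVectorBundle ∞ F A 𝓘(ℝ, E)]
  [FiniteDimensional ℝ F] in
theorem isDifferential_one_iff {α : Form A 1} {β : Form A 2} :
    L.IsDifferential α β ↔ ∀ (X Y : Sec (E := E) F A) (x : M), β x ![X x, Y x] =
      dirDeriv 𝓘(ℝ, E) (fun y => α y (fun _ => Y y)) x (L.anchor x (X x)) -
        dirDeriv 𝓘(ℝ, E) (fun y => α y (fun _ => X y)) x (L.anchor x (Y x)) -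
        α x (fun _ => L.bracket X Y x) := by
  have key : ∀ (X : Fin 2 → Sec (E := E) F A) (x : M),
      (∑ i : Fin 2, (-1 : ℝ) ^ (i : ℕ) *
        dirDeriv 𝓘(ℝ, E) (fun y => α y (i.removeNth (fun l => X l y))) x (L.anchor x (X i x)))
      + L.bracketSum α X x =
      dirDeriv 𝓘(ℝ, E) (fun y => α y (fun _ => X 1 y)) x (L.anchor x (X 0 x)) -
        dirDeriv 𝓘(ℝ, E) (fun y => α y (fun _ => X 0 y)) x (L.anchor x (X 1 x)) -
        α x (fun _ => L.bracket (X 0) (X 1) x) := by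
    intro X x
    have h0 : ∀ y, (Fin.removeNth 0 (fun l => X l y) : Fin 1 → A y) = fun _ => X 1 y := by
      intro y; funext i; rw [Subsingleton.elim i 0]; rfl
    have h1 : ∀ y, (Fin.removeNth 1 (fun l => X l y) : Fin 1 → A y) = fun _ => X 0 y := by
      intro y; funext i; rw [Subsingleton.elim i 0]; rfl
    have h2 : ∀ (a : A x) (v : Fin 0 → A x), Matrix.vecCons a v = fun _ => a := by
      intro a v; funext i; rw [Subsingleton.elim i 0]; rfl
    rw [Fin.sum_univ_two]
    simp only [h0, h1, bracketSum, h2]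
    -- The only pair in the bracket sum is i = j = 0. It stands for the indices 0 < 1 and has sign
    -- -1.
    have h3 : Finset.Ici (0 : Fin 1) = {0} := rfl
    simp [h3]
    ring
  constructor
  · intro h X Y x
    have h1 := h ![X, Y] x
    rw [key] at h1
    have h2 : (fun i => (![X, Y] : Fin 2 → Sec (E := E) F A) i x) = ![X x, Y x] := by
      funext i; fin_cases i <;> rfl
    rw [h2] at h1
    exact h1
  · intro h X x
    rw [key, ← h]
    congr 1
    funext i; fin_cases i <;> rfl

/-- `ρ(X)(l(Y)) - ρ(Y)(l(X)) - l(⟦X, Y⟧)` as an additive function of `Y`. -/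
def oneFormDiff {l : ∀ x, A x →ₗ[ℝ] ℝ} (hl : IsSmoothForm (E := E) F (oneForm l)) (x : M)
    (X : Sec (E := E) F A) : Sec (E := E) F A →ₗ[ℝ] ℝ where
  toFun Y := dirDeriv 𝓘(ℝ, E) (fun y => l y (Y y)) x (L.anchor x (X x)) -
    dirDeriv 𝓘(ℝ, E) (fun y => l y (X y)) x (L.anchor x (Y x)) - l x (L.bracket X Y x)
  map_add' Y Z := by
    have hd : ∀ W : Sec (E := E) F A,
        MDifferentiableAt 𝓘(ℝ, E) 𝓘(ℝ, ℝ) (fun y => l y (W y)) x := fun W =>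
      (hl (fun _ => W) x).mdifferentiableAt (by simp)
    simp only [map_add, ContMDiffSection.coe_add, Pi.add_apply, dirDeriv_add_right]
    rw [dirDeriv_add (hd Y) (hd Z)]
    ring
  map_smul' c Y := by
    have hd : MDifferentiableAt 𝓘(ℝ, E) 𝓘(ℝ, ℝ) (fun y => l y (Y y)) x :=
      (hl (fun _ => Y) x).mdifferentiableAt (by simp)
    simp only [map_smul, ContMDiffSection.coe_smul, Pi.smul_apply, dirDeriv_smul_right, smul_eq_mul]
    rw [dirDeriv_const_mul c hd, RingHom.id_apply]
    ring

/-- Replacing Y by fY, the term ρ(X)(f) l(Y) from the derivative cancels the one from the bracket.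
The expression is therefore tensorial in Y. -/
theorem oneFormDiff_congr {l : ∀ x, A x →ₗ[ℝ] ℝ} (hl : IsSmoothForm (E := E) F (oneForm l))
    {x : M} (X : Sec (E := E) F A) {Y Y' : Sec (E := E) F A} (h : Y x = Y' x) :
    L.oneFormDiff hl x X Y = L.oneFormDiff hl x X Y' := by
  rw [← sub_eq_zero, ← map_sub]
  refine tensorial_eq_zero (x := x) (L.oneFormDiff hl x X).toAddMonoidHom (fun f hf Z => ?_)
    (by simp [h])
  have hd : MDifferentiableAt 𝓘(ℝ, E) 𝓘(ℝ, ℝ) (fun y => l y (Z y)) x :=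
    (hl (fun _ => Z) x).mdifferentiableAt (by simp)
  have hd' := (hf x).mdifferentiableAt (by simp)
  simp only [oneFormDiff, LinearMap.toAddMonoidHom_coe, LinearMap.coe_mk, AddHom.coe_mk,
    funSMul_apply, map_smul, L.bracket_funSMul, ContMDiffSection.coe_add, Pi.add_apply, map_add,
    smul_eq_mul, dirDeriv_smul_right]
  rw [dirDeriv_mul hd' hd]
  ring

omit [FiniteDimensional ℝ E] [T2Space M] [ContMDiffVectorBundle ∞ F A 𝓘(ℝ, E)]
  [FiniteDimensional ℝ F] in
theorem oneFormDiff_swap {l : ∀ x, A x →ₗ[ℝ] ℝ} (hl : IsSmoothForm (E := E) F (oneForm l))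
    (x : M) (X Y : Sec (E := E) F A) :
    L.oneFormDiff hl x X Y = -L.oneFormDiff hl x Y X := by
  simp only [oneFormDiff, LinearMap.coe_mk, AddHom.coe_mk]
  rw [L.bracket_skew X Y]
  simp only [ContMDiffSection.coe_neg, Pi.neg_apply, map_neg]
  ring

/-- Every smooth `1`-form has a differential. -/
theorem exists_isDifferential [SigmaCompactSpace M] {l : ∀ x, A x →ₗ[ℝ] ℝ}
    (hl : IsSmoothForm (E := E) F (oneForm l)) : ∃ β : Form A 2, L.IsDifferential (oneForm l) β := by
  -- The differential has to be evaluated on vectors of one fibre. They are extended to sections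
  -- linearly; tensoriality in both arguments makes the result independent of the extension.
  choose σ hσ using fun x => exists_linear_sec (E := E) (F := F) (A := A) x
  have hD : ∀ x (X Y : Sec (E := E) F A),
      L.oneFormDiff hl x (σ x (X x)) (σ x (Y x)) = L.oneFormDiff hl x X Y := by
    intro x X Y
    rw [L.oneFormDiff_congr hl _ (hσ x (Y x)), L.oneFormDiff_swap hl,
      L.oneFormDiff_congr hl _ (hσ x (X x)), ← L.oneFormDiff_swap hl]
  have hself : ∀ x (X : Sec (E := E) F A), L.oneFormDiff hl x X X = 0 := fun x X =>
    self_eq_neg.1 (L.oneFormDiff_swap hl x X X)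
  refine ⟨fun x => { toFun := fun v => L.oneFormDiff hl x (σ x (v 0)) (σ x (v 1)),
                     map_update_add' := ?_, map_update_smul' := ?_, map_eq_zero_of_eq' := ?_ }, ?_⟩
  · intro _ v i a b
    fin_cases i
    · simp only [Fin.zero_eta, Function.update_self, map_add,
        Function.update_of_ne (Fin.zero_ne_one (n := 0)).symm]
      rw [L.oneFormDiff_swap hl, map_add, neg_add, ← L.oneFormDiff_swap hl,
        ← L.oneFormDiff_swap hl]
    · simp only [Fin.mk_one, Function.update_self, map_add,
        Function.update_of_ne (Fin.zero_ne_one (n := 0))]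
  · intro _ v i c a
    fin_cases i
    · simp only [Fin.zero_eta, Function.update_self, map_smul,
        Function.update_of_ne (Fin.zero_ne_one (n := 0)).symm]
      rw [L.oneFormDiff_swap hl, map_smul, ← smul_neg, ← L.oneFormDiff_swap hl]
    · simp only [Fin.mk_one, Function.update_self, map_smul,
        Function.update_of_ne (Fin.zero_ne_one (n := 0))]
  · intro v i j hv hij
    have h01 : v 0 = v 1 := by
      fin_cases i <;> fin_cases j <;> first | exact absurd rfl hij | exact hv | exact hv.symm
    simp only [h01, hself]
  · rw [isDifferential_one_iff]
    intro X Y x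
    exact hD x X Y

end

end LieAlgebroid

end AlgebroidBasics

/-! ### Locally constant maps and the product rule -/

section Calculus

variable {E : Type*} [NormedAddCommGroup E] [NormedSpace ℝ E]
  {M : Type*} [TopologicalSpace M] [ChartedSpace E M]
  {V : Type*} [NormedAddCommGroup V] [NormedSpace ℝ V]

/-- In a chart the map has zero derivative on a ball, so it is constant there by convexity. -/
theorem isLocallyConstant_of_hasMFDerivAt_zero [IsManifold 𝓘(ℝ, E) ∞ M] {f : M → V}
    (hf : ∀ x, HasMFDerivAt 𝓘(ℝ, E) 𝓘(ℝ, V) f x (0 : E →L[ℝ] V)) : IsLocallyConstant f := by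
  rw [IsLocallyConstant.iff_eventually_eq]
  intro x
  set φ := extChartAt 𝓘(ℝ, E) x with hφ
  have hd : ∀ u ∈ φ.target, HasFDerivAt (f ∘ φ.symm) (0 : E →L[ℝ] V) u := by
    intro u hu
    have h1 : MDifferentiableAt 𝓘(ℝ, E) 𝓘(ℝ, E) φ.symm u :=
      (contMDiffAt_extChartAt_symm_of_mem hu).mdifferentiableAt (by simp)
    obtain ⟨d, hd⟩ : ∃ d : E →L[ℝ] E, HasMFDerivAt 𝓘(ℝ, E) 𝓘(ℝ, E) φ.symm u d :=
      ⟨_, h1.hasMFDerivAt⟩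
    have h2 : HasMFDerivAt 𝓘(ℝ, E) 𝓘(ℝ, V) (f ∘ φ.symm) u ((0 : E →L[ℝ] V).comp d) :=
      (hf (φ.symm u)).comp u hd
    exact hasMFDerivAt_iff_hasFDerivAt.1 (h2.congr_mfderiv (ContinuousLinearMap.zero_comp d))
  obtain ⟨r, hr, hball⟩ := Metric.isOpen_iff.1 (isOpen_extChartAt_target (I := 𝓘(ℝ, E)) x) (φ x)
    (mem_extChartAt_target x)
  filter_upwards [extChartAt_source_mem_nhds (I := 𝓘(ℝ, E)) x,
    (continuousAt_extChartAt (I := 𝓘(ℝ, E)) x).preimage_mem_nhds (Metric.ball_mem_nhds (φ x) hr)]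
    with y hy hyb
  have h := Metric.isOpen_ball.is_const_of_fderiv_eq_zero (convex_ball (φ x) r).isPreconnected
    (fun u hu => (hd u (hball hu)).differentiableAt.differentiableWithinAt)
    (fun u hu => (hd u (hball hu)).fderiv) hyb (Metric.mem_ball_self hr)
  simp only [Function.comp_apply] at h
  rwa [φ.left_inv hy, hφ, extChartAt_to_inv] at h

/-- The derivative along the diagonal is the sum of the partial derivatives. This is the product
rule for expressions in which a group element occurs twice. -/
theorem hasMFDerivAt_diag {g : M × M → V} {p : M}
    (hg : MDifferentiableAt (𝓘(ℝ, E).prod 𝓘(ℝ, E)) 𝓘(ℝ, V) g (p, p)) {a b : E →L[ℝ] V}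
    (ha : HasMFDerivAt 𝓘(ℝ, E) 𝓘(ℝ, V) (fun h => g (h, p)) p a)
    (hb : HasMFDerivAt 𝓘(ℝ, E) 𝓘(ℝ, V) (fun k => g (p, k)) p b) :
    HasMFDerivAt 𝓘(ℝ, E) 𝓘(ℝ, V) (fun h => g (h, h)) p (a + b) := by
  let g' : E × E →L[ℝ] V := mfderiv (𝓘(ℝ, E).prod 𝓘(ℝ, E)) 𝓘(ℝ, V) g (p, p)
  have hg' : HasMFDerivAt (𝓘(ℝ, E).prod 𝓘(ℝ, E)) 𝓘(ℝ, V) g (p, p) g' := hg.hasMFDerivAt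
  have h1 : HasMFDerivAt 𝓘(ℝ, E) 𝓘(ℝ, V) (fun h => g (h, p)) p
      (g'.comp ((ContinuousLinearMap.id ℝ E).prod (0 : E →L[ℝ] E))) :=
    hg'.comp (f := fun h => (h, p)) p ((hasMFDerivAt_id p).prodMk (hasMFDerivAt_const p p))
  have h2 : HasMFDerivAt 𝓘(ℝ, E) 𝓘(ℝ, V) (fun k => g (p, k)) p
      (g'.comp ((0 : E →L[ℝ] E).prod (ContinuousLinearMap.id ℝ E))) :=
    hg'.comp (f := fun k => (p, k)) p ((hasMFDerivAt_const p p).prodMk (hasMFDerivAt_id p))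
  have h3 : HasMFDerivAt 𝓘(ℝ, E) 𝓘(ℝ, V) (fun k => g (k, k)) p
      (g'.comp ((ContinuousLinearMap.id ℝ E).prod (ContinuousLinearMap.id ℝ E))) :=
    hg'.comp (f := fun k => (k, k)) p ((hasMFDerivAt_id p).prodMk (hasMFDerivAt_id p))
  have ea : a = _ := hasMFDerivAt_unique ha h1
  have eb : b = _ := hasMFDerivAt_unique hb h2
  have key : ∀ T : E × E →L[ℝ] V,
      T.comp ((ContinuousLinearMap.id ℝ E).prod (ContinuousLinearMap.id ℝ E)) =
        T.comp ((ContinuousLinearMap.id ℝ E).prod (0 : E →L[ℝ] E)) +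
          T.comp ((0 : E →L[ℝ] E).prod (ContinuousLinearMap.id ℝ E)) := by
    intro T
    ext v
    simp [← map_add]
  exact h3.congr_mfderiv ((key g').trans (congrArg₂ (· + ·) ea eb).symm)

end Calculus

/-! ### Infinitesimal actions and pull-backs of sections -/

section Actions

variable {E : Type*} [NormedAddCommGroup E] [NormedSpace ℝ E]
  {M : Type*} [TopologicalSpace M] [ChartedSpace E M] [IsManifold 𝓘(ℝ, E) ∞ M]
  {F : Type*} [NormedAddCommGroup F] [NormedSpace ℝ F]
  {A : M → Type*} [∀ x, AddCommGroup (A x)] [∀ x, Module ℝ (A x)] [∀ x, TopologicalSpace (A x)]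
  [TopologicalSpace (TotalSpace F A)] [FiberBundle F A] [VectorBundle ℝ F A]
  {EG : Type*} [NormedAddCommGroup EG] [NormedSpace ℝ EG]
  {G : Type*} [Group G] [TopologicalSpace G] [ChartedSpace EG G]

namespace BundleAction

variable (Φ : BundleAction (E := E) (EG := EG) F A G)

theorem map_one_eq (a : TotalSpace F A) : Φ.map 1 a = a := Φ.map_one a

theorem map_mul_eq (g h : G) (a : TotalSpace F A) : Φ.map (g * h) a = Φ.map g (Φ.map h a) :=
  Φ.map_mul g h a

theorem map_map_inv (g : G) (a : TotalSpace F A) : Φ.map g (Φ.map g⁻¹ a) = a := by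
  rw [← map_mul_eq, mul_inv_cancel, map_one_eq]

theorem base_one (x : M) : Φ.base 1 x = x :=
  congrArg TotalSpace.proj (Φ.map_one ⟨x, 0⟩)

theorem base_mul (g h : G) (x : M) : Φ.base (g * h) x = Φ.base g (Φ.base h x) :=
  congrArg TotalSpace.proj (Φ.map_mul g h ⟨x, 0⟩)

theorem base_inv_base (g : G) (x : M) : Φ.base g⁻¹ (Φ.base g x) = x := by
  rw [← base_mul, inv_mul_cancel, base_one]

/-- The action on the base is the action on the zero section, followed by the projection. -/
theorem contMDiff_base [ContMDiffVectorBundle ∞ F A 𝓘(ℝ, E)] :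
    ContMDiff (𝓘(ℝ, EG).prod 𝓘(ℝ, E)) 𝓘(ℝ, E) ∞ (fun p : G × M => Φ.base p.1 p.2) := by
  have h1 : ContMDiff (𝓘(ℝ, EG).prod 𝓘(ℝ, E)) (𝓘(ℝ, E).prod 𝓘(ℝ, F)) ∞
      (fun p : G × M => (zeroSection F A p.2)) := (contMDiff_zeroSection ℝ A).comp contMDiff_snd
  exact (contMDiff_proj A).comp (Φ.contMDiff.comp (contMDiff_fst.prodMk h1))

/-- The pull-back `Φ_{h⁻¹}(Y(h x))` of a section, in the trivialization of `A` at `x`. -/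
def pullback (Y : Sec (E := E) F A) (x : M) (h : G) : F :=
  (trivializationAt F A x (Φ.map h⁻¹ ⟨Φ.base h x, Y (Φ.base h x)⟩)).2

theorem map_inv_sec (Y : Sec (E := E) F A) (x : M) (h : G) :
    Φ.map h⁻¹ ⟨Φ.base h x, Y (Φ.base h x)⟩ =
      (⟨x, (trivializationAt F A x).symm x (Φ.pullback Y x h)⟩ : TotalSpace F A) := by
  have h1 : (Φ.map h⁻¹ (⟨Φ.base h x, Y (Φ.base h x)⟩ : TotalSpace F A)).1 = x :=
    Φ.base_inv_base h x
  have key : ∀ b : TotalSpace F A, b.1 = x →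
      b = ⟨x, (trivializationAt F A x).symm x (trivializationAt F A x b).2⟩ := by
    rintro ⟨y, b⟩ rfl
    exact congrArg _ ((trivializationAt F A y).symm_apply_apply_mk
      (FiberBundle.mem_baseSet_trivializationAt' y) b).symm
  exact key _ h1

theorem map_pullback (Y : Sec (E := E) F A) (x : M) (h : G) :
    Φ.map h ⟨x, (trivializationAt F A x).symm x (Φ.pullback Y x h)⟩ =
      (⟨Φ.base h x, Y (Φ.base h x)⟩ : TotalSpace F A) := by
  rw [← map_inv_sec, map_map_inv]

theorem pullback_one (Y : Sec (E := E) F A) (x : M) :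
    Φ.pullback Y x 1 = (trivializationAt F A x ⟨x, Y x⟩).2 := by
  unfold pullback
  rw [inv_one, map_one_eq, base_one]

theorem pullback_add (Y Z : Sec (E := E) F A) (x : M) (h : G) :
    Φ.pullback (Y + Z) x h = Φ.pullback Y x h + Φ.pullback Z x h := by
  have h1 : (Φ.base h⁻¹ (Φ.base h x)) ∈ (trivializationAt F A x).baseSet := by
    rw [base_inv_base]; exact FiberBundle.mem_baseSet_trivializationAt' x
  have h2 := (trivializationAt F A x).linear ℝ h1
  unfold pullback map
  simp only [ContMDiffSection.coe_add, Pi.add_apply, _root_.map_add]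
  exact h2.map_add _ _

theorem pullback_smul (c : ℝ) (Y : Sec (E := E) F A) (x : M) (h : G) :
    Φ.pullback (c • Y) x h = c • Φ.pullback Y x h := by
  have h1 : (Φ.base h⁻¹ (Φ.base h x)) ∈ (trivializationAt F A x).baseSet := by
    rw [base_inv_base]; exact FiberBundle.mem_baseSet_trivializationAt' x
  have h2 := (trivializationAt F A x).linear ℝ h1
  unfold pullback map
  simp only [ContMDiffSection.coe_smul, Pi.smul_apply, _root_.map_smul]
  exact h2.map_smul _ _

variable [ContMDiffVectorBundle ∞ F A 𝓘(ℝ, E)] [LieGroup 𝓘(ℝ, EG) ∞ G]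

theorem contMDiff_pullback (Y : Sec (E := E) F A) (x : M) :
    ContMDiff 𝓘(ℝ, EG) 𝓘(ℝ, F) ∞ (Φ.pullback Y x : G → F) := by
  have h1 : ContMDiff 𝓘(ℝ, EG) 𝓘(ℝ, E) ∞ (fun h : G => Φ.base h x) :=
    Φ.contMDiff_base.comp (contMDiff_id.prodMk contMDiff_const)
  have h2 : ContMDiff 𝓘(ℝ, EG) (𝓘(ℝ, E).prod 𝓘(ℝ, F)) ∞
      (fun h : G => Φ.map h⁻¹ ⟨Φ.base h x, Y (Φ.base h x)⟩) :=
    Φ.contMDiff.comp ((contMDiff_inv 𝓘(ℝ, EG) ∞).prodMk (Y.contMDiff.comp h1))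
  have h3 := ((trivializationAt F A x).contMDiffOn (IB := 𝓘(ℝ, E)) (n := ∞)).comp_contMDiff h2
    fun h => (Trivialization.mem_source _).2 (by
      change Φ.base h⁻¹ (Φ.base h x) ∈ _
      rw [base_inv_base]; exact FiberBundle.mem_baseSet_trivializationAt' x)
  exact contMDiff_snd.comp h3

/-- The infinitesimal generator of the action on the base. -/
def baseGenerator (ξ : EG) (x : M) : TangentSpace 𝓘(ℝ, E) x :=
  (mfderiv 𝓘(ℝ, EG) 𝓘(ℝ, E) (fun g : G => Φ.base g x) 1 ξ : E)

theorem hasMFDerivAt_map (a : TotalSpace F A) :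
    ∃ D : EG →L[ℝ] E × F,
      HasMFDerivAt 𝓘(ℝ, EG) (𝓘(ℝ, E).prod 𝓘(ℝ, F)) (fun g : G => Φ.map g a) 1 D ∧
        ∀ ξ : EG, (Φ.generator ξ a : E × F) = D ξ := by
  have h : ContMDiff 𝓘(ℝ, EG) (𝓘(ℝ, E).prod 𝓘(ℝ, F)) ∞ (fun g : G => Φ.map g a) :=
    Φ.contMDiff.comp (contMDiff_id.prodMk contMDiff_const)
  exact ⟨_, ((h 1).mdifferentiableAt (by simp)).hasMFDerivAt, fun _ => rfl⟩

theorem contMDiff_base_left (x : M) :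
    ContMDiff 𝓘(ℝ, EG) 𝓘(ℝ, E) ∞ (fun g : G => Φ.base g x) :=
  Φ.contMDiff_base.comp (contMDiff_id.prodMk contMDiff_const)

theorem hasMFDerivAt_base (x : M) :
    ∃ D : EG →L[ℝ] E,
      HasMFDerivAt 𝓘(ℝ, EG) 𝓘(ℝ, E) (fun g : G => Φ.base g x) 1 D ∧
        ∀ ξ : EG, (Φ.baseGenerator ξ x : E) = D ξ :=
  ⟨_, ((Φ.contMDiff_base_left x 1).mdifferentiableAt (by simp)).hasMFDerivAt, fun _ => rfl⟩

theorem mfderiv_proj_generator (ξ : EG) (a : TotalSpace F A) :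
    (mfderiv (𝓘(ℝ, E).prod 𝓘(ℝ, F)) 𝓘(ℝ, E) (fun b : TotalSpace F A => b.1) a
      (Φ.generator ξ a : E × F) : E) = Φ.baseGenerator ξ a.1 := by
  obtain ⟨D, hD, hDξ⟩ := Φ.hasMFDerivAt_map a
  obtain ⟨D', hD', hDξ'⟩ := Φ.hasMFDerivAt_base a.1
  obtain ⟨T, hT, hTe⟩ : ∃ T : E × F →L[ℝ] E,
      HasMFDerivAt (𝓘(ℝ, E).prod 𝓘(ℝ, F)) 𝓘(ℝ, E) (fun b : TotalSpace F A => b.1) a T ∧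
      ∀ w : E × F, (mfderiv (𝓘(ℝ, E).prod 𝓘(ℝ, F)) 𝓘(ℝ, E) (fun b : TotalSpace F A => b.1) a w
        : E) = T w :=
    ⟨_, (((contMDiff_proj (n := ∞) (IB := 𝓘(ℝ, E)) (F := F) A) a).mdifferentiableAt
      (by simp)).hasMFDerivAt, fun _ => rfl⟩
  have hT1 : HasMFDerivAt (𝓘(ℝ, E).prod 𝓘(ℝ, F)) 𝓘(ℝ, E) (fun b : TotalSpace F A => b.1)
      (Φ.map 1 a) T := by rw [map_one_eq]; exact hT
  have h1 : HasMFDerivAt 𝓘(ℝ, EG) 𝓘(ℝ, E) (fun g : G => Φ.base g a.1) 1 (T.comp D) :=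
    hT1.comp 1 hD
  have h2 : T.comp D = D' := hasMFDerivAt_unique h1 hD'
  refine (hTe _).trans ?_
  rw [hDξ]
  refine Eq.trans ?_ (hDξ' ξ).symm
  rw [← h2]
  rfl

/-- The derivative at `1` of a pulled back section. -/
def dotPullback (Y : Sec (E := E) F A) (ξ : EG) (x : M) : A x :=
  (trivializationAt F A x).symm x (mfderiv 𝓘(ℝ, EG) 𝓘(ℝ, F) (Φ.pullback Y x : G → F) 1 ξ : F)

theorem hasMFDerivAt_pullback (Y : Sec (E := E) F A) (x : M) :
    ∃ D : EG →L[ℝ] F, HasMFDerivAt 𝓘(ℝ, EG) 𝓘(ℝ, F) (Φ.pullback Y x : G → F) 1 D ∧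
      ∀ ξ : EG, Φ.dotPullback Y ξ x = (trivializationAt F A x).symm x (D ξ) :=
  ⟨_, ((Φ.contMDiff_pullback Y x 1).mdifferentiableAt (by simp)).hasMFDerivAt, fun _ => rfl⟩

/-- Write Y(gx) as Φ_g applied to the pull-back Φ_{g⁻¹}(Y(gx)), apply l and differentiate at g = 1.
The product rule gives one term from the generator and one from the pull-back. -/
theorem dirDeriv_linFun_generator [FiniteDimensional ℝ E] [T2Space M] [FiniteDimensional ℝ F]
    {l : ∀ x, A x →ₗ[ℝ] ℝ} (hl : IsSmoothForm (E := E) F (oneForm l))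
    (Y : Sec (E := E) F A) (ξ : EG) (x : M) :
    dirDeriv (𝓘(ℝ, E).prod 𝓘(ℝ, F)) (linFun (F := F) (oneForm l)) ⟨x, Y x⟩
      (Φ.generator ξ ⟨x, Y x⟩) + l x (Φ.dotPullback Y ξ x) =
      dirDeriv 𝓘(ℝ, E) (fun y => l y (Y y)) x (Φ.baseGenerator ξ x) := by
  set t := trivializationAt F A x with ht
  have hx : x ∈ t.baseSet := FiberBundle.mem_baseSet_trivializationAt' x
  obtain ⟨D, hD, hDξ⟩ := Φ.hasMFDerivAt_map ⟨x, Y x⟩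
  obtain ⟨D', hD', hDξ'⟩ := Φ.hasMFDerivAt_base x
  obtain ⟨D'', hD'', hDξ''⟩ := Φ.hasMFDerivAt_pullback Y x
  let g : G × G → ℝ := fun p => linFun (oneForm l)
    (Φ.map p.1 (⟨x, t.symm x (Φ.pullback Y x p.2)⟩ : TotalSpace F A))
  have hg : ContMDiff (𝓘(ℝ, EG).prod 𝓘(ℝ, EG)) 𝓘(ℝ, ℝ) ∞ g := by
    refine (contMDiff_linFun hl).comp (Φ.contMDiff.comp (contMDiff_fst.prodMk ?_))
    exact contMDiffOn_univ.1 (contMDiffOn_trivialization_symm x contMDiffOn_const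
      ((Φ.contMDiff_pullback Y x).comp contMDiff_snd).contMDiffOn fun _ _ => hx)
  have h1 : t.symm x (Φ.pullback Y x (1 : G)) = Y x := by
    rw [pullback_one]; exact t.symm_apply_apply_mk hx _
  have hlin := (contMDiff_linFun (F := F) (E := E) hl ⟨x, Y x⟩).mdifferentiableAt
    (n := ∞) (by simp)
  have ha : HasMFDerivAt 𝓘(ℝ, EG) 𝓘(ℝ, ℝ) (fun h => g (h, 1)) 1
      ((mfderiv (𝓘(ℝ, E).prod 𝓘(ℝ, F)) 𝓘(ℝ, ℝ) (linFun (F := F) (oneForm l)) ⟨x, Y x⟩ :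
        E × F →L[ℝ] ℝ).comp D) := by
    have e : (fun h => g (h, 1)) = fun h => linFun (oneForm l)
        (Φ.map h (⟨x, Y x⟩ : TotalSpace F A)) := by
      funext h; simp only [g, h1]
    rw [e]
    have hT : HasMFDerivAt (𝓘(ℝ, E).prod 𝓘(ℝ, F)) 𝓘(ℝ, ℝ) (linFun (F := F) (oneForm l))
        (Φ.map 1 ⟨x, Y x⟩) (mfderiv (𝓘(ℝ, E).prod 𝓘(ℝ, F)) 𝓘(ℝ, ℝ)
          (linFun (F := F) (oneForm l)) ⟨x, Y x⟩ : E × F →L[ℝ] ℝ) := by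
      rw [map_one_eq]; exact hlin.hasMFDerivAt
    exact hT.comp 1 hD
  let Λ : F →L[ℝ] ℝ := LinearMap.toContinuousLinearMap ((l x).comp (t.symmₗ ℝ x))
  have hΛ : ∀ u, Λ u = l x (t.symm x u) := fun u => congrArg (l x) (t.symmₗ_apply hx u)
  have hb : HasMFDerivAt 𝓘(ℝ, EG) 𝓘(ℝ, ℝ) (fun k => g (1, k)) 1 (Λ.comp D'') := by
    have e : (fun k => g (1, k)) = fun k => Λ (Φ.pullback Y x k) := by
      funext k; simp only [g, map_one_eq, hΛ]; rfl
    rw [e]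
    exact Λ.hasMFDerivAt.comp 1 hD''
  have hdiag := hasMFDerivAt_diag ((hg (1, 1)).mdifferentiableAt (by simp)) ha hb
  have hY : MDifferentiableAt 𝓘(ℝ, E) 𝓘(ℝ, ℝ) (fun y => l y (Y y)) x :=
    (hl (fun _ => Y) x).mdifferentiableAt (by simp)
  have hc : HasMFDerivAt 𝓘(ℝ, EG) 𝓘(ℝ, ℝ) (fun h => g (h, h)) 1
      ((mfderiv 𝓘(ℝ, E) 𝓘(ℝ, ℝ) (fun y => l y (Y y)) x : E →L[ℝ] ℝ).comp D') := by
    have e : (fun h => g (h, h)) = fun h => l (Φ.base h x) (Y (Φ.base h x)) := by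
      funext h
      simp only [g]
      rw [Φ.map_pullback]
      rfl
    rw [e]
    have hT : HasMFDerivAt 𝓘(ℝ, E) 𝓘(ℝ, ℝ) (fun y => l y (Y y)) (Φ.base 1 x)
        (mfderiv 𝓘(ℝ, E) 𝓘(ℝ, ℝ) (fun y => l y (Y y)) x : E →L[ℝ] ℝ) := by
      rw [base_one]; exact hY.hasMFDerivAt
    exact hT.comp 1 hD'
  have key : ∀ T T' : EG →L[ℝ] ℝ, T = T' → T ξ = T' ξ := by rintro T _ rfl; rfl
  have h := key _ _ (hasMFDerivAt_unique hdiag hc)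
  have e1 : Λ (D'' ξ) = l x (Φ.dotPullback Y ξ x) := (hΛ _).trans (congrArg (l x) (hDξ'' ξ).symm)
  have e2 : dirDeriv (𝓘(ℝ, E).prod 𝓘(ℝ, F)) (linFun (F := F) (oneForm l)) ⟨x, Y x⟩
      (Φ.generator ξ ⟨x, Y x⟩) = (mfderiv (𝓘(ℝ, E).prod 𝓘(ℝ, F)) 𝓘(ℝ, ℝ)
        (linFun (F := F) (oneForm l)) ⟨x, Y x⟩ : E × F →L[ℝ] ℝ) (D ξ) :=
    congrArg (mfderiv (𝓘(ℝ, E).prod 𝓘(ℝ, F)) 𝓘(ℝ, ℝ)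
        (linFun (F := F) (oneForm l)) ⟨x, Y x⟩ : E × F →L[ℝ] ℝ) (hDξ ξ)
  rw [e2, ← e1]
  exact h.trans (congrArg (mfderiv 𝓘(ℝ, E) 𝓘(ℝ, ℝ) (fun y => l y (Y y)) x : E →L[ℝ] ℝ) (hDξ' ξ).symm)

end BundleAction

end Actions

/-! ### Complete lifts in terms of pull-backs, and equivariance of ψ -/

section CompleteLifts

variable {E : Type*} [NormedAddCommGroup E] [NormedSpace ℝ E] [FiniteDimensional ℝ E]
  {M : Type*} [TopologicalSpace M] [T2Space M] [SigmaCompactSpace M] [ChartedSpace E M]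
  [IsManifold 𝓘(ℝ, E) ∞ M]
  {F : Type*} [NormedAddCommGroup F] [NormedSpace ℝ F] [FiniteDimensional ℝ F]
  {A : M → Type*} [∀ x, AddCommGroup (A x)] [∀ x, Module ℝ (A x)] [∀ x, TopologicalSpace (A x)]
  [TopologicalSpace (TotalSpace F A)] [FiberBundle F A] [VectorBundle ℝ F A]
  [ContMDiffVectorBundle ∞ F A 𝓘(ℝ, E)]
  {EG : Type*} [NormedAddCommGroup EG] [NormedSpace ℝ EG]
  {G : Type*} [Group G] [TopologicalSpace G] [ChartedSpace EG G] [LieGroup 𝓘(ℝ, EG) ∞ G]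
  {L : LieAlgebroid (E := E) F A} {Φ : BundleAction (E := E) (EG := EG) F A G}

theorem baseGenerator_eq_anchor {X : Sec (E := E) F A} {ξ : EG}
    (h : L.IsCompleteLift X (Φ.generator ξ)) (x : M) :
    Φ.baseGenerator ξ x = L.anchor x (X x) :=
  (Φ.mfderiv_proj_generator ξ ⟨x, 0⟩).symm.trans (h.1 ⟨x, 0⟩)

/-- If the generator of `ξ` is the complete lift of `X`, the derivative of the pull-backs of a
section `Y` in the direction `ξ` is `⟦X, Y⟧`. -/
theorem dotPullback_eq_bracket {X : Sec (E := E) F A} {ξ : EG}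
    (h : L.IsCompleteLift X (Φ.generator ξ)) (Y : Sec (E := E) F A) (x : M) :
    Φ.dotPullback Y ξ x = L.bracket X Y x := by
  -- One-forms separate vectors. The complete lift gives dl(X, Y) + ρ(Y)(l(X)) on the linear
  -- function of l, which equals ρ(X)(l(Y)) - l(⟦X, Y⟧); comparison with `dirDeriv_linFun_generator`
  -- isolates the bracket.
  refine eq_of_forall_isSmoothForm (E := E) (F := F) fun l hl => ?_
  obtain ⟨β, hβ⟩ := L.exists_isDifferential hl
  have h1 := h.2 _ β hl hβ ⟨x, Y x⟩
  have h2 := L.isDifferential_one_iff.1 hβ X Y x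
  have h3 := Φ.dirDeriv_linFun_generator hl Y ξ x
  rw [baseGenerator_eq_anchor h x] at h3
  simp only [oneForm_apply] at h1 h2
  linarith

theorem exists_eq_oneForm (α : Form A 1) : ∃ l : ∀ x, A x →ₗ[ℝ] ℝ, α = oneForm l := by
  refine ⟨fun x => (AlternatingMap.ofSubsingleton ℝ (A x) ℝ (0 : Fin 1)).symm (α x), ?_⟩
  funext x
  exact ((AlternatingMap.ofSubsingleton ℝ (A x) ℝ (0 : Fin 1)).apply_symm_apply (α x)).symm

/-- The computation for `dotPullback_eq_bracket` is reversible, because every vector of A is the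
value of a section. This is the criterion applied to the restricted action. -/
theorem isCompleteLift_generator {X : Sec (E := E) F A} {ξ : EG}
    (hbase : ∀ x, Φ.baseGenerator ξ x = L.anchor x (X x))
    (hdot : ∀ (Y : Sec (E := E) F A) (x : M), Φ.dotPullback Y ξ x = L.bracket X Y x) :
    L.IsCompleteLift X (Φ.generator ξ) := by
  refine ⟨fun a => (Φ.mfderiv_proj_generator ξ a).trans (hbase a.1), ?_⟩
  rintro α β hα hβ ⟨x, a⟩
  obtain ⟨l, rfl⟩ := exists_eq_oneForm α
  obtain ⟨Y, rfl⟩ := exists_sec_apply_eq (E := E) (F := F) x a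
  have h2 := L.isDifferential_one_iff.1 hβ X Y x
  have h3 := Φ.dirDeriv_linFun_generator hα Y ξ x
  rw [hbase x, hdot Y x] at h3
  simp only [oneForm_apply] at h2 ⊢
  linarith

section Equivariance

variable [FiniteDimensional ℝ EG] [CompleteSpace EG]
  {ψ : GroupLieAlgebra 𝓘(ℝ, EG) G →ₗ[ℝ] Sec (E := E) F A}

/-- A linear map on `𝔤`, as a linear map on the vector space underlying `𝔤 = T_1 G`. -/
def onModel {W : Type*} [AddCommGroup W] [Module ℝ W]
    (ψ : GroupLieAlgebra 𝓘(ℝ, EG) G →ₗ[ℝ] W) : EG →ₗ[ℝ] W where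
  toFun w := ψ w
  map_add' v w := map_add ψ v w
  map_smul' c w := map_smul ψ c w

/-- Pulling back by kg at x is pulling back by k at gx and then by g. This reduces differentiation
at g to differentiation at 1. -/
theorem pullback_mul (Φ : BundleAction (E := E) (EG := EG) F A G) (Y : Sec (E := E) F A) (x : M)
    (k g : G) : Φ.pullback Y x (k * g) = (trivializationAt F A x (Φ.map g⁻¹ ⟨Φ.base g x,
      (trivializationAt F A (Φ.base g x)).symm (Φ.base g x) (Φ.pullback Y (Φ.base g x) k)⟩)).2 := by
  rw [← BundleAction.map_inv_sec, ← BundleAction.map_mul_eq, ← mul_inv_rev, ← Φ.base_mul]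
  rfl

/-- By the product rule the derivative along η is ⟦ψη, ψξ⟧, from the pull-back, plus ψ([η, ξ]), from
Ad. They cancel because ψ is an anti-morphism. -/
theorem hasMFDerivAt_pullback_Ad_one (hΦ : IsActionByCompleteLifts L Φ ψ) (ξ : EG) (x : M) :
    HasMFDerivAt 𝓘(ℝ, EG) 𝓘(ℝ, F) (fun h : G => Φ.pullback (onModel ψ (Ad (EG := EG) h ξ)) x h) 1
      (0 : EG →L[ℝ] F) := by
  set t := trivializationAt F A x with ht
  have hx : x ∈ t.baseSet := FiberBundle.mem_baseSet_trivializationAt' x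
  obtain ⟨D, hD, hDη⟩ := Φ.hasMFDerivAt_pullback (onModel ψ ξ) x
  -- Separating the group element of the pull-back from that of Ad prepares for the product rule.
  -- Linearity in w reduces joint smoothness to finitely many basis vectors.
  let P : G → EG →ₗ[ℝ] F := fun h =>
    { toFun := fun w => Φ.pullback (onModel ψ w) x h
      map_add' := fun v w => by rw [← Φ.pullback_add, ← map_add]
      map_smul' := fun c w => by rw [RingHom.id_apply, ← Φ.pullback_smul, ← map_smul] }
  let b := Module.finBasis ℝ EG
  have hP : ∀ h w, P h w = ∑ i, (b.coord i).toContinuousLinearMap w • Φ.pullback (onModel ψ (b i)) x h := by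
    intro h w
    conv_lhs => rw [← b.sum_repr w, map_sum]
    simp only [map_smul]
    rfl
  have hAd : ContMDiff 𝓘(ℝ, EG) 𝓘(ℝ, EG) ∞ (fun k : G => Ad (EG := EG) k ξ) :=
    (contMDiff_Ad (EG := EG) (G := G)).clm_apply contMDiff_const
  have hg : ContMDiff (𝓘(ℝ, EG).prod 𝓘(ℝ, EG)) 𝓘(ℝ, F) ∞
      (fun p : G × G => P p.1 (Ad (EG := EG) p.2 ξ)) := by
    simp only [hP]
    exact contMDiff_finsetSum fun i _ =>
      ((b.coord i).toContinuousLinearMap.contMDiff.comp (hAd.comp contMDiff_snd)).smul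
        ((Φ.contMDiff_pullback (ψ (b i)) x).comp contMDiff_fst)
  have ha : HasMFDerivAt 𝓘(ℝ, EG) 𝓘(ℝ, F) (fun h : G => P h (Ad (EG := EG) (1 : G) ξ)) 1 D := by
    have e : Ad (EG := EG) (1 : G) ξ = ξ := by rw [Ad_one]; rfl
    exact hD.congr_of_eventuallyEq (Filter.Eventually.of_forall fun h => congrArg (P h) e)
  obtain ⟨D', hD', hDη'⟩ : ∃ D' : EG →L[ℝ] EG,
      HasMFDerivAt 𝓘(ℝ, EG) 𝓘(ℝ, EG) (fun k : G => Ad (EG := EG) k ξ) (1 : G) D' ∧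
      ∀ η : EG, D' η = Bracket.bracket (L := GroupLieAlgebra 𝓘(ℝ, EG) G)
        (M := GroupLieAlgebra 𝓘(ℝ, EG) G) η ξ :=
    ⟨_, ((hAd 1).mdifferentiableAt (by simp)).hasMFDerivAt, fun η => mfderiv_Ad_apply η ξ⟩
  let Λ : EG →L[ℝ] F := LinearMap.toContinuousLinearMap (P 1)
  have hb : HasMFDerivAt 𝓘(ℝ, EG) 𝓘(ℝ, F) (fun k : G => P 1 (Ad (EG := EG) k ξ)) 1
      (Λ.comp D') := Λ.hasMFDerivAt.comp 1 hD'
  refine (hasMFDerivAt_diag ((hg (1, 1)).mdifferentiableAt (by simp)) ha hb).congr_mfderiv ?_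
  ext η
  have h1 : t.symm x (D η) = L.bracket (ψ η) (ψ ξ) x :=
    (hDη η).symm.trans (dotPullback_eq_bracket (hΦ.generator η) (ψ ξ) x)
  have h2 : D η = (t ⟨x, L.bracket (ψ η) (ψ ξ) x⟩).2 := by
    rw [← h1, t.apply_mk_symm hx]
  have h3 : Λ (D' η) = (t ⟨x, -L.bracket (ψ η) (ψ ξ) x⟩).2 := by
    rw [hDη']
    refine (Φ.pullback_one _ x).trans ?_
    exact congrArg (fun W : Sec (E := E) F A => (t ⟨x, W x⟩).2) (hΦ.anti η ξ)
  change D η + Λ (D' η) = 0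
  have h4 := t.linear ℝ hx
  rw [h2, h3, ← h4.map_add, add_neg_cancel, h4.map_zero]

/-- With h = kg, the map is a fixed linear map K applied to the same map at the point gx, for Ad_g ξ
in place of ξ and near k = 1. -/
theorem hasMFDerivAt_pullback_Ad (hΦ : IsActionByCompleteLifts L Φ ψ) (ξ : EG) (x : M) (g : G) :
    HasMFDerivAt 𝓘(ℝ, EG) 𝓘(ℝ, F) (fun h : G => Φ.pullback (onModel ψ (Ad (EG := EG) h ξ)) x h) g
      (0 : EG →L[ℝ] F) := by
  set t := trivializationAt F A x with ht
  set y := Φ.base g x with hy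
  let K : F →L[ℝ] F := LinearMap.toContinuousLinearMap ((t.linearMapAt ℝ (Φ.base g⁻¹ y)).comp
    ((Φ.fib g⁻¹ y).comp ((trivializationAt F A y).symmₗ ℝ y)))
  have hxt : Φ.base g⁻¹ y ∈ t.baseSet := by
    rw [hy, Φ.base_inv_base]; exact FiberBundle.mem_baseSet_trivializationAt' x
  have hK : ∀ k : G, Φ.pullback (onModel ψ (Ad (EG := EG) (k * g) ξ)) x (k * g) =
      K (Φ.pullback (onModel ψ (Ad (EG := EG) k (Ad (EG := EG) g ξ))) y k) := by
    intro k
    rw [pullback_mul, Ad_mul]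
    simp only [K, LinearMap.coe_toContinuousLinearMap', LinearMap.comp_apply]
    rw [t.linearMapAt_apply, if_pos hxt,
      (trivializationAt F A y).symmₗ_apply (FiberBundle.mem_baseSet_trivializationAt' y)]
    rfl
  have h1 : HasMFDerivAt 𝓘(ℝ, EG) 𝓘(ℝ, F)
      (fun k : G => Φ.pullback (onModel ψ (Ad (EG := EG) (k * g) ξ)) x (k * g)) (g * g⁻¹)
      (0 : EG →L[ℝ] F) := by
    rw [mul_inv_cancel]
    exact ((K.hasMFDerivAt.comp 1 (hasMFDerivAt_pullback_Ad_one hΦ (Ad (EG := EG) g ξ) y)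
      ).congr_mfderiv (ContinuousLinearMap.comp_zero K)).congr_of_eventuallyEq
        (Filter.Eventually.of_forall hK)
  obtain ⟨d, hd⟩ : ∃ d : EG →L[ℝ] EG,
      HasMFDerivAt 𝓘(ℝ, EG) 𝓘(ℝ, EG) (fun h : G => h * g⁻¹) g d :=
    ⟨_, ((contMDiff_mul_right (I := 𝓘(ℝ, EG)) (n := ∞) (a := g⁻¹) g).mdifferentiableAt
      (by simp)).hasMFDerivAt⟩
  have h2 := (h1.comp g hd).congr_mfderiv (ContinuousLinearMap.zero_comp d)
  refine h2.congr_of_eventuallyEq (Filter.Eventually.of_forall fun h => ?_)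
  simp

/-- An action by complete lifts of a connected group intertwines `ψ` with the adjoint action. -/
theorem map_psi [ConnectedSpace G] (hΦ : IsActionByCompleteLifts L Φ ψ) (g : G) (ξ : EG) (x : M) :
    Φ.map g ⟨x, onModel ψ ξ x⟩ =
      (⟨Φ.base g x, onModel ψ (Ad (EG := EG) g ξ) (Φ.base g x)⟩ : TotalSpace F A) := by
  -- Connectedness enters here: the pull-back at g equals the pull-back at 1, which is ψ(ξ) itself.
  have h1 := (isLocallyConstant_of_hasMFDerivAt_zero
    (hasMFDerivAt_pullback_Ad hΦ ξ x)).apply_eq_of_preconnectedSpace g 1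
  have e : Ad (EG := EG) (1 : G) ξ = ξ := by rw [Ad_one]; rfl
  simp only [Φ.pullback_one, e] at h1
  rw [← Φ.map_pullback, h1]
  congr 2
  exact ((trivializationAt F A x).symm_apply_apply_mk
    (FiberBundle.mem_baseSet_trivializationAt' x) _).symm

end Equivariance

end CompleteLifts

/-! ### The momentum map: invariance of the level bundle -/

section Momentum

variable {E : Type*} [NormedAddCommGroup E] [NormedSpace ℝ E] [FiniteDimensional ℝ E]
  {M : Type*} [TopologicalSpace M] [T2Space M] [SigmaCompactSpace M] [ChartedSpace E M]
  [IsManifold 𝓘(ℝ, E) ∞ M]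
  {F : Type*} [NormedAddCommGroup F] [NormedSpace ℝ F] [FiniteDimensional ℝ F]
  {A : M → Type*} [∀ x, AddCommGroup (A x)] [∀ x, Module ℝ (A x)] [∀ x, TopologicalSpace (A x)]
  [TopologicalSpace (TotalSpace F A)] [FiberBundle F A] [VectorBundle ℝ F A]
  [ContMDiffVectorBundle ∞ F A 𝓘(ℝ, E)]
  {EG : Type*} [NormedAddCommGroup EG] [NormedSpace ℝ EG] [FiniteDimensional ℝ EG]
  [CompleteSpace EG]
  {G : Type*} [Group G] [TopologicalSpace G] [ChartedSpace EG G] [LieGroup 𝓘(ℝ, EG) ∞ G]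
  {L : LieAlgebroid (E := E) F A} {Φ : BundleAction (E := E) (EG := EG) F A G}
  {ψ : GroupLieAlgebra 𝓘(ℝ, EG) G →ₗ[ℝ] Sec (E := E) F A}
  {J : M → (EG →L[ℝ] ℝ)} {μ : EG →L[ℝ] ℝ} {Ω : Form A 2}

theorem dirDeriv_apply_eq_tangentJ (hJ : ContMDiff 𝓘(ℝ, E) 𝓘(ℝ, EG →L[ℝ] ℝ) ∞ J) (x : M) (ξ : EG)
    (v : TangentSpace 𝓘(ℝ, E) x) :
    dirDeriv 𝓘(ℝ, E) (fun y => J y ξ) x v = tangentJ J x v ξ := by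
  obtain ⟨D, hD, hDv⟩ : ∃ D : E →L[ℝ] EG →L[ℝ] ℝ,
      HasMFDerivAt 𝓘(ℝ, E) 𝓘(ℝ, EG →L[ℝ] ℝ) J x D ∧ ∀ v : E, tangentJ (E := E) J x v = D v :=
    ⟨_, ((hJ x).mdifferentiableAt (by simp)).hasMFDerivAt, fun _ => rfl⟩
  have h1 : HasMFDerivAt 𝓘(ℝ, E) 𝓘(ℝ, ℝ) (fun y => J y ξ) x
      ((ContinuousLinearMap.apply ℝ ℝ ξ).comp D) :=
    (ContinuousLinearMap.apply ℝ ℝ ξ).hasMFDerivAt.comp x hD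
  refine (dirDeriv_eq h1 v).trans ?_
  exact (congrArg (fun l : EG →L[ℝ] ℝ => l ξ) (hDv v)).symm

theorem mem_levelFiber_iff {x : J ⁻¹' {μ}} {a : A x} :
    a ∈ levelFiber L J μ x ↔ tangentJ (E := E) J x (L.anchor x a) = 0 := by
  change JT L J ⟨x, a⟩ = (0, μ) ↔ _
  have hx : J x = μ := x.2
  simp [JT, hx]

/-- The momentum equation turns TJ(ρ(a))(ξ) into Ω(ψ(ξ), a). The fibre is thus the Ω-orthogonal of
the vectors ψ(ξ), a description adapted to the action. -/
theorem mem_levelFiber_iff_contraction (hJ : IsEquivariantMomentumMap L Ω Φ ψ J)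
    {x : J ⁻¹' {μ}} {a : A x} :
    a ∈ levelFiber L J μ x ↔ ∀ ξ : EG, Ω x ![onModel ψ ξ x, a] = 0 := by
  rw [mem_levelFiber_iff, ContinuousLinearMap.ext_iff]
  refine forall_congr' fun ξ => ?_
  have h1 : Ω x ![onModel ψ ξ x, a] = tangentJ (E := E) J x (L.anchor x a) ξ :=
    (hJ.contraction ξ x a).trans (dirDeriv_apply_eq_tangentJ hJ.contMDiff x ξ _)
  rw [h1]
  rfl

theorem base_mem_level (hJ : IsEquivariantMomentumMap L Ω Φ ψ J) {g : G}
    (hg : g ∈ isotropyGroup G μ) {x : M} (hx : x ∈ J ⁻¹' {μ}) : Φ.base g x ∈ J ⁻¹' {μ} := by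
  have hx' : J x = μ := hx
  change J (Φ.base g x) = μ
  rw [hJ.equivariant, hx']
  exact hg

theorem Ad_mul_inv_apply (g : G) (ξ : EG) : Ad (EG := EG) g (Ad (EG := EG) g⁻¹ ξ) = ξ := by
  rw [← ContinuousLinearMap.comp_apply, ← Ad_mul, mul_inv_cancel, Ad_one]
  rfl

theorem Ad_inv_mul_apply (g : G) (ξ : EG) : Ad (EG := EG) g⁻¹ (Ad (EG := EG) g ξ) = ξ := by
  rw [← ContinuousLinearMap.comp_apply, ← Ad_mul, inv_mul_cancel, Ad_one]
  rfl

theorem fib_psi [ConnectedSpace G] (hΦ : IsActionByCompleteLifts L Φ ψ) (g : G) (ξ : EG) (x : M) :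
    Φ.fib g x (onModel ψ ξ x) = onModel ψ (Ad (EG := EG) g ξ) (Φ.base g x) :=
  TotalSpace.mk_inj.1 (map_psi hΦ g ξ x)

/-- Invariance of Ω and equivariance of ψ give Ω(ψ(ξ), Φ_g a) = Ω(ψ(Ad_{g⁻¹}ξ), a), which is zero.
-/
theorem fib_mem_levelFiber [ConnectedSpace G] (hΦ : IsActionByCompleteLifts L Φ ψ)
    (hJ : IsEquivariantMomentumMap L Ω Φ ψ J) {g : G}
    (hg : g ∈ isotropyGroup G μ) {x : J ⁻¹' {μ}} {a : A x} (ha : a ∈ levelFiber L J μ x) :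
    Φ.fib g x a ∈ levelFiber L J μ ⟨Φ.base g x, base_mem_level hJ hg x.2⟩ := by
  rw [mem_levelFiber_iff_contraction hJ] at ha ⊢
  intro ξ
  have h1 := fib_psi hΦ g (Ad (EG := EG) g⁻¹ ξ) (x : M)
  rw [Ad_mul_inv_apply] at h1
  change Ω (Φ.base g x) ![onModel ψ ξ (Φ.base g x), Φ.fib g x a] = 0
  rw [← h1, hJ.invariant]
  exact ha _

/-- Equivariance makes J(φ_g x)(Ad_g η) constant in g. Its derivative at 1 along ξ is ρ(ψ(ξ))(J_η) +
μ([ξ, η]), whose second term vanishes for ξ ∈ 𝔤_μ. -/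
theorem psi_mem_levelFiber (hΦ : IsActionByCompleteLifts L Φ ψ)
    (hJ : IsEquivariantMomentumMap L Ω Φ ψ J) {ξ : EG} (hξ : ξ ∈ isotropyAlgebra G μ)
    (x : J ⁻¹' {μ}) : onModel ψ ξ x ∈ levelFiber L J μ x := by
  rw [mem_levelFiber_iff]
  ext η
  have hx : J x = μ := x.2
  refine (dirDeriv_apply_eq_tangentJ hJ.contMDiff x η _).symm.trans ?_
  have hbase := baseGenerator_eq_anchor (hΦ.generator ξ) (x : M)
  obtain ⟨D, hD, hDξ⟩ := Φ.hasMFDerivAt_base (x : M)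
  have hAd : ContMDiff 𝓘(ℝ, EG) 𝓘(ℝ, EG) ∞ (fun k : G => Ad (EG := EG) k η) :=
    (contMDiff_Ad (EG := EG) (G := G)).clm_apply contMDiff_const
  obtain ⟨D', hD', hDη'⟩ : ∃ D' : EG →L[ℝ] EG,
      HasMFDerivAt 𝓘(ℝ, EG) 𝓘(ℝ, EG) (fun k : G => Ad (EG := EG) k η) (1 : G) D' ∧
      ∀ ξ : EG, D' ξ = Bracket.bracket (L := GroupLieAlgebra 𝓘(ℝ, EG) G)
        (M := GroupLieAlgebra 𝓘(ℝ, EG) G) ξ η :=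
    ⟨_, ((hAd 1).mdifferentiableAt (by simp)).hasMFDerivAt, fun ξ => mfderiv_Ad_apply ξ η⟩
  have hg : ContMDiff (𝓘(ℝ, EG).prod 𝓘(ℝ, EG)) 𝓘(ℝ, ℝ) ∞
      (fun p : G × G => J (Φ.base p.1 x) (Ad (EG := EG) p.2 η)) :=
    (hJ.contMDiff.comp ((Φ.contMDiff_base_left (x : M)).comp contMDiff_fst)).clm_apply
      (hAd.comp contMDiff_snd)
  have hJη : ContMDiff 𝓘(ℝ, E) 𝓘(ℝ, ℝ) ∞ (fun y => J y η) :=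
    hJ.contMDiff.clm_apply contMDiff_const
  obtain ⟨T, hT, hTv⟩ : ∃ T : E →L[ℝ] ℝ,
      HasMFDerivAt 𝓘(ℝ, E) 𝓘(ℝ, ℝ) (fun y => J y η) (x : M) T ∧
        ∀ v : E, dirDeriv 𝓘(ℝ, E) (fun y => J y η) (x : M) v = T v :=
    ⟨_, ((hJη x).mdifferentiableAt (by simp)).hasMFDerivAt, fun _ => rfl⟩
  have hT1 : HasMFDerivAt 𝓘(ℝ, E) 𝓘(ℝ, ℝ) (fun y => J y η) (Φ.base 1 x) T := by
    rw [Φ.base_one]; exact hT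
  have ha : HasMFDerivAt 𝓘(ℝ, EG) 𝓘(ℝ, ℝ)
      (fun h : G => J (Φ.base h x) (Ad (EG := EG) (1 : G) η)) 1 (T.comp D) := by
    have e : Ad (EG := EG) (1 : G) η = η := by rw [Ad_one]; rfl
    rw [e]
    exact hT1.comp 1 hD
  have hb : HasMFDerivAt 𝓘(ℝ, EG) 𝓘(ℝ, ℝ)
      (fun k : G => J (Φ.base 1 x) (Ad (EG := EG) k η)) 1 (μ.comp D') := by
    rw [Φ.base_one, hx]
    exact μ.hasMFDerivAt.comp 1 hD'
  have hdiag := hasMFDerivAt_diag ((hg (1, 1)).mdifferentiableAt (by simp)) ha hb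
  have hconst : HasMFDerivAt 𝓘(ℝ, EG) 𝓘(ℝ, ℝ)
      (fun h : G => J (Φ.base h x) (Ad (EG := EG) h η)) 1 (0 : EG →L[ℝ] ℝ) := by
    refine (hasMFDerivAt_const (J x η) (1 : G)).congr_of_eventuallyEq
      (Filter.Eventually.of_forall fun h => ?_)
    simp only [hJ.equivariant, Coad, ContinuousLinearMap.comp_apply, Ad_inv_mul_apply]
  have key : ∀ T T' : EG →L[ℝ] ℝ, T = T' → T ξ = T' ξ := by rintro T _ rfl; rfl
  have h := key _ _ (hasMFDerivAt_unique hdiag hconst)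
  have h2 : T (D ξ) + μ (D' ξ) = 0 := h
  have h3 : μ (D' ξ) = 0 := (congrArg μ (hDη' ξ)).trans (hξ η)
  rw [h3, add_zero] at h2
  refine Eq.trans ?_ h2
  refine Eq.trans ?_ (congrArg T (hDξ ξ))
  refine Eq.trans ?_ (hTv _)
  exact congrArg (dirDeriv 𝓘(ℝ, E) (fun y => J y η) (x : M)) hbase.symm

end Momentum

/-! ### Kernels of constant rank form a subbundle -/

section KernelBundle

variable {E : Type*} [NormedAddCommGroup E] [NormedSpace ℝ E]
  {M : Type*} [TopologicalSpace M] [ChartedSpace E M]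
  {F : Type*} [NormedAddCommGroup F] [NormedSpace ℝ F] [FiniteDimensional ℝ F]
  {W : Type*} [NormedAddCommGroup W] [NormedSpace ℝ W] 

/-- Since F is finite-dimensional, the operator is a finite sum of fixed coordinate functionals
times its values on a basis. -/
theorem contMDiffOn_clm_of_apply {K : M → F →L[ℝ] W} {U : Set M}
    (h : ∀ v, ContMDiffOn 𝓘(ℝ, E) 𝓘(ℝ, W) ∞ (fun y => K y v) U) :
    ContMDiffOn 𝓘(ℝ, E) 𝓘(ℝ, F →L[ℝ] W) ∞ K U := by
  let b := Module.finBasis ℝ F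
  have h1 : ∀ y, K y = ∑ i, ContinuousLinearMap.smulRightL ℝ F W
      (b.coord i).toContinuousLinearMap (K y (b i)) := by
    intro y
    ext v
    conv_lhs => rw [← b.sum_repr v, map_sum]
    simp
  have h2 : ContMDiffOn 𝓘(ℝ, E) 𝓘(ℝ, F →L[ℝ] W) ∞ (fun y => ∑ i,
      ContinuousLinearMap.smulRightL ℝ F W (b.coord i).toContinuousLinearMap (K y (b i))) U :=
    contMDiffOn_finsetSum fun i _ => (ContinuousLinearMap.contMDiff _).comp_contMDiffOn (h (b i))
  exact h2.congr fun y _ => h1 y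

variable [FiniteDimensional ℝ W]
  {A : M → Type*} [∀ x, AddCommGroup (A x)] [∀ x, Module ℝ (A x)] [∀ x, TopologicalSpace (A x)]
  [TopologicalSpace (TotalSpace F A)] [FiberBundle F A] [VectorBundle ℝ F A]
  [ContMDiffVectorBundle ∞ F A 𝓘(ℝ, E)]
  {S : Set M} {F₁ : Type*} [NormedAddCommGroup F₁] [NormedSpace ℝ F₁] [FiniteDimensional ℝ F₁]

/-- The kernels over `S` of a bundle map with values in a vector space which has constant rank
along `S` admit smooth coordinates. -/
theorem exists_subbundleChart_ker {B : ∀ x : S, Submodule ℝ (A x)} (σ : ∀ y, A y →ₗ[ℝ] W)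
    (hσ : ContMDiff (𝓘(ℝ, E).prod 𝓘(ℝ, F)) 𝓘(ℝ, W) ∞ (fun a : TotalSpace F A => σ a.1 a.2))
    (hB : ∀ (x : S) (a : A x), a ∈ B x ↔ σ x a = 0) {r : ℕ}
    (hr : ∀ x ∈ S, Module.finrank ℝ (LinearMap.range (σ x)) = r)
    (hk : Module.finrank ℝ F₁ + r = Module.finrank ℝ F) (x₀ : S) :
    Nonempty (SubbundleChart E F F₁ B x₀) := by
  set t := trivializationAt F A (x₀ : M) with ht
  have hx₀ : (x₀ : M) ∈ t.baseSet := FiberBundle.mem_baseSet_trivializationAt' _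
  have : CompleteSpace F := FiniteDimensional.complete ℝ F
  let K : M → F →L[ℝ] W := fun y => LinearMap.toContinuousLinearMap ((σ y).comp (t.symmₗ ℝ y))
  have hK : ∀ y ∈ t.baseSet, ∀ v, K y v = σ y (t.symm y v) := fun y hy v =>
    congrArg (σ y) (t.symmₗ_apply hy v)
  have hK' : ∀ y ∈ t.baseSet, ∀ a : A y, K y (t ⟨y, a⟩).2 = σ y a := fun y hy a => by
    rw [hK y hy, t.symm_apply_apply_mk hy]
  have hKs : ContMDiffOn 𝓘(ℝ, E) 𝓘(ℝ, F →L[ℝ] W) ∞ K t.baseSet := by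
    refine contMDiffOn_clm_of_apply fun v => ?_
    exact (hσ.comp_contMDiffOn (contMDiffOn_trivialization_symm (x₀ : M) contMDiffOn_id
      (contMDiffOn_const (c := v)) fun y hy => hy)).congr fun y hy => hK y hy v
  have hker : ∀ y ∈ S, y ∈ t.baseSet →
      Module.finrank ℝ (LinearMap.ker (K y : F →ₗ[ℝ] W)) = Module.finrank ℝ F₁ := by
    intro y hy hyt
    have h1 : LinearMap.range (K y : F →ₗ[ℝ] W) = LinearMap.range (σ y) := by
      ext w
      constructor
      · rintro ⟨v, rfl⟩
        exact ⟨_, (hK y hyt v).symm⟩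
      · rintro ⟨a, rfl⟩
        exact ⟨_, hK' y hyt a⟩
    have h2 := LinearMap.finrank_range_add_finrank_ker (K y : F →ₗ[ℝ] W)
    rw [h1, hr y hy] at h2
    omega
  let N := LinearMap.ker (K x₀ : F →ₗ[ℝ] W)
  let R := LinearMap.range (K x₀ : F →ₗ[ℝ] W)
  obtain ⟨pN, hpN⟩ := N.subtype.exists_leftInverse_of_injective (by simp)
  obtain ⟨pR, hpR⟩ := R.subtype.exists_leftInverse_of_injective (by simp)
  let ℓ : N ≃ₗ[ℝ] F₁ := LinearEquiv.ofFinrankEq N F₁ (hker x₀ x₀.2 hx₀)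
  let P : F →L[ℝ] F₁ := LinearMap.toContinuousLinearMap ((ℓ : N →ₗ[ℝ] F₁).comp pN)
  let Q' : W →L[ℝ] R := LinearMap.toContinuousLinearMap pR
  -- T straightens the kernel: its components are a projection to the kernel at x₀ and K y projected
  -- to the range at x₀. It is invertible at x₀, hence nearby.
  let T : M → F →L[ℝ] F₁ × R := fun y => P.prod (Q'.comp (K y))
  have hT0 : (T x₀).IsInvertible := by
    have hinj : Function.Injective (T x₀) := by
      rw [injective_iff_map_eq_zero]
      intro v hv
      have h1 : ℓ (pN v) = 0 := congrArg Prod.fst hv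
      have h2 : pR (K x₀ v) = 0 := congrArg Prod.snd hv
      have h3 : pR (K x₀ v) = ⟨K x₀ v, v, rfl⟩ :=
        LinearMap.congr_fun hpR (⟨K x₀ v, v, rfl⟩ : R)
      have h4 : K x₀ v = 0 := congrArg Subtype.val (h3.symm.trans h2)
      have h5 : pN v = ⟨v, h4⟩ := LinearMap.congr_fun hpN (⟨v, h4⟩ : N)
      exact congrArg Subtype.val (h5.symm.trans (ℓ.map_eq_zero_iff.1 h1))
    have hdim : Module.finrank ℝ F = Module.finrank ℝ (F₁ × R) := by
      have h2 := LinearMap.finrank_range_add_finrank_ker (K x₀ : F →ₗ[ℝ] W)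
      have h3 := hker x₀ x₀.2 hx₀
      rw [Module.finrank_prod]
      change _ = _ + Module.finrank ℝ (LinearMap.range (K x₀ : F →ₗ[ℝ] W))
      omega
    exact ⟨(LinearEquiv.ofInjectiveOfFinrankEq (T x₀ : F →ₗ[ℝ] F₁ × R) hinj hdim
      ).toContinuousLinearEquiv, by ext v <;> rfl⟩
  have hTs : ContMDiffOn 𝓘(ℝ, E) 𝓘(ℝ, F →L[ℝ] F₁ × R) ∞ T t.baseSet :=
    contMDiffOn_clm_of_apply fun v => contMDiffOn_const.prodMk_space
      (Q'.contMDiff.comp_contMDiffOn (hKs.clm_apply (contMDiffOn_const (c := v))))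
  let U : Set M := t.baseSet ∩ T ⁻¹' {S | S.IsInvertible}
  have hU : IsOpen U := by
    refine hTs.continuousOn.isOpen_inter_preimage t.open_baseSet ?_
    exact ContinuousLinearEquiv.isOpen
  have hTinj : ∀ y ∈ U, Function.Injective (T y) := by
    rintro y ⟨-, e, he⟩
    rw [← he]
    exact e.injective
  have hinv : ∀ y ∈ U, ∀ v, (T y).inverse (T y v) = v := by
    rintro y ⟨-, e, he⟩ v
    rw [← he, ContinuousLinearMap.inverse_equiv]
    exact e.symm_apply_apply v
  -- For y ∈ S the kernel of K y has dimension dim F₁, and P is injective on it because T y is. So P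
  -- maps it onto F₁. Constant rank is needed here, and only along S.
  have hsurj : ∀ y ∈ S, y ∈ U → ∀ u : F₁, ∃ v, K y v = 0 ∧ P v = u := by
    intro y hy hyU u
    let f : LinearMap.ker (K y : F →ₗ[ℝ] W) →ₗ[ℝ] F₁ :=
      (P : F →ₗ[ℝ] F₁).comp (LinearMap.ker (K y : F →ₗ[ℝ] W)).subtype
    have hf : Function.Injective f := by
      rw [injective_iff_map_eq_zero]
      intro v hv
      refine Subtype.ext (hTinj y hyU ?_)
      rw [Submodule.coe_zero, map_zero]
      refine Prod.ext hv ?_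
      change Q' (K y v) = 0
      have hv' : K y v = 0 := v.2
      rw [hv', map_zero]
    obtain ⟨v, hv⟩ := (LinearMap.injective_iff_surjective_of_finrank_eq_finrank
      (hker y hy hyU.1)).1 hf u
    exact ⟨v, v.2, hv⟩
  have hQ : ∀ y ∈ U, ∀ v, K y v = 0 → (T y).inverse (P v, 0) = v := by
    intro y hy v hv
    have : T y v = (P v, 0) := Prod.ext rfl (by change Q' (K y v) = 0; rw [hv, map_zero])
    rw [← this, hinv y hy]
  refine ⟨⟨U, hU, ⟨hx₀, hT0⟩, Set.inter_subset_left, fun _ => P,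
    fun y => (T y).inverse.comp (ContinuousLinearMap.inl ℝ F₁ R), contMDiffOn_const, ?_,
    fun y u hy => ?_, fun y u hy => ?_, fun y b hy => ?_⟩⟩
  · intro y hy
    obtain ⟨e, he⟩ := hy.2
    have h1 : ContMDiffAt 𝓘(ℝ, F →L[ℝ] F₁ × R) 𝓘(ℝ, F₁ × R →L[ℝ] F) ∞
        ContinuousLinearMap.inverse (T y) := by
      rw [← he]
      exact (contDiffAt_map_inverse e).contMDiffAt
    exact ((h1.comp y (hTs.contMDiffAt (t.open_baseSet.mem_nhds hy.1))).clm_comp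
      contMDiffAt_const).contMDiffWithinAt
  · obtain ⟨v, hv, rfl⟩ := hsurj y y.2 hy u
    rw [hB, ← hK y hy.1]
    change K y ((T y).inverse (P v, 0)) = 0
    rw [hQ y hy v hv, hv]
  · obtain ⟨v, hv, rfl⟩ := hsurj y y.2 hy u
    change P ((T y).inverse (P v, 0)) = P v
    rw [hQ y hy v hv]
  · exact hQ y hy _ ((hK' y hy.1 b).trans ((hB y b).1 b.2))

end KernelBundle

/-! ### Regular level sets -/

section Level

variable {E : Type*} [NormedAddCommGroup E] [NormedSpace ℝ E] [FiniteDimensional ℝ E]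
  {M : Type*} [TopologicalSpace M] [ChartedSpace E M] [IsManifold 𝓘(ℝ, E) ∞ M]
  {V : Type*} [NormedAddCommGroup V] [NormedSpace ℝ V] [FiniteDimensional ℝ V]

/-- The preimage of a regular value is a submanifold, whose tangent spaces are the kernels of the
differential. -/
theorem exists_isSubmanifold_preimage {J : M → V} (hJ : ContMDiff 𝓘(ℝ, E) 𝓘(ℝ, V) ∞ J)
    {J' : M → E →L[ℝ] V} (hJ' : ∀ x, HasMFDerivAt 𝓘(ℝ, E) 𝓘(ℝ, V) J x (J' x)) (μ : V)
    (hreg : ∀ x, J x = μ → Function.Surjective (J' x)) :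
    ∃ (d : ℕ) (_ : ChartedSpace (EuclideanSpace ℝ (Fin d)) (J ⁻¹' {μ}))
      (_ : IsManifold 𝓘(ℝ, EuclideanSpace ℝ (Fin d)) ∞ (J ⁻¹' {μ})),
      IsSubmanifold (E := E) (EuclideanSpace ℝ (Fin d)) (J ⁻¹' {μ}) ∧
      ∀ (x : J ⁻¹' {μ}) (v : E), J' x v = 0 →
        ∃ w : EuclideanSpace ℝ (Fin d), (mfderiv 𝓘(ℝ, EuclideanSpace ℝ (Fin d)) 𝓘(ℝ, E)
          (Subtype.val : J ⁻¹' {μ} → M) x w : E) = v := by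
  have hdim : ∀ x, J x = μ → Module.finrank ℝ V +
      Module.finrank ℝ (LinearMap.ker (J' x : E →ₗ[ℝ] V)) = Module.finrank ℝ E := by
    intro x hx
    have h1 := LinearMap.finrank_range_add_finrank_ker (J' x : E →ₗ[ℝ] V)
    rwa [LinearMap.range_eq_top.2 (hreg x hx), finrank_top] at h1
  -- The truncated subtraction is a true one as soon as the level set has a point, since the
  -- differential is onto there; for an empty level set any dimension will do.
  obtain ⟨i1, i2, hS⟩ := exists_isSubmanifold (E := E)
    (E₁ := EuclideanSpace ℝ (Fin (Module.finrank ℝ E - Module.finrank ℝ V))) (W := V)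
    (S := J ⁻¹' {μ}) fun x hx => by
      have hx' : J x = μ := hx
      refine ⟨fun y => J y - μ, J' x, Set.univ, isOpen_univ, trivial,
        (hJ.sub contMDiff_const).contMDiffOn, fun y _ => sub_eq_zero.symm,
        ((hJ' x).sub (hasMFDerivAt_const μ x)).congr_mfderiv (sub_zero (J' x)), hreg x hx', ?_⟩
      have := hdim x hx'
      rw [finrank_euclideanSpace_fin]
      omega
  refine ⟨_, i1, i2, hS, fun x v hv => ?_⟩
  refine hS.exists_mfderiv_val_eq (hJ' x) Filter.univ_mem (v := μ) (fun y _ hy => hy) ?_ hv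
  have := hdim x x.2
  rw [finrank_euclideanSpace_fin]
  omega

end Level

/-! ### Extension of sections and independence of the bracket -/

section Restriction

variable {E : Type*} [NormedAddCommGroup E] [NormedSpace ℝ E] [FiniteDimensional ℝ E]
  {M : Type*} [TopologicalSpace M] [T2Space M] [ChartedSpace E M] [IsManifold 𝓘(ℝ, E) ∞ M]
  {F : Type*} [NormedAddCommGroup F] [NormedSpace ℝ F]
  {A : M → Type*} [∀ x, AddCommGroup (A x)] [∀ x, Module ℝ (A x)] [∀ x, TopologicalSpace (A x)]
  [TopologicalSpace (TotalSpace F A)] [FiberBundle F A] [VectorBundle ℝ F A]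
  {S : Set M} {E₁ : Type*} [NormedAddCommGroup E₁] [NormedSpace ℝ E₁] [ChartedSpace E₁ S]
  {F₁ : Type*} [NormedAddCommGroup F₁] [NormedSpace ℝ F₁] {B : ∀ x : S, Submodule ℝ (A x)}
  [TopologicalSpace (TotalSpace F₁ (fun x : S => B x))] [FiberBundle F₁ (fun x : S => B x)]
  [VectorBundle ℝ F₁ (fun x : S => B x)]

/-- The restriction to `S` of a section of `A` that takes values in the subbundle `B` over `S`. -/
def secRestrict (hS : IsSubmanifold (E := E) E₁ S) (hB : IsSubbundle E F E₁ (F₁ := F₁) B)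
    (X : Sec (E := E) F A) (hX : ∀ x : S, X x ∈ B x) : Sec (E := E₁) F₁ (fun x : S => B x) :=
  ⟨fun x => ⟨X x, hX x⟩, (hB.contMDiff_iff hS).2 (X.contMDiff.comp hS.contMDiff_val)⟩

variable [ContMDiffVectorBundle ∞ F A 𝓘(ℝ, E)]

/-- Near a point of S, compose with a retraction onto S and carry the value to the fibre over y by
means of a trivialization of A. Closedness of S allows these local extensions to be glued. -/
theorem exists_extension [SigmaCompactSpace M] (hSc : IsClosed S)
    (hS : IsSubmanifold (E := E) E₁ S) (hB : IsSubbundle E F E₁ (F₁ := F₁) B)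
    (X : Sec (E := E₁) F₁ (fun x : S => B x)) :
    ∃ Y : Sec (E := E) F A, ∀ x : S, Y x = X x := by
  refine exists_sec_eqOn hSc (fun x : S => (X x : A x)) fun x => ?_
  obtain ⟨U, hU, hxU, r, hr, hrS⟩ := hS.exists_retraction x
  set t := trivializationAt F A (x : M) with ht
  have hxt : (x : M) ∈ t.baseSet := FiberBundle.mem_baseSet_trivializationAt' _
  have hr' : ContMDiffOn 𝓘(ℝ, E) 𝓘(ℝ, E) ∞ (fun y => (r y : M)) U :=
    hS.contMDiff_val.comp_contMDiffOn hr
  set V : Set M := (U ∩ (fun y => (r y : M)) ⁻¹' t.baseSet) ∩ t.baseSet with hV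
  have hVo : IsOpen V :=
    (hr'.continuousOn.isOpen_inter_preimage hU t.open_baseSet).inter t.open_baseSet
  have hxV : (x : M) ∈ V := ⟨⟨hxU, by
    rw [Set.mem_preimage, hrS x hxU]; exact hxt⟩, hxt⟩
  have h1 : ContMDiffOn 𝓘(ℝ, E) (𝓘(ℝ, E).prod 𝓘(ℝ, F)) ∞
      (fun y => (⟨(r y : M), (X (r y) : A (r y))⟩ : TotalSpace F A)) V :=
    hB.contMDiff_incl.comp_contMDiffOn (X.contMDiff.comp_contMDiffOn (hr.mono fun y hy => hy.1.1))
  have h2 : ContMDiffOn 𝓘(ℝ, E) 𝓘(ℝ, F) ∞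
      (fun y => (t (⟨(r y : M), (X (r y) : A (r y))⟩ : TotalSpace F A)).2) V :=
    contMDiff_snd.comp_contMDiffOn ((t.contMDiffOn (IB := 𝓘(ℝ, E)) (n := ∞)).comp h1
      fun y hy => (Trivialization.mem_source _).2 hy.1.2)
  refine ⟨V, hVo.mem_nhds hxV, _,
    contMDiffOn_trivialization_symm (x : M) contMDiffOn_id h2 fun y hy => hy.2, fun y hy => ?_⟩
  have h3 : r y = y := hrS y hy.1.1
  change t.symm (y : M) (t (subIncl (F := F) F₁ B ⟨r y, X (r y)⟩)).2 = _
  rw [h3]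
  exact t.symm_apply_apply_mk hy.2 _

/-- Restriction is a surjective linear map onto the sections of B, so it has a linear right inverse.
With a linear extension the restricted bracket is bilinear by construction. -/
theorem exists_linear_extension [SigmaCompactSpace M] (hSc : IsClosed S)
    (hS : IsSubmanifold (E := E) E₁ S) (hB : IsSubbundle E F E₁ (F₁ := F₁) B) :
    ∃ ε : Sec (E := E₁) F₁ (fun x : S => B x) →ₗ[ℝ] Sec (E := E) F A,
      ∀ X (x : S), ε X x = X x := by
  let W : Submodule ℝ (Sec (E := E) F A) :=
    { carrier := {X | ∀ x : S, X x ∈ B x}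
      zero_mem' := fun x => (B x).zero_mem
      add_mem' := fun hX hY x => (B x).add_mem (hX x) (hY x)
      smul_mem' := fun c X hX x => (B x).smul_mem c (hX x) }
  let res : W →ₗ[ℝ] Sec (E := E₁) F₁ (fun x : S => B x) :=
    { toFun := fun X => secRestrict hS hB X.1 X.2
      map_add' := fun _ _ => rfl
      map_smul' := fun _ _ => rfl }
  obtain ⟨ε, hε⟩ := res.exists_rightInverse_of_surjective (LinearMap.range_eq_top.2 fun X => by
    obtain ⟨Y, hY⟩ := exists_extension hSc hS hB X
    exact ⟨⟨Y, fun x => by rw [hY x]; exact (X x).2⟩,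
      ContMDiffSection.ext fun x => by apply Subtype.ext; exact hY x⟩)
  refine ⟨W.subtype ∘ₗ ε, fun X x => ?_⟩
  have h := congrArg (fun Z : Sec (E := E₁) F₁ (fun x : S => B x) => (Z x : A x))
    (LinearMap.congr_fun hε X)
  exact h

/-- The subbundle `B` of `A` over `S` is stable under the operations of the Lie algebroid `A`: the
anchor maps it to vectors tangent to `S`, and the sections of `A` with values in `B` over `S` are
closed under the bracket. -/
structure IsInvolutive (L : LieAlgebroid (E := E) F A) (E₁ : Type*) [NormedAddCommGroup E₁]
    [NormedSpace ℝ E₁] [ChartedSpace E₁ S] (B : ∀ x : S, Submodule ℝ (A x)) : Prop where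
  exists_anchor : ∀ (x : S) (a : A x), a ∈ B x → ∃ w : E₁,
    (mfderiv 𝓘(ℝ, E₁) 𝓘(ℝ, E) (Subtype.val : S → M) x w : E) = L.anchor x a
  bracket_mem : ∀ X Y : Sec (E := E) F A, (∀ x : S, X x ∈ B x) → (∀ x : S, Y x ∈ B x) →
    ∀ x : S, L.bracket X Y x ∈ B x

/-- A function that is constant on `S` has vanishing derivative along vectors tangent to `S`. -/
theorem IsSubmanifold.dirDeriv_eq_zero (hS : IsSubmanifold (E := E) E₁ S) {x : S} {w : E₁} {v : E}
    (hw : (mfderiv 𝓘(ℝ, E₁) 𝓘(ℝ, E) (Subtype.val : S → M) x w : E) = v)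
    {f : M → ℝ} (hf : MDifferentiableAt 𝓘(ℝ, E) 𝓘(ℝ, ℝ) f x) {U : Set M} (hU : U ∈ 𝓝 (x : M))
    {c : ℝ} (hfU : ∀ y ∈ U, y ∈ S → f y = c) :
    dirDeriv 𝓘(ℝ, E) f x v = 0 := by
  obtain ⟨D, hD⟩ : ∃ D : E →L[ℝ] ℝ, HasMFDerivAt 𝓘(ℝ, E) 𝓘(ℝ, ℝ) f (x : M) D :=
    ⟨_, hf.hasMFDerivAt⟩
  exact (dirDeriv_eq hD _).trans ((congrArg D hw).symm.trans (hS.mfderiv_val_eq_zero hD hU hfU w))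

variable [FiniteDimensional ℝ F]

/-- The values over `S` of the bracket of two sections with values in `B` over `S` only depend on
the restrictions to `S`. -/
theorem IsInvolutive.bracket_congr {L : LieAlgebroid (E := E) F A}
    (hL : IsInvolutive L E₁ B) (hS : IsSubmanifold (E := E) E₁ S) {X X' Y Y' : Sec (E := E) F A}
    {x : S} {U : Set M} (hU : U ∈ 𝓝 (x : M))
    (hX : ∀ y : S, X y ∈ B y) (hY : ∀ y : S, Y y ∈ B y)
    (hXX' : ∀ y : S, (y : M) ∈ U → X y = X' y) (hYY' : ∀ y : S, (y : M) ∈ U → Y y = Y' y) :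
    L.bracket X Y x = L.bracket X' Y' x := by
  have key : ∀ X Z Z' : Sec (E := E) F A, X x ∈ B x → (∀ y : S, (y : M) ∈ U → Z y = Z' y) →
      L.bracket X Z x = L.bracket X Z' x := by
    intro X Z Z' hX hZ
    have h := L.bracket_apply_eq_zero (X := X) (Z := Z - Z') x.2 hU
      (fun y hy hyS => by
        rw [ContMDiffSection.coe_sub, Pi.sub_apply]
        exact sub_eq_zero.2 (hZ ⟨y, hyS⟩ hy))
      fun f hf hfU => by
        obtain ⟨w, hw⟩ := hL.exists_anchor x (X x) hX
        exact hS.dirDeriv_eq_zero hw ((hf _).mdifferentiableAt (by simp)) hU hfU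
    rw [map_sub, ContMDiffSection.coe_sub, Pi.sub_apply] at h
    exact sub_eq_zero.1 h
  -- Y is replaced by Y', and then X by X' after exchanging the arguments. The second replacement
  -- only uses that Y' lies in B at x, where it agrees with Y.
  have hY' : Y' x ∈ B x := hYY' x (mem_of_mem_nhds hU) ▸ hY x
  rw [key X Y Y' (hX x) hYY', L.bracket_skew X, L.bracket_skew X', ContMDiffSection.coe_neg,
    ContMDiffSection.coe_neg, Pi.neg_apply, Pi.neg_apply, key Y' X X' hY' hXX']

/-- The Lie algebroid `L₁` on the subbundle `B` is the restriction of `L`. -/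
structure IsRestriction [IsManifold 𝓘(ℝ, E₁) ∞ S]
    (L₁ : LieAlgebroid (E := E₁) F₁ (fun x : S => B x))
    (L : LieAlgebroid (E := E) F A) : Prop where
  anchor : ∀ (x : S) (b : B x), (mfderiv 𝓘(ℝ, E₁) 𝓘(ℝ, E) (Subtype.val : S → M) x
    (L₁.anchor x b) : E) = L.anchor x b
  bracket : ∀ (X Y : Sec (E := E₁) F₁ (fun x : S => B x)) (X' Y' : Sec (E := E) F A),
    (∀ x : S, X' x = X x) → (∀ x : S, Y' x = Y x) →
      ∀ x : S, (L₁.bracket X Y x : A x) = L.bracket X' Y' x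

end Restriction

/-! ### Restriction of a Lie algebroid to an involutive subbundle -/

section Restriction

variable {E : Type*} [NormedAddCommGroup E] [NormedSpace ℝ E] [FiniteDimensional ℝ E]
  {M : Type*} [TopologicalSpace M] [T2Space M] [ChartedSpace E M] [IsManifold 𝓘(ℝ, E) ∞ M]
  {F : Type*} [NormedAddCommGroup F] [NormedSpace ℝ F]
  {A : M → Type*} [∀ x, AddCommGroup (A x)] [∀ x, Module ℝ (A x)] [∀ x, TopologicalSpace (A x)]
  [TopologicalSpace (TotalSpace F A)] [FiberBundle F A] [VectorBundle ℝ F A]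
  {S : Set M} {E₁ : Type*} [NormedAddCommGroup E₁] [NormedSpace ℝ E₁] [ChartedSpace E₁ S]

/-- Smooth functions on a submanifold extend locally to smooth functions on the manifold. -/
theorem IsSubmanifold.exists_extension (hS : IsSubmanifold (E := E) E₁ S) {f : S → ℝ}
    (hf : ContMDiff 𝓘(ℝ, E₁) 𝓘(ℝ, ℝ) ∞ f) (x : S) :
    ∃ g : M → ℝ, ContMDiff 𝓘(ℝ, E) 𝓘(ℝ, ℝ) ∞ g ∧ ∃ U ∈ 𝓝 (x : M), ∀ y : S, (y : M) ∈ U →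
      g y = f y := by
  obtain ⟨U, hU, hxU, r, hr, hrS⟩ := hS.exists_retraction x
  obtain ⟨χ, hχ, hχs, hχ1⟩ := exists_bump (E := E) (hU.mem_nhds hxU)
  refine ⟨fun y => χ y * f (r y), contMDiff_of_tsupport fun y hy => ?_, _,
    Filter.inter_mem hχ1 (hU.mem_nhds hxU), fun y hy => ?_⟩
  · have hyU : y ∈ U := hχs (closure_mono (Function.support_mul_subset_left χ _) hy)
    exact (hχ y).mul ((hf _).comp y (hr.contMDiffAt (hU.mem_nhds hyU)))
  · have h1 : χ y = 1 := hy.1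
    dsimp only
    rw [h1, hrS y hy.2, one_mul]

variable {F₁ : Type*} [NormedAddCommGroup F₁] [NormedSpace ℝ F₁] {B : ∀ x : S, Submodule ℝ (A x)}
  [TopologicalSpace (TotalSpace F₁ (fun x : S => B x))] [FiberBundle F₁ (fun x : S => B x)]
  [VectorBundle ℝ F₁ (fun x : S => B x)]
  [IsManifold 𝓘(ℝ, E₁) ∞ S]

/-- The vector w tangent to S is recovered from its image v in TM by the tangent map of a local
retraction, which is smooth. -/
theorem contMDiff_of_mfderiv_val {EN : Type*} [NormedAddCommGroup EN] [NormedSpace ℝ EN]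
    {HN : Type*} [TopologicalSpace HN]
    {I : ModelWithCorners ℝ EN HN} {N : Type*} [TopologicalSpace N] [ChartedSpace HN N]
    (hS : IsSubmanifold (E := E) E₁ S) {p : N → S} {w : N → E₁} {v : N → E}
    (hp : ContMDiff I 𝓘(ℝ, E₁) ∞ p)
    (hv : ContMDiff I 𝓘(ℝ, E).tangent ∞ (fun q => (⟨p q, v q⟩ : TangentBundle 𝓘(ℝ, E) M)))
    (hw : ∀ q, (mfderiv 𝓘(ℝ, E₁) 𝓘(ℝ, E) (Subtype.val : S → M) (p q) (w q) : E) = v q) :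
    ContMDiff I 𝓘(ℝ, E₁).tangent ∞ (fun q => (⟨p q, w q⟩ : TangentBundle 𝓘(ℝ, E₁) S)) := by
  intro q₀
  obtain ⟨U, hU, hxU, r, hr, hrS⟩ := hS.exists_retraction (p q₀)
  have hVo : IsOpen ((fun q => (p q : M)) ⁻¹' U) :=
    hU.preimage (continuous_subtype_val.comp hp.continuous)
  have h1 := (hr.contMDiffOn_tangentMapWithin (m := ∞) (by simp) hU.uniqueMDiffOn).comp
    hv.contMDiffOn (s := (fun q => (p q : M)) ⁻¹' U) fun q hq => hq
  refine (h1.contMDiffAt (hVo.mem_nhds hxU)).congr_of_eventuallyEq ?_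
  filter_upwards [hVo.mem_nhds hxU] with q hq
  have h2 : (mfderiv 𝓘(ℝ, E) 𝓘(ℝ, E₁) r (p q : M) (v q) : E₁) = w q := by
    rw [← hw q]
    exact hS.mfderiv_retraction_comp hU hr hrS hq (w q)
  have h3 : mfderivWithin 𝓘(ℝ, E) 𝓘(ℝ, E₁) r U (p q : M) = mfderiv 𝓘(ℝ, E) 𝓘(ℝ, E₁) r (p q : M) :=
    mfderivWithin_of_mem_nhds (hU.mem_nhds hq)
  have key : ∀ (a b : S) (u v : E₁), a = b → u = v →
      (⟨a, u⟩ : TangentBundle 𝓘(ℝ, E₁) S) = ⟨b, v⟩ := by rintro a _ u _ rfl rfl; rfl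
  refine key _ _ _ _ (hrS _ hq).symm ?_
  exact h2.symm.trans (congrArg (fun T : E →L[ℝ] E₁ => T (v q)) h3.symm)

variable [ContMDiffVectorBundle ∞ F A 𝓘(ℝ, E)] [FiniteDimensional ℝ F]

/-- A Lie algebroid restricts to an involutive subbundle over a closed submanifold. -/
theorem exists_isRestriction [SigmaCompactSpace M] {L : LieAlgebroid (E := E) F A}
    (hSc : IsClosed S) (hS : IsSubmanifold (E := E) E₁ S)
    (hB : IsSubbundle E F E₁ (F₁ := F₁) B) (hL : IsInvolutive L E₁ B) :
    ∃ L₁ : LieAlgebroid (E := E₁) F₁ (fun x : S => B x), IsRestriction L₁ L := by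
  obtain ⟨ε, hε⟩ := exists_linear_extension hSc hS hB
  have hεB : ∀ X (x : S), ε X x ∈ B x := fun X x => by rw [hε]; exact (X x).2
  have hbr : ∀ X Y (x : S), L.bracket (ε X) (ε Y) x ∈ B x := fun X Y =>
    hL.bracket_mem _ _ (hεB X) (hεB Y)
  -- The vector tangent to S with image ρ(a) is unique, as the inclusion is an immersion; this makes
  -- it linear in a.
  choose w hw using hL.exists_anchor
  let ρ : ∀ x : S, B x →ₗ[ℝ] TangentSpace 𝓘(ℝ, E₁) x := fun x =>
    { toFun := fun b => w x b b.2
      map_add' := fun a b => hS.injective_mfderiv_val x (by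
        refine (hw x _ _).trans (Eq.trans ?_ (map_add (mfderiv 𝓘(ℝ, E₁) 𝓘(ℝ, E)
          (Subtype.val : S → M) x : E₁ →L[ℝ] E) _ _).symm)
        exact (map_add (L.anchor x) (a : A x) b).trans
          (congrArg₂ (fun u v : E => u + v) (hw x a a.2).symm (hw x b b.2).symm))
      map_smul' := fun c b => hS.injective_mfderiv_val x (by
        refine (hw x _ _).trans (Eq.trans ?_ (map_smul (mfderiv 𝓘(ℝ, E₁) 𝓘(ℝ, E)
          (Subtype.val : S → M) x : E₁ →L[ℝ] E) _ _).symm)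
        exact (map_smul (L.anchor x) c (b : A x)).trans
          (congrArg (fun u : E => c • u) (hw x b b.2).symm)) }
  let β : Sec (E := E₁) F₁ (fun x : S => B x) →ₗ[ℝ] Sec (E := E₁) F₁ (fun x : S => B x) →ₗ[ℝ]
      Sec (E := E₁) F₁ (fun x : S => B x) :=
    LinearMap.mk₂ ℝ (fun X Y => secRestrict hS hB (L.bracket (ε X) (ε Y)) (hbr X Y))
      (fun X X' Y => ContMDiffSection.ext fun x => by
        apply Subtype.ext
        change L.bracket (ε (X + X')) (ε Y) x = L.bracket (ε X) (ε Y) x + L.bracket (ε X') (ε Y) x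
        simp only [map_add, LinearMap.add_apply, ContMDiffSection.coe_add, Pi.add_apply])
      (fun c X Y => ContMDiffSection.ext fun x => by
        apply Subtype.ext
        change L.bracket (ε (c • X)) (ε Y) x = c • L.bracket (ε X) (ε Y) x
        simp only [map_smul, LinearMap.smul_apply, ContMDiffSection.coe_smul, Pi.smul_apply])
      (fun X Y Y' => ContMDiffSection.ext fun x => by
        apply Subtype.ext
        change L.bracket (ε X) (ε (Y + Y')) x = L.bracket (ε X) (ε Y) x + L.bracket (ε X) (ε Y') x
        simp only [map_add, ContMDiffSection.coe_add, Pi.add_apply])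
      (fun c X Y => ContMDiffSection.ext fun x => by
        apply Subtype.ext
        change L.bracket (ε X) (ε (c • Y)) x = c • L.bracket (ε X) (ε Y) x
        simp only [map_smul, ContMDiffSection.coe_smul, Pi.smul_apply])
  -- Agreement near x is enough. This matters for the Leibniz rule, where a function on S is only
  -- extended locally.
  have hβ : ∀ (X Y : Sec (E := E₁) F₁ (fun x : S => B x)) (X' Y' : Sec (E := E) F A) (x : S)
      (U : Set M), U ∈ 𝓝 (x : M) →
      (∀ y : S, (y : M) ∈ U → X' y = X y) → (∀ y : S, (y : M) ∈ U → Y' y = Y y) →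
      (β X Y x : A x) = L.bracket X' Y' x := fun X Y X' Y' x U hU hX hY =>
    hL.bracket_congr hS hU (hεB X) (hεB Y) (fun y hy => (hε X y).trans (hX y hy).symm)
      (fun y hy => (hε Y y).trans (hY y hy).symm)
  have hβ' : ∀ (X Y : Sec (E := E₁) F₁ (fun x : S => B x)) (x : S),
      (β X Y x : A x) = L.bracket (ε X) (ε Y) x := fun X Y x => rfl
  have hv : ContMDiff (𝓘(ℝ, E₁).prod 𝓘(ℝ, F₁)) 𝓘(ℝ, E).tangent ∞
      (fun b : TotalSpace F₁ (fun x : S => B x) =>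
        (⟨(b.1 : M), L.anchor b.1 (b.2 : A b.1)⟩ : TangentBundle 𝓘(ℝ, E) M)) :=
    L.contMDiff_anchor.comp hB.contMDiff_incl
  refine ⟨⟨ρ, ?_, β, ?_, ?_, ?_⟩, ?_, ?_⟩
  · exact contMDiff_of_mfderiv_val hS (contMDiff_proj _) hv fun b => hw b.1 b.2 b.2.2
  · refine fun X => ContMDiffSection.ext fun x => ?_
    apply Subtype.ext
    rw [hβ', L.bracket_self]
    rfl
  · refine fun X Y Z => ContMDiffSection.ext fun x => ?_
    apply Subtype.ext
    -- The bracket ⟦εY, εZ⟧ is itself an extension of β Y Z, so iterated brackets can be computed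
    -- with it and the Jacobi identity of L applies.
    change (β X (β Y Z) x : A x) = (β (β X Y) Z x : A x) + β Y (β X Z) x
    rw [hβ X (β Y Z) (ε X) (L.bracket (ε Y) (ε Z)) x _ Filter.univ_mem (fun y _ => hε X y)
        (fun y _ => rfl),
      hβ (β X Y) Z (L.bracket (ε X) (ε Y)) (ε Z) x _ Filter.univ_mem (fun y _ => rfl)
        (fun y _ => hε Z y),
      hβ Y (β X Z) (ε Y) (L.bracket (ε X) (ε Z)) x _ Filter.univ_mem (fun y _ => hε Y y)
        (fun y _ => rfl), L.jacobi, ContMDiffSection.coe_add, Pi.add_apply]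
  · intro X Y f hf x
    apply Subtype.ext
    obtain ⟨g, hg, U, hU, hgU⟩ := hS.exists_extension hf x
    rw [hβ X (funSMul f hf Y) (ε X) (funSMul g hg (ε Y)) x U hU (fun y _ => hε X y)
      (fun y hy => by rw [funSMul_apply, hgU y hy, hε]; rfl), L.leibniz, hgU x (mem_of_mem_nhds hU),
      hε Y]
    change f x • L.bracket (ε X) (ε Y) x + _ = f x • L.bracket (ε X) (ε Y) x + _ • (Y x : A x)
    congr 2
    rw [hε X]
    have h1 : (fun y : S => g y) =ᶠ[𝓝 x] f := by
      filter_upwards [continuous_subtype_val.continuousAt.preimage_mem_nhds hU] with y hy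
      exact hgU y hy
    have h2 := dirDeriv_comp (f := g) ((hg _).mdifferentiableAt (by simp))
      (hS.mdifferentiableAt_val x).hasMFDerivAt (w x (X x) (X x).2)
    refine Eq.trans ?_ (h2.symm.trans (dirDeriv_congr h1 _))
    exact congrArg (fun v : E => dirDeriv 𝓘(ℝ, E) g x v) (hw x (X x) (X x).2).symm
  · exact fun x b => hw x b b.2
  · exact fun X Y X' Y' hX hY x => hβ X Y X' Y' x _ Filter.univ_mem (fun y _ => hX y)
      (fun y _ => hY y)

omit [FiniteDimensional ℝ F] in
-- The formula for the differential of the restricted form is that of L on extended sections,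
-- evaluated on S: derivatives are along vectors tangent to S and brackets restrict.
theorem IsRestriction.isLieSubalgebroid [SigmaCompactSpace M] {L : LieAlgebroid (E := E) F A}
    {L₁ : LieAlgebroid (E := E₁) F₁ (fun x : S => B x)} (h : IsRestriction L₁ L)
    (hSc : IsClosed S) (hS : IsSubmanifold (E := E) E₁ S)
    (hB : IsSubbundle E F E₁ (F₁ := F₁) B) :
    IsLieSubalgebroid L₁ L (Subtype.val : S → M) (fun x => (B x).subtype) := by
  obtain ⟨ε, hε⟩ := exists_linear_extension hSc hS hB
  refine ⟨⟨hB.contMDiff_incl, fun k α β hα hβ X x => ?_⟩, Subtype.val_injective,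
    hS.isSmoothEmbedding.isImmersion, fun x => Subtype.val_injective⟩
  have h1 := hβ (fun i => ε (X i)) x
  have h2 : ∀ (y : S) (i : Fin (k + 1)), (B y).subtype (X i y) = ε (X i) y := fun y i =>
    (hε (X i) y).symm
  have h3 : ∀ (y : S) (i : Fin (k + 1)), ((B y).subtype ∘ i.removeNth fun l => X l y) =
      i.removeNth fun l => ε (X l) y := fun y i => by
    funext l
    exact h2 y _
  refine Eq.trans ?_ (h1.trans ?_)
  · refine congrArg (β x) ?_
    funext i
    exact h2 x i
  · congr 1
    · refine Finset.sum_congr rfl fun i _ => ?_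
      congr 1
      have hsm : ContMDiff 𝓘(ℝ, E) 𝓘(ℝ, ℝ) ∞
          (fun y => α y (i.removeNth (fun l => ε (X l) y))) := hα fun j => ε (X (i.succAbove j))
      have h4 := dirDeriv_comp (f := fun y => α y (i.removeNth (fun l => ε (X l) y)))
        ((hsm _).mdifferentiableAt (by simp)) (hS.mdifferentiableAt_val x).hasMFDerivAt
        (L₁.anchor x (X i x))
      refine Eq.trans ?_ (h4.symm.trans ?_)
      · refine congrArg (fun v : E => dirDeriv 𝓘(ℝ, E) _ (x : M) v) ?_
        refine Eq.trans ?_ (h.anchor x (X i x)).symm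
        exact congrArg (L.anchor x) (hε (X i) x)
      · refine congrArg (fun f : S → ℝ => dirDeriv 𝓘(ℝ, E₁) f x (L₁.anchor x (X i x))) ?_
        funext y
        exact (congrArg (α y) (h3 y i)).symm
    · cases k with
      | zero => rfl
      | succ n =>
        refine Finset.sum_congr rfl fun i _ => Finset.sum_congr rfl fun j _ => ?_
        congr 1
        refine congrArg (α x) ?_
        funext l
        refine Fin.cases ?_ (fun l => ?_) l
        · exact (h.bracket _ _ _ _ (hε _) (hε _) x).symm
        · exact hε _ x

end Restriction

/-! ### Involutivity of the level bundle -/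

section Level

variable {E : Type*} [NormedAddCommGroup E] [NormedSpace ℝ E] [FiniteDimensional ℝ E]
  {M : Type*} [TopologicalSpace M] [T2Space M] [SigmaCompactSpace M] [ChartedSpace E M]
  [IsManifold 𝓘(ℝ, E) ∞ M]
  {F : Type*} [NormedAddCommGroup F] [NormedSpace ℝ F] [FiniteDimensional ℝ F]
  {A : M → Type*} [∀ x, AddCommGroup (A x)] [∀ x, Module ℝ (A x)] [∀ x, TopologicalSpace (A x)]
  [TopologicalSpace (TotalSpace F A)] [FiberBundle F A] [VectorBundle ℝ F A]
  [ContMDiffVectorBundle ∞ F A 𝓘(ℝ, E)]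
  {EG : Type*} [NormedAddCommGroup EG] [NormedSpace ℝ EG] [FiniteDimensional ℝ EG]
  {L : LieAlgebroid (E := E) F A} {J : M → (EG →L[ℝ] ℝ)} {μ : EG →L[ℝ] ℝ}
  {E₁ : Type*} [NormedAddCommGroup E₁] [NormedSpace ℝ E₁] [ChartedSpace E₁ (J ⁻¹' {μ})]

/-- The anchor turns ⟦X, Y⟧ into a commutator of derivations, here applied to J_η. Each of its terms
differentiates, along a vector tangent to S, a function that vanishes on S. -/
theorem isInvolutive_levelFiber (hJ : ContMDiff 𝓘(ℝ, E) 𝓘(ℝ, EG →L[ℝ] ℝ) ∞ J)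
    (hS : IsSubmanifold (E := E) E₁ (J ⁻¹' {μ}))
    (ht : ∀ (x : J ⁻¹' {μ}) (v : E), tangentJ (E := E) J x v = 0 → ∃ w : E₁,
      (mfderiv 𝓘(ℝ, E₁) 𝓘(ℝ, E) (Subtype.val : J ⁻¹' {μ} → M) x w : E) = v) :
    IsInvolutive L E₁ (levelFiber L J μ) := by
  refine ⟨fun x a ha => ht x _ (mem_levelFiber_iff.1 ha), fun X Y hX hY x => ?_⟩
  rw [mem_levelFiber_iff]
  ext η
  have hJη : ContMDiff 𝓘(ℝ, E) 𝓘(ℝ, ℝ) ∞ (fun y => J y η) := hJ.clm_apply contMDiff_const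
  refine (dirDeriv_apply_eq_tangentJ hJ x η _).symm.trans ?_
  rw [L.dirDeriv_anchor_bracket hJη]
  have key : ∀ X Y : Sec (E := E) F A, (∀ x : J ⁻¹' {μ}, X x ∈ levelFiber L J μ x) →
      (∀ x : J ⁻¹' {μ}, Y x ∈ levelFiber L J μ x) →
      dirDeriv 𝓘(ℝ, E) (fun y => dirDeriv 𝓘(ℝ, E) (fun y => J y η) y (L.anchor y (Y y))) x
        (L.anchor x (X x)) = 0 := by
    intro X Y hX hY
    obtain ⟨w, hw⟩ := ht x _ (mem_levelFiber_iff.1 (hX x))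
    refine hS.dirDeriv_eq_zero (c := 0) hw
      ((L.contMDiff_dirDeriv_anchor hJη Y _).mdifferentiableAt (by simp)) Filter.univ_mem
      fun y _ hy => ?_
    refine (dirDeriv_apply_eq_tangentJ hJ y η _).trans ?_
    exact congrArg (fun l : EG →L[ℝ] ℝ => l η) (mem_levelFiber_iff.1 (hY ⟨y, hy⟩))
  rw [key X Y hX hY, key Y X hY hX, sub_zero]
  rfl

end Level

/-! ### The isotropy group as a level set of constant rank -/

section Isotropy

variable {EG : Type*} [NormedAddCommGroup EG] [NormedSpace ℝ EG] [FiniteDimensional ℝ EG]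
  [CompleteSpace EG]
  {G : Type*} [Group G] [TopologicalSpace G] [ChartedSpace EG G] [LieGroup 𝓘(ℝ, EG) ∞ G]

theorem mem_isotropyGroup_iff {μ : EG →L[ℝ] ℝ} {g : G} :
    g ∈ isotropyGroup G μ ↔ μ.comp (Ad (EG := EG) g) = μ := by
  rw [← inv_mem_iff]
  change μ.comp (Ad (EG := EG) (g⁻¹)⁻¹) = μ ↔ _
  rw [inv_inv]

/-- The derivative at `1` of `g ↦ μ ∘ Ad_g`. -/
theorem exists_hasMFDerivAt_coadjoint (μ : EG →L[ℝ] ℝ) :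
    ∃ D : EG →L[ℝ] EG →L[ℝ] ℝ,
      HasMFDerivAt 𝓘(ℝ, EG) 𝓘(ℝ, EG →L[ℝ] ℝ) (fun g : G => μ.comp (Ad (EG := EG) g)) 1 D ∧
      ∀ ξ η : EG, D ξ η = μ (Bracket.bracket (L := GroupLieAlgebra 𝓘(ℝ, EG) G)
        (M := GroupLieAlgebra 𝓘(ℝ, EG) G) ξ η) := by
  have hf : ContMDiff 𝓘(ℝ, EG) 𝓘(ℝ, EG →L[ℝ] ℝ) ∞ (fun g : G => μ.comp (Ad (EG := EG) g)) :=
    contMDiff_const.clm_comp contMDiff_Ad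
  obtain ⟨D, hD⟩ : ∃ D : EG →L[ℝ] EG →L[ℝ] ℝ,
      HasMFDerivAt 𝓘(ℝ, EG) 𝓘(ℝ, EG →L[ℝ] ℝ) (fun g : G => μ.comp (Ad (EG := EG) g)) 1 D :=
    ⟨_, ((hf 1).mdifferentiableAt (by simp)).hasMFDerivAt⟩
  refine ⟨D, hD, fun ξ η => ?_⟩
  have hAd : ContMDiff 𝓘(ℝ, EG) 𝓘(ℝ, EG) ∞ (fun k : G => Ad (EG := EG) k η) :=
    (contMDiff_Ad (EG := EG) (G := G)).clm_apply contMDiff_const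
  obtain ⟨D', hD', hDη'⟩ : ∃ D' : EG →L[ℝ] EG,
      HasMFDerivAt 𝓘(ℝ, EG) 𝓘(ℝ, EG) (fun k : G => Ad (EG := EG) k η) (1 : G) D' ∧
      ∀ ξ : EG, D' ξ = Bracket.bracket (L := GroupLieAlgebra 𝓘(ℝ, EG) G)
        (M := GroupLieAlgebra 𝓘(ℝ, EG) G) ξ η :=
    ⟨_, ((hAd 1).mdifferentiableAt (by simp)).hasMFDerivAt, fun ξ => mfderiv_Ad_apply ξ η⟩
  have h1 : HasMFDerivAt 𝓘(ℝ, EG) 𝓘(ℝ, ℝ) (fun g : G => μ (Ad (EG := EG) g η)) 1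
      ((ContinuousLinearMap.apply ℝ ℝ η).comp D) :=
    (ContinuousLinearMap.apply ℝ ℝ η).hasMFDerivAt.comp 1 hD
  have h2 : HasMFDerivAt 𝓘(ℝ, EG) 𝓘(ℝ, ℝ) (fun g : G => μ (Ad (EG := EG) g η)) 1 (μ.comp D') :=
    μ.hasMFDerivAt.comp 1 hD'
  have key : ∀ T T' : EG →L[ℝ] ℝ, T = T' → T ξ = T' ξ := by rintro T _ rfl; rfl
  exact (key _ _ (hasMFDerivAt_unique h1 h2)).trans (congrArg μ (hDη' ξ))

/-- Right translations have invertible derivatives. -/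
theorem exists_hasMFDerivAt_mul_right (g h : G) :
    ∃ R : EG ≃L[ℝ] EG, HasMFDerivAt 𝓘(ℝ, EG) 𝓘(ℝ, EG) (fun k : G => k * h) g (R : EG →L[ℝ] EG) := by
  have hd : ∀ g h : G, ∃ R : EG →L[ℝ] EG,
      HasMFDerivAt 𝓘(ℝ, EG) 𝓘(ℝ, EG) (fun k : G => k * h) g R := fun g h =>
    ⟨_, ((contMDiff_mul_right (I := 𝓘(ℝ, EG)) (n := ∞) (a := h) g).mdifferentiableAt
      (by simp)).hasMFDerivAt⟩
  have hinv : ∀ (g h : G) (R R' : EG →L[ℝ] EG),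
      HasMFDerivAt 𝓘(ℝ, EG) 𝓘(ℝ, EG) (fun k : G => k * h) g R →
      HasMFDerivAt 𝓘(ℝ, EG) 𝓘(ℝ, EG) (fun k : G => k * h⁻¹) (g * h) R' → ∀ v, R' (R v) = v := by
    intro g h R R' hR hR' v
    have h1 : HasMFDerivAt 𝓘(ℝ, EG) 𝓘(ℝ, EG) (fun k : G => k) g (R'.comp R) := by
      refine HasMFDerivAt.congr_of_eventuallyEq (f' := R'.comp R) (hR'.comp g hR)
        (Filter.Eventually.of_forall fun k => ?_)
      simp
    have key : ∀ T T' : EG →L[ℝ] EG, T = T' → T v = T' v := by rintro T _ rfl; rfl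
    exact key _ _ (hasMFDerivAt_unique h1 (hasMFDerivAt_id g))
  obtain ⟨R, hR⟩ := hd g h
  obtain ⟨R', hR'⟩ := hd (g * h) h⁻¹
  refine ⟨ContinuousLinearEquiv.equivOfInverse R R' (hinv g h R R' hR hR') ?_, hR⟩
  refine hinv (g * h) h⁻¹ R' R hR' ?_
  rwa [mul_inv_cancel_right, inv_inv]

/-- Since μ ∘ Ad_k = (μ ∘ Ad_{kg⁻¹}) ∘ Ad_g, the derivative at g is the derivative D at 1 between
two invertible maps. The rank is therefore constant. -/
theorem hasMFDerivAt_coadjoint {μ : EG →L[ℝ] ℝ} {D : EG →L[ℝ] EG →L[ℝ] ℝ}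
    (hD : HasMFDerivAt 𝓘(ℝ, EG) 𝓘(ℝ, EG →L[ℝ] ℝ) (fun g : G => μ.comp (Ad (EG := EG) g)) 1 D)
    (g : G) : ∃ R : EG ≃L[ℝ] EG,
      HasMFDerivAt 𝓘(ℝ, EG) 𝓘(ℝ, EG →L[ℝ] ℝ) (fun g : G => μ.comp (Ad (EG := EG) g)) g
        ((((ContinuousLinearMap.compL ℝ EG EG ℝ).flip (Ad (EG := EG) g)).comp D).comp
          (R : EG →L[ℝ] EG)) := by
  obtain ⟨R, hR⟩ := exists_hasMFDerivAt_mul_right (EG := EG) g g⁻¹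
  refine ⟨R, ?_⟩
  have h1 : HasMFDerivAt 𝓘(ℝ, EG) 𝓘(ℝ, EG →L[ℝ] ℝ) (fun g : G => μ.comp (Ad (EG := EG) g))
      (g * g⁻¹) D := by rwa [mul_inv_cancel]
  have h2 := (((ContinuousLinearMap.compL ℝ EG EG ℝ).flip (Ad (EG := EG) g)).hasMFDerivAt.comp
    (g * g⁻¹) h1).comp g hR
  refine HasMFDerivAt.congr_of_eventuallyEq h2 (Filter.Eventually.of_forall fun k => ?_)
  simp only [Function.comp_apply, ContinuousLinearMap.flip_apply, ContinuousLinearMap.compL_apply]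
  rw [ContinuousLinearMap.comp_assoc, ← Ad_mul, inv_mul_cancel_right]

/-- A linear map becomes a submersion when composed with a projection onto its range. -/
theorem exists_projection_range {E V : Type*} [NormedAddCommGroup E] [NormedSpace ℝ E]
    [FiniteDimensional ℝ E] [NormedAddCommGroup V] [NormedSpace ℝ V] [FiniteDimensional ℝ V]
    (D : E →L[ℝ] V) :
    ∃ (m : ℕ) (Q : V →L[ℝ] EuclideanSpace ℝ (Fin m)) (s : EuclideanSpace ℝ (Fin m) →L[ℝ] E),
      (∀ r, Q (D (s r)) = r) ∧ (∀ v, D (s (Q (D v))) = D v) ∧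
      Module.finrank ℝ (LinearMap.ker (D : E →ₗ[ℝ] V)) + m = Module.finrank ℝ E := by
  set R := LinearMap.range (D : E →ₗ[ℝ] V) with hR
  obtain ⟨Q₀, hQ₀⟩ := LinearMap.exists_leftInverse_of_injective R.subtype
    (LinearMap.ker_eq_bot.2 R.subtype_injective)
  obtain ⟨s₀, hs₀⟩ := (D : E →ₗ[ℝ] V).rangeRestrict.exists_rightInverse_of_surjective
    (LinearMap.range_rangeRestrict (D : E →ₗ[ℝ] V))
  have hQ : ∀ r : R, Q₀ r = r := fun r => LinearMap.congr_fun hQ₀ r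
  have hs : ∀ r : R, D (s₀ r) = r := fun r => congrArg Subtype.val (LinearMap.congr_fun hs₀ r)
  let i : R ≃ₗ[ℝ] EuclideanSpace ℝ (Fin (Module.finrank ℝ R)) :=
    LinearEquiv.ofFinrankEq _ _ (by simp)
  refine ⟨Module.finrank ℝ R, LinearMap.toContinuousLinearMap (i.toLinearMap ∘ₗ Q₀),
    LinearMap.toContinuousLinearMap (s₀ ∘ₗ i.symm.toLinearMap), fun r => ?_, fun v => ?_, ?_⟩
  · change i (Q₀ (D (s₀ (i.symm r)))) = r
    rw [hs, hQ, i.apply_symm_apply]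
  · change D (s₀ (i.symm (i (Q₀ (D v))))) = D v
    rw [i.symm_apply_apply, hs]
    exact congrArg Subtype.val (hQ ⟨D v, v, rfl⟩)
  · rw [add_comm]
    exact LinearMap.finrank_range_add_finrank_ker _

/-- Near `1`, the group `G_μ` is the zero set of a submersion. -/
theorem exists_submersion_isotropyGroup {μ : EG →L[ℝ] ℝ} {D : EG →L[ℝ] EG →L[ℝ] ℝ}
    (hD : HasMFDerivAt 𝓘(ℝ, EG) 𝓘(ℝ, EG →L[ℝ] ℝ) (fun g : G => μ.comp (Ad (EG := EG) g)) 1 D) :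
    ∃ (m : ℕ) (h : G → EuclideanSpace ℝ (Fin m)) (h' : EG →L[ℝ] EuclideanSpace ℝ (Fin m))
      (U : Set G), IsOpen U ∧ 1 ∈ U ∧
      ContMDiff 𝓘(ℝ, EG) 𝓘(ℝ, EuclideanSpace ℝ (Fin m)) ∞ h ∧
      (∀ g ∈ U, g ∈ isotropyGroup G μ ↔ h g = 0) ∧
      HasMFDerivAt 𝓘(ℝ, EG) 𝓘(ℝ, EuclideanSpace ℝ (Fin m)) h 1 h' ∧ Function.Surjective h' ∧
      Module.finrank ℝ (LinearMap.ker (D : EG →ₗ[ℝ] EG →L[ℝ] ℝ)) + m = Module.finrank ℝ EG := by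
  obtain ⟨m, Q, s, hQs, hsQ, hm⟩ := exists_projection_range D
  let f : G → EG →L[ℝ] ℝ := fun g => μ.comp (Ad (EG := EG) g)
  have hf : ContMDiff 𝓘(ℝ, EG) 𝓘(ℝ, EG →L[ℝ] ℝ) ∞ f := contMDiff_const.clm_comp contMDiff_Ad
  have hf1 : f 1 = μ := by
    change μ.comp (Ad (EG := EG) (1 : G)) = μ
    rw [Ad_one]; rfl
  -- Up to the invertible derivative of a right translation, K g is the derivative of Q ∘ f at g.
  let K : G → EG →L[ℝ] EuclideanSpace ℝ (Fin m) := fun g =>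
    Q.comp (((ContinuousLinearMap.compL ℝ EG EG ℝ).flip (Ad (EG := EG) g)).comp D)
  have hKc : Continuous fun g => (K g).comp s := by
    have h1 : Continuous fun g : G => (ContinuousLinearMap.compL ℝ EG EG ℝ).flip (Ad (EG := EG) g) :=
      (ContinuousLinearMap.continuous _).comp contMDiff_Ad.continuous
    exact (continuous_const.clm_comp (h1.clm_comp continuous_const)).clm_comp continuous_const
  have hK1 : (K 1).comp s = ContinuousLinearMap.id ℝ _ := by
    refine ContinuousLinearMap.ext fun r => ?_
    change Q ((D (s r)).comp (Ad (EG := EG) (1 : G))) = r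
    rw [Ad_one]
    exact hQs r
  -- K 1 ∘ s is the identity, so K g ∘ s stays invertible near 1. There K g is onto and its kernel
  -- lies in that of D, so Q ∘ f is a submersion whose derivative has no larger kernel than that of
  -- f.
  let U : Set G := {g | ((K g).comp s).det ≠ 0}
  have hU : IsOpen U := isOpen_ne.preimage (ContinuousLinearMap.continuous_det.comp hKc)
  have h1U : (1 : G) ∈ U := by
    change ((K 1).comp s).det ≠ 0
    rw [hK1]
    simp [ContinuousLinearMap.det]
  have hinj : ∀ g ∈ U, Function.Injective ((K g).comp s) := fun g hg =>
    LinearMap.ker_eq_bot.1 (not_not.1 fun h => hg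
      (LinearMap.det_eq_zero_iff_ker_ne_bot.2 h))
  have hsurj : ∀ g ∈ U, Function.Surjective (K g) := fun g hg r => by
    obtain ⟨r', hr'⟩ := (LinearMap.injective_iff_surjective (f := ((K g).comp s).toLinearMap)).1 (hinj g hg) r
    exact ⟨s r', hr'⟩
  have hker : ∀ g ∈ U, ∀ v, K g v = 0 → D v = 0 := by
    intro g hg v hv
    have h1 : ((K g).comp s) (Q (D v)) = 0 := by
      change Q ((D (s (Q (D v)))).comp (Ad (EG := EG) g)) = 0
      rw [hsQ]
      exact hv
    rw [← hsQ v, hinj g hg (h1.trans (map_zero _).symm), map_zero, map_zero]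
  let h : G → EuclideanSpace ℝ (Fin m) := fun g => Q (f g) - Q μ
  have hh : ContMDiff 𝓘(ℝ, EG) 𝓘(ℝ, EuclideanSpace ℝ (Fin m)) ∞ h :=
    (Q.contMDiff.comp hf).sub contMDiff_const
  have hhd : ∀ g : G, ∃ S : EG ≃L[ℝ] EG,
      HasMFDerivAt 𝓘(ℝ, EG) 𝓘(ℝ, EG →L[ℝ] ℝ) f g
        ((((ContinuousLinearMap.compL ℝ EG EG ℝ).flip (Ad (EG := EG) g)).comp D).comp
          (S : EG →L[ℝ] EG)) ∧
      HasMFDerivAt 𝓘(ℝ, EG) 𝓘(ℝ, EuclideanSpace ℝ (Fin m)) h g ((K g).comp (S : EG →L[ℝ] EG)) := by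
    intro g
    obtain ⟨S, hS⟩ := hasMFDerivAt_coadjoint hD g
    refine ⟨S, hS, ?_⟩
    have h1 := (Q.hasMFDerivAt.comp g hS).sub (hasMFDerivAt_const (Q μ) g)
    refine HasMFDerivAt.congr_mfderiv h1 (sub_zero _)
  -- A priori Z is larger than G_μ near 1, because Q forgets part of f. But the derivative of f
  -- vanishes along Z, so f is locally constant on Z and equals μ on it near 1.
  let Z : Set G := {g | g ∈ U ∧ h g = 0}
  obtain ⟨i1, i2, hZ⟩ := exists_isSubmanifold (E := EG)
    (E₁ := LinearMap.ker (D : EG →ₗ[ℝ] EG →L[ℝ] ℝ)) (W := EuclideanSpace ℝ (Fin m)) (S := Z) fun g hg => by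
      obtain ⟨S, -, hS⟩ := hhd g
      refine ⟨h, _, U, hU, hg.1, hh.contMDiffOn, fun y hy => ⟨fun hyZ => hyZ.2, fun h0 => ⟨hy, h0⟩⟩,
        hS, fun r => ?_, by
        rw [finrank_euclideanSpace_fin, hm]⟩
      obtain ⟨v, hv⟩ := hsurj g hg.1 r
      exact ⟨S.symm v, (congrArg (K g) (S.apply_symm_apply v)).trans hv⟩
  have hzero : ∀ g : Z, HasMFDerivAt 𝓘(ℝ, LinearMap.ker (D : EG →ₗ[ℝ] EG →L[ℝ] ℝ))
      𝓘(ℝ, EG →L[ℝ] ℝ) (fun g : Z => f g) g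
      (0 : LinearMap.ker (D : EG →ₗ[ℝ] EG →L[ℝ] ℝ) →L[ℝ] EG →L[ℝ] ℝ) := by
    intro g
    obtain ⟨S, hSf, hSh⟩ := hhd g
    refine HasMFDerivAt.congr_mfderiv (hSf.comp g (hZ.mdifferentiableAt_val g).hasMFDerivAt) ?_
    refine ContinuousLinearMap.ext fun w => ?_
    have h1 := hZ.mfderiv_val_eq_zero hSh Filter.univ_mem (v := 0) (fun y _ hy => hy.2) w
    have h2 := hker g g.2.1 _ h1
    change (D (S _)).comp (Ad (EG := EG) (g : G)) = 0
    refine (congrArg (fun l : EG →L[ℝ] ℝ => l.comp (Ad (EG := EG) (g : G))) h2).trans ?_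
    exact ContinuousLinearMap.zero_comp _
  have h1Z : (1 : G) ∈ Z := ⟨h1U, by
    change Q (f 1) - Q μ = 0
    rw [hf1, sub_self]⟩
  have hloc := (IsLocallyConstant.iff_eventually_eq _).1
    (isLocallyConstant_of_hasMFDerivAt_zero hzero) ⟨1, h1Z⟩
  rw [nhds_subtype_eq_comap, Filter.eventually_comap] at hloc
  obtain ⟨N, hN, hNo, h1N⟩ := eventually_nhds_iff.1 hloc
  obtain ⟨S, -, hS⟩ := hhd 1
  refine ⟨m, h, _, U ∩ N, hU.inter hNo, ⟨h1U, h1N⟩, hh, fun g hg => ?_, hS, fun r => ?_,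
    hm⟩
  · rw [mem_isotropyGroup_iff]
    constructor
    · intro h0
      change Q (f g) - Q μ = 0
      rw [show f g = μ from h0, sub_self]
    · intro h0
      exact (hN g hg.2 ⟨g, hg.1, h0⟩ rfl).trans hf1
  · obtain ⟨v, hv⟩ := hsurj 1 h1U r
    exact ⟨S.symm v, (congrArg (K 1) (S.apply_symm_apply v)).trans hv⟩

/-- `G_μ` is an embedded submanifold of `G`. -/
theorem exists_isSubmanifold_isotropyGroup {μ : EG →L[ℝ] ℝ} {D : EG →L[ℝ] EG →L[ℝ] ℝ}
    (hD : HasMFDerivAt 𝓘(ℝ, EG) 𝓘(ℝ, EG →L[ℝ] ℝ) (fun g : G => μ.comp (Ad (EG := EG) g)) 1 D)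
    {E₁ : Type*} [NormedAddCommGroup E₁] [NormedSpace ℝ E₁] [FiniteDimensional ℝ E₁]
    (hE₁ : Module.finrank ℝ E₁ = Module.finrank ℝ (LinearMap.ker (D : EG →ₗ[ℝ] EG →L[ℝ] ℝ))) :
    ∃ (_ : ChartedSpace E₁ (isotropyGroup G μ : Set G))
      (_ : IsManifold 𝓘(ℝ, E₁) ∞ (isotropyGroup G μ : Set G)),
      IsSubmanifold (E := EG) E₁ (isotropyGroup G μ : Set G) := by
  have : IsManifold 𝓘(ℝ, EG) ∞ G := inferInstance
  obtain ⟨m, h, h', U, hU, h1U, hh, hhU, hd, hsurj, hm⟩ := exists_submersion_isotropyGroup hD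
  -- Right translation by g⁻¹ preserves G_μ and carries the situation at g to the one at 1.
  refine exists_isSubmanifold (E := EG) (E₁ := E₁) (W := EuclideanSpace ℝ (Fin m)) fun g hg => ?_
  obtain ⟨R, hR⟩ := exists_hasMFDerivAt_mul_right (EG := EG) g g⁻¹
  have hr : ContMDiff 𝓘(ℝ, EG) 𝓘(ℝ, EG) ∞ (fun k : G => k * g⁻¹) := contMDiff_mul_right
  have hd' : HasMFDerivAt 𝓘(ℝ, EG) 𝓘(ℝ, EuclideanSpace ℝ (Fin m)) h (g * g⁻¹)
      h' := by rwa [mul_inv_cancel]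
  refine ⟨fun k => h (k * g⁻¹), h'.comp (R : EG →L[ℝ] EG), (fun k => k * g⁻¹) ⁻¹' U,
    hU.preimage hr.continuous, ?_, (hh.comp hr).contMDiffOn, fun k hk => ?_, hd'.comp g hR,
    hsurj.comp R.surjective, ?_⟩
  · rwa [Set.mem_preimage, mul_inv_cancel]
  · rw [← hhU _ hk, SetLike.mem_coe]
    exact (Subgroup.mul_mem_cancel_right _ (inv_mem hg)).symm
  · rw [hE₁, finrank_euclideanSpace_fin, hm]

end Isotropy

/-! ### Embedded Lie subgroups -/

section Subgroup

variable {EG : Type*} [NormedAddCommGroup EG] [NormedSpace ℝ EG]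
  {G : Type*} [Group G] [TopologicalSpace G] [ChartedSpace EG G]
  {E₁ : Type*} [NormedAddCommGroup E₁] [NormedSpace ℝ E₁] {H : Subgroup G} [ChartedSpace E₁ H]

theorem IsSubmanifold.contMDiff_subgroup_iff (hH : IsSubmanifold (E := EG) E₁ (H : Set G))
    {EN : Type*} [NormedAddCommGroup EN] [NormedSpace ℝ EN] {HN : Type*} [TopologicalSpace HN]
    {I : ModelWithCorners ℝ EN HN} {N : Type*} [TopologicalSpace N] [ChartedSpace HN N]
    {f : N → H} :
    ContMDiff I 𝓘(ℝ, E₁) ∞ f ↔ ContMDiff I 𝓘(ℝ, EG) ∞ (fun q => (f q : G)) :=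
  hH.contMDiff_iff (f := f)

theorem IsSubmanifold.contMDiff_subgroup_val (hH : IsSubmanifold (E := EG) E₁ (H : Set G)) :
    ContMDiff 𝓘(ℝ, E₁) 𝓘(ℝ, EG) ∞ (Subtype.val : H → G) :=
  hH.contMDiff_val

theorem IsSubmanifold.lieGroup [LieGroup 𝓘(ℝ, EG) ∞ G] [IsManifold 𝓘(ℝ, E₁) ∞ H]
    (hH : IsSubmanifold (E := EG) E₁ (H : Set G)) : LieGroup 𝓘(ℝ, E₁) ∞ H where
  contMDiff_mul := hH.contMDiff_subgroup_iff.2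
    ((hH.contMDiff_subgroup_val.comp contMDiff_fst).mul
      (hH.contMDiff_subgroup_val.comp contMDiff_snd))
  contMDiff_inv := hH.contMDiff_subgroup_iff.2 hH.contMDiff_subgroup_val.inv

theorem hasMFDerivAt_subgroup_val (hH : ContMDiff 𝓘(ℝ, E₁) 𝓘(ℝ, EG) ∞ (Subtype.val : H → G)) :
    ∃ T : E₁ →L[ℝ] EG, HasMFDerivAt 𝓘(ℝ, E₁) 𝓘(ℝ, EG) (Subtype.val : H → G) 1 T ∧
      ∀ ξ : E₁, (mfderiv 𝓘(ℝ, E₁) 𝓘(ℝ, EG) (Subtype.val : H → G) 1 ξ : EG) = T ξ :=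
  ⟨_, ((hH 1).mdifferentiableAt (by simp)).hasMFDerivAt, fun _ => rfl⟩

variable [LieGroup 𝓘(ℝ, EG) ∞ G] [LieGroup 𝓘(ℝ, E₁) ∞ H]

/-- The inclusion intertwines the conjugations of H and G; the statement is the derivative of this
at 1. -/
theorem hasMFDerivAt_val_Ad {T : E₁ →L[ℝ] EG}
    (hT : HasMFDerivAt 𝓘(ℝ, E₁) 𝓘(ℝ, EG) (Subtype.val : H → G) 1 T) (h : H) (η : E₁) :
    T (Ad (EG := E₁) h η) = Ad (EG := EG) (h : G) (T η) := by
  have hT' : HasMFDerivAt 𝓘(ℝ, E₁) 𝓘(ℝ, EG) (Subtype.val : H → G) (h * 1 * h⁻¹) T := by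
    rwa [mul_one, mul_inv_cancel]
  have h1 := hT'.comp 1 (hasMFDerivAt_conj (EG := E₁) h)
  have h2 : HasMFDerivAt 𝓘(ℝ, E₁) 𝓘(ℝ, EG) (fun k : H => (h : G) * (k : G) * (h : G)⁻¹) 1
      ((Ad (EG := EG) (h : G)).comp T) := (hasMFDerivAt_conj (EG := EG) (h : G)).comp 1 hT
  have key : ∀ T T' : E₁ →L[ℝ] EG, T = T' → T η = T' η := by rintro T _ rfl; rfl
  exact key _ _ (hasMFDerivAt_unique h1 h2)

variable [FiniteDimensional ℝ EG] [CompleteSpace EG] [FiniteDimensional ℝ E₁] [CompleteSpace E₁]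

/-- Differentiating T ∘ Ad_k = Ad_k ∘ T at k = 1 gives the claim, since the derivative of Ad is the
bracket. -/
theorem hasMFDerivAt_val_bracket {T : E₁ →L[ℝ] EG}
    (hT : HasMFDerivAt 𝓘(ℝ, E₁) 𝓘(ℝ, EG) (Subtype.val : H → G) 1 T) (ξ η : E₁) :
    T (Bracket.bracket (L := GroupLieAlgebra 𝓘(ℝ, E₁) H) (M := GroupLieAlgebra 𝓘(ℝ, E₁) H) ξ η) =
      Bracket.bracket (L := GroupLieAlgebra 𝓘(ℝ, EG) G) (M := GroupLieAlgebra 𝓘(ℝ, EG) G)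
        (T ξ) (T η) := by
  have hAd : ContMDiff 𝓘(ℝ, EG) 𝓘(ℝ, EG) ∞ (fun k : G => Ad (EG := EG) k (T η)) :=
    (contMDiff_Ad (EG := EG) (G := G)).clm_apply contMDiff_const
  have hAd' : ContMDiff 𝓘(ℝ, E₁) 𝓘(ℝ, E₁) ∞ (fun k : H => Ad (EG := E₁) k η) :=
    (contMDiff_Ad (EG := E₁) (G := H)).clm_apply contMDiff_const
  obtain ⟨D, hD, hDv⟩ : ∃ D : EG →L[ℝ] EG,
      HasMFDerivAt 𝓘(ℝ, EG) 𝓘(ℝ, EG) (fun k : G => Ad (EG := EG) k (T η)) (1 : G) D ∧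
      ∀ ξ : EG, D ξ = Bracket.bracket (L := GroupLieAlgebra 𝓘(ℝ, EG) G)
        (M := GroupLieAlgebra 𝓘(ℝ, EG) G) ξ (T η) :=
    ⟨_, ((hAd 1).mdifferentiableAt (by simp)).hasMFDerivAt, fun ξ => mfderiv_Ad_apply ξ (T η)⟩
  obtain ⟨D', hD', hDv'⟩ : ∃ D : E₁ →L[ℝ] E₁,
      HasMFDerivAt 𝓘(ℝ, E₁) 𝓘(ℝ, E₁) (fun k : H => Ad (EG := E₁) k η) (1 : H) D ∧
      ∀ ξ : E₁, D ξ = Bracket.bracket (L := GroupLieAlgebra 𝓘(ℝ, E₁) H)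
        (M := GroupLieAlgebra 𝓘(ℝ, E₁) H) ξ η :=
    ⟨_, ((hAd' 1).mdifferentiableAt (by simp)).hasMFDerivAt, fun ξ => mfderiv_Ad_apply ξ η⟩
  have h1 : HasMFDerivAt 𝓘(ℝ, E₁) 𝓘(ℝ, EG) (fun k : H => T (Ad (EG := E₁) k η)) 1 (T.comp D') :=
    T.hasMFDerivAt.comp 1 hD'
  have hD1 : HasMFDerivAt 𝓘(ℝ, EG) 𝓘(ℝ, EG) (fun k : G => Ad (EG := EG) k (T η)) ((1 : H) : G) D :=
    hD
  have h2 : HasMFDerivAt 𝓘(ℝ, E₁) 𝓘(ℝ, EG) (fun k : H => T (Ad (EG := E₁) k η)) 1 (D.comp T) := by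
    refine HasMFDerivAt.congr_of_eventuallyEq (f' := D.comp T) (hD1.comp 1 hT)
      (Filter.Eventually.of_forall fun k => ?_)
    exact hasMFDerivAt_val_Ad hT k η
  have key : ∀ T T' : E₁ →L[ℝ] EG, T = T' → T ξ = T' ξ := by rintro T _ rfl; rfl
  have h3 := key _ _ (hasMFDerivAt_unique h1 h2)
  exact (congrArg T (hDv' ξ)).symm.trans (h3.trans (hDv (T ξ)))

end Subgroup

/-! ### The Lie algebra of the isotropy group -/

section Isotropy

variable {EG : Type*} [NormedAddCommGroup EG] [NormedSpace ℝ EG] [FiniteDimensional ℝ EG]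
  [CompleteSpace EG]
  {G : Type*} [Group G] [TopologicalSpace G] [ChartedSpace EG G] [LieGroup 𝓘(ℝ, EG) ∞ G]

/-- The isotropy group of the coadjoint action is an embedded Lie subgroup whose Lie algebra is the
isotropy algebra. -/
theorem exists_lieGroup_isotropyGroup (μ : EG →L[ℝ] ℝ) :
    ∃ (e : ℕ) (_ : ChartedSpace (EuclideanSpace ℝ (Fin e)) (isotropyGroup G μ))
      (_ : LieGroup 𝓘(ℝ, EuclideanSpace ℝ (Fin e)) ∞ (isotropyGroup G μ))
      (ι : GroupLieAlgebra 𝓘(ℝ, EuclideanSpace ℝ (Fin e)) (isotropyGroup G μ)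
        ≃ₗ⁅ℝ⁆ isotropyAlgebra G μ),
      IsSmoothEmbedding 𝓘(ℝ, EuclideanSpace ℝ (Fin e)) 𝓘(ℝ, EG) ∞
        (Subtype.val : isotropyGroup G μ → G) ∧
      ∀ ξ, (ι ξ : GroupLieAlgebra 𝓘(ℝ, EG) G) =
        mfderiv 𝓘(ℝ, EuclideanSpace ℝ (Fin e)) 𝓘(ℝ, EG)
          (Subtype.val : isotropyGroup G μ → G) 1 ξ := by
  obtain ⟨D, hD, hDb⟩ := exists_hasMFDerivAt_coadjoint (G := G) μ
  -- Since D ξ η = μ([ξ, η]), the kernel of D is the space underlying 𝔤_μ. Its dimension is that of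
  -- G_μ, so the tangent space at 1, which lies in the kernel, fills it.
  set e := Module.finrank ℝ (LinearMap.ker (D : EG →ₗ[ℝ] EG →L[ℝ] ℝ)) with he
  obtain ⟨i1, i2, hH⟩ := exists_isSubmanifold_isotropyGroup hD
    (E₁ := EuclideanSpace ℝ (Fin e)) (by rw [finrank_euclideanSpace_fin])
  let i1' : ChartedSpace (EuclideanSpace ℝ (Fin e)) (isotropyGroup G μ) := i1
  have i2' : IsManifold 𝓘(ℝ, EuclideanSpace ℝ (Fin e)) ∞ (isotropyGroup G μ) := i2
  have i3 : LieGroup 𝓘(ℝ, EuclideanSpace ℝ (Fin e)) ∞ (isotropyGroup G μ) := hH.lieGroup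
  obtain ⟨T, hT, hTξ⟩ := hasMFDerivAt_subgroup_val hH.contMDiff_subgroup_val
  have hinj : Function.Injective T := fun a b h =>
    hH.injective_mfderiv_val (1 : isotropyGroup G μ) ((hTξ a).trans (h.trans (hTξ b).symm))
  have hmem : ∀ ξ : EuclideanSpace ℝ (Fin e), T ξ ∈ isotropyAlgebra G μ := by
    intro ξ η
    have h1 : D (T ξ) = 0 := (congrArg D (hTξ ξ)).symm.trans
      (hH.mfderiv_val_eq_zero (x := (1 : isotropyGroup G μ)) hD
        Filter.univ_mem (v := μ) (fun y _ hy => mem_isotropyGroup_iff.1 hy) ξ)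
    exact (hDb (T ξ) η).symm.trans (congrArg (fun l : EG →L[ℝ] ℝ => l η) h1)
  have hsurj : ∀ ξ : EG, ξ ∈ isotropyAlgebra G μ → ∃ w, T w = ξ := by
    intro ξ hξ
    have hDξ : D ξ = 0 := by
      ext η
      exact (hDb ξ η).trans (hξ η)
    obtain ⟨w, hw⟩ := hH.exists_mfderiv_val_eq (x := (1 : isotropyGroup G μ)) hD
      Filter.univ_mem (v := μ) (fun y _ hy => mem_isotropyGroup_iff.1 hy)
      (by rw [finrank_euclideanSpace_fin]) hDξ
    exact ⟨w, (hTξ w).symm.trans hw⟩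
  let ι₀ : GroupLieAlgebra 𝓘(ℝ, EuclideanSpace ℝ (Fin e)) (isotropyGroup G μ) →ₗ⁅ℝ⁆
      isotropyAlgebra G μ :=
    { toFun := fun ξ => ⟨T ξ, hmem ξ⟩
      map_add' := fun ξ η => Subtype.ext (map_add T ξ η)
      map_smul' := fun c ξ => Subtype.ext (map_smul T c ξ)
      map_lie' := fun {ξ η} => Subtype.ext (hasMFDerivAt_val_bracket hT ξ η) }
  refine ⟨e, i1', i3, LieEquiv.ofBijective ι₀ ⟨fun ξ η h => hinj (congrArg Subtype.val h),
    fun ξ => ?_⟩, hH.isSmoothEmbedding, fun ξ => (hTξ ξ).symm⟩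
  obtain ⟨w, hw⟩ := hsurj ξ.1 ξ.2
  exact ⟨w, Subtype.ext hw⟩

end Isotropy

/-! ### The tangent group in the left trivialization -/

section LeftTrivialization

variable {EG : Type*} [NormedAddCommGroup EG] [NormedSpace ℝ EG]
  {G : Type*} [Group G] [TopologicalSpace G] [ChartedSpace EG G] [LieGroup 𝓘(ℝ, EG) ∞ G]

/-- The `𝔤`-component of the left trivialization, as a vector of the model space. -/
def leftTrivModel (v : TangentBundle 𝓘(ℝ, EG) G) : EG := leftTriv v

theorem hasMFDerivAt_mul_left (g h : G) : ∃ D : EG →L[ℝ] EG,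
    HasMFDerivAt 𝓘(ℝ, EG) 𝓘(ℝ, EG) (fun k : G => g * k) h D :=
  ⟨_, ((contMDiff_mul_left (I := 𝓘(ℝ, EG)) (n := ∞) (a := g) h).mdifferentiableAt
    (by simp)).hasMFDerivAt⟩

theorem leftTrivModel_eq {g : G} {D : EG →L[ℝ] EG}
    (hD : HasMFDerivAt 𝓘(ℝ, EG) 𝓘(ℝ, EG) (fun k : G => g⁻¹ * k) g D) (v : EG) :
    leftTrivModel (⟨g, v⟩ : TangentBundle 𝓘(ℝ, EG) G) = D v := by
  have key : ∀ T T' : EG →L[ℝ] EG, T = T' → T v = T' v := by rintro T _ rfl; rfl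
  exact key _ _ hD.mfderiv

theorem leftTrivModel_one_zero : leftTrivModel (⟨1, 0⟩ : TangentBundle 𝓘(ℝ, EG) G) = 0 := by
  obtain ⟨D, hD⟩ := hasMFDerivAt_mul_left (EG := EG) (1 : G)⁻¹ 1
  exact (leftTrivModel_eq hD 0).trans (map_zero D)

/-- Vary one factor at a time: (gh)⁻¹(kh) = h⁻¹(g⁻¹k)h contributes Ad_{h⁻¹}, and (gh)⁻¹(gk) = h⁻¹k
contributes the second term unchanged. -/
theorem leftTrivModel_tangentMul (v w : TangentBundle 𝓘(ℝ, EG) G) :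
    leftTrivModel (tangentMul v w) = Ad (EG := EG) (w.1)⁻¹ (leftTrivModel v) + leftTrivModel w := by
  obtain ⟨g, v⟩ := v
  obtain ⟨h, w⟩ := w
  change EG at v w
  obtain ⟨m, hm, hmv⟩ : ∃ m : EG × EG →L[ℝ] EG,
      HasMFDerivAt (𝓘(ℝ, EG).prod 𝓘(ℝ, EG)) 𝓘(ℝ, EG) (fun p : G × G => p.1 * p.2) (g, h) m ∧
      tangentMul (⟨g, v⟩ : TangentBundle 𝓘(ℝ, EG) G) ⟨h, w⟩ = ⟨g * h, m (v, w)⟩ :=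
    ⟨_, ((contMDiff_mul 𝓘(ℝ, EG) ∞ (g, h)).mdifferentiableAt (by simp)).hasMFDerivAt, rfl⟩
  obtain ⟨D, hD⟩ := hasMFDerivAt_mul_left (EG := EG) (g * h)⁻¹ (g * h)
  obtain ⟨Dg, hDg⟩ := hasMFDerivAt_mul_left (EG := EG) g⁻¹ g
  obtain ⟨Dh, hDh⟩ := hasMFDerivAt_mul_left (EG := EG) h⁻¹ h
  rw [hmv]
  refine (leftTrivModel_eq hD _).trans ?_
  rw [leftTrivModel_eq hDg v, leftTrivModel_eq hDh w]
  have hc : HasMFDerivAt (𝓘(ℝ, EG).prod 𝓘(ℝ, EG)) 𝓘(ℝ, EG)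
      (fun p : G × G => (g * h)⁻¹ * (p.1 * p.2)) (g, h) (D.comp m) :=
    HasMFDerivAt.comp (f := fun p : G × G => p.1 * p.2) (g, h) hD hm
  have hl : HasMFDerivAt 𝓘(ℝ, EG) (𝓘(ℝ, EG).prod 𝓘(ℝ, EG)) (fun k : G => (k, h)) g
      ((ContinuousLinearMap.id ℝ EG).prod (0 : EG →L[ℝ] EG)) :=
    (hasMFDerivAt_id g).prodMk (hasMFDerivAt_const h g)
  have hr : HasMFDerivAt 𝓘(ℝ, EG) (𝓘(ℝ, EG).prod 𝓘(ℝ, EG)) (fun k : G => (g, k)) h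
      ((0 : EG →L[ℝ] EG).prod (ContinuousLinearMap.id ℝ EG)) :=
    (hasMFDerivAt_const g h).prodMk (hasMFDerivAt_id h)
  have h1 := HasMFDerivAt.comp (f := fun k : G => (k, h)) g hc hl
  have h2 := HasMFDerivAt.comp (f := fun k : G => (g, k)) h hc hr
  have hconj : HasMFDerivAt 𝓘(ℝ, EG) 𝓘(ℝ, EG) (fun k : G => h⁻¹ * k * (h⁻¹)⁻¹) (g⁻¹ * g)
      (Ad (EG := EG) h⁻¹) := by
    rw [inv_mul_cancel]; exact hasMFDerivAt_conj h⁻¹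
  have h1' : HasMFDerivAt 𝓘(ℝ, EG) 𝓘(ℝ, EG) (fun k : G => (g * h)⁻¹ * (k * h)) g
      ((Ad (EG := EG) h⁻¹).comp Dg) := by
    refine HasMFDerivAt.congr_of_eventuallyEq (f' := (Ad (EG := EG) h⁻¹).comp Dg)
      (hconj.comp g hDg) (Filter.Eventually.of_forall fun k => ?_)
    simp [mul_assoc]
  have h2' : HasMFDerivAt 𝓘(ℝ, EG) 𝓘(ℝ, EG) (fun k : G => (g * h)⁻¹ * (g * k)) h Dh := by
    refine HasMFDerivAt.congr_of_eventuallyEq (f' := Dh) hDh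
      (Filter.Eventually.of_forall fun k => ?_)
    simp [mul_assoc]
  have key : ∀ (T T' : EG →L[ℝ] EG) (u : EG), T = T' → T u = T' u := by rintro T _ u rfl; rfl
  have e1 : D (m (v, 0)) = Ad (EG := EG) h⁻¹ (Dg v) := key _ _ v (hasMFDerivAt_unique h1 h1')
  have e2 : D (m (0, w)) = Dh w := key _ _ w (hasMFDerivAt_unique h2 h2')
  rw [← e1, ← e2, ← map_add, ← map_add]
  simp

/-- The left trivialization is the tangent map of (g, h) ↦ g⁻¹h on the pair of 0 at g and the given
vector. All images are based at 1, where the fibre coordinate of a tangent vector is the vector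
itself. -/
theorem contMDiff_leftTrivModel :
    ContMDiff 𝓘(ℝ, EG).tangent 𝓘(ℝ, EG) ∞ (leftTrivModel (EG := EG) (G := G)) := by
  have hm : ContMDiff (𝓘(ℝ, EG).prod 𝓘(ℝ, EG)) 𝓘(ℝ, EG) ∞ (fun p : G × G => p.1⁻¹ * p.2) :=
    contMDiff_fst.inv.mul contMDiff_snd
  have h0 : ContMDiff 𝓘(ℝ, EG).tangent 𝓘(ℝ, EG).tangent ∞
      (fun v : TangentBundle 𝓘(ℝ, EG) G => (⟨v.1, 0⟩ : TangentBundle 𝓘(ℝ, EG) G)) :=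
    (contMDiff_zeroSection ℝ (TangentSpace 𝓘(ℝ, EG) (M := G))).comp
      (contMDiff_proj (TangentSpace 𝓘(ℝ, EG) (M := G)))
  have h1 : ContMDiff 𝓘(ℝ, EG).tangent 𝓘(ℝ, EG).tangent ∞
      (fun v : TangentBundle 𝓘(ℝ, EG) G => tangentMap (𝓘(ℝ, EG).prod 𝓘(ℝ, EG)) 𝓘(ℝ, EG)
        (fun p : G × G => p.1⁻¹ * p.2)
        ((equivTangentBundleProd 𝓘(ℝ, EG) G 𝓘(ℝ, EG) G).symm
          ((⟨v.1, 0⟩ : TangentBundle 𝓘(ℝ, EG) G), v))) :=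
    (hm.contMDiff_tangentMap (m := ∞) (by simp)).comp
      ((contMDiff_equivTangentBundleProd_symm (n := ∞)).comp (h0.prodMk contMDiff_id))
  have h2 : ContMDiff 𝓘(ℝ, EG).tangent 𝓘(ℝ, EG).tangent ∞
      (fun v : TangentBundle 𝓘(ℝ, EG) G => (⟨1, leftTrivModel (EG := EG) v⟩ : TangentBundle 𝓘(ℝ, EG) G)) := by
    refine h1.congr fun v => ?_
    obtain ⟨g, v⟩ := v
    change EG at v
    obtain ⟨m, hm, hmv⟩ : ∃ m : EG × EG →L[ℝ] EG,
        HasMFDerivAt (𝓘(ℝ, EG).prod 𝓘(ℝ, EG)) 𝓘(ℝ, EG) (fun p : G × G => p.1⁻¹ * p.2) (g, g) m ∧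
        tangentMap (𝓘(ℝ, EG).prod 𝓘(ℝ, EG)) 𝓘(ℝ, EG) (fun p : G × G => p.1⁻¹ * p.2)
          ((equivTangentBundleProd 𝓘(ℝ, EG) G 𝓘(ℝ, EG) G).symm
            ((⟨g, 0⟩ : TangentBundle 𝓘(ℝ, EG) G), ⟨g, v⟩)) = ⟨g⁻¹ * g, m (0, v)⟩ :=
      ⟨_, ((hm (g, g)).mdifferentiableAt (by simp)).hasMFDerivAt, rfl⟩
    have hr : HasMFDerivAt 𝓘(ℝ, EG) (𝓘(ℝ, EG).prod 𝓘(ℝ, EG)) (fun k : G => (g, k)) g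
        ((0 : EG →L[ℝ] EG).prod (ContinuousLinearMap.id ℝ EG)) :=
      (hasMFDerivAt_const g g).prodMk (hasMFDerivAt_id g)
    have h3 := HasMFDerivAt.comp (f := fun k : G => (g, k)) g hm hr
    have key : ∀ (a b : G) (u v : EG), a = b → u = v →
      (⟨a, u⟩ : TangentBundle 𝓘(ℝ, EG) G) = ⟨b, v⟩ := by rintro a _ u _ rfl rfl; rfl
    refine Eq.trans ?_ hmv.symm
    exact key _ _ _ _ (inv_mul_cancel g).symm (leftTrivModel_eq h3 v)
  intro v₀
  have h4 := (contMDiffAt_totalSpace.1 (h2 v₀)).2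
  refine h4.congr_of_eventuallyEq (Filter.Eventually.of_forall fun v => ?_)
  dsimp only
  rw [TangentBundle.trivializationAt_apply]
  exact (tangentCoordChange_self (I := 𝓘(ℝ, EG)) (x := (1 : G)) (z := 1)
    (mem_extChartAt_source (I := 𝓘(ℝ, EG)) (1 : G))).symm

end LeftTrivialization

/-! ### The affine action of the tangent group -/

section AffineAction

variable {E : Type*} [NormedAddCommGroup E] [NormedSpace ℝ E]
  {M : Type*} [TopologicalSpace M] [ChartedSpace E M] [IsManifold 𝓘(ℝ, E) ∞ M]
  {F : Type*} [NormedAddCommGroup F] [NormedSpace ℝ F]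
  {A : M → Type*} [∀ x, AddCommGroup (A x)] [∀ x, Module ℝ (A x)] [∀ x, TopologicalSpace (A x)]
  [TopologicalSpace (TotalSpace F A)] [FiberBundle F A] [VectorBundle ℝ F A]
  [ContMDiffVectorBundle ∞ F A 𝓘(ℝ, E)]

/-- Translating in the fibres by a combination of sections is smooth. -/
theorem contMDiff_add_sum {EN : Type*} [NormedAddCommGroup EN] [NormedSpace ℝ EN]
    {HN : Type*} [TopologicalSpace HN]
    {I : ModelWithCorners ℝ EN HN} {N : Type*} [TopologicalSpace N] [ChartedSpace HN N]
    {a : N → TotalSpace F A} (ha : ContMDiff I (𝓘(ℝ, E).prod 𝓘(ℝ, F)) ∞ a) {ι : Type*} [Fintype ι]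
    {c : ι → N → ℝ} (hc : ∀ i, ContMDiff I 𝓘(ℝ, ℝ) ∞ (c i)) (X : ι → Sec (E := E) F A) :
    ContMDiff I (𝓘(ℝ, E).prod 𝓘(ℝ, F)) ∞
      (fun q => (⟨(a q).1, (a q).2 + ∑ i, c i q • X i (a q).1⟩ : TotalSpace F A)) := by
  intro q₀
  have hp : ContMDiffAt I 𝓘(ℝ, E) ∞ (fun q => (a q).1) q₀ :=
    (contMDiffAt_totalSpace.1 (ha q₀)).1
  set t := trivializationAt F A (a q₀).1 with ht
  have hX : ∀ i, ContMDiffAt I 𝓘(ℝ, F) ∞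
      (fun q => (t (⟨(a q).1, X i (a q).1⟩ : TotalSpace F A)).2) q₀ := fun i =>
    (contMDiffAt_totalSpace.1 (((X i).contMDiff _).comp q₀ hp)).2
  refine contMDiffAt_totalSpace.2 ⟨hp, ?_⟩
  have h1 : ContMDiffAt I 𝓘(ℝ, F) ∞ (fun q => (t (a q)).2 +
      ∑ i, c i q • (t (⟨(a q).1, X i (a q).1⟩ : TotalSpace F A)).2) q₀ :=
    (contMDiffAt_totalSpace.1 (ha q₀)).2.add
      (contMDiffAt_finsetSum fun i _ => ((hc i) q₀).smul (hX i))
  refine h1.congr_of_eventuallyEq ?_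
  filter_upwards [hp.continuousAt.preimage_mem_nhds
    (t.open_baseSet.mem_nhds (FiberBundle.mem_baseSet_trivializationAt' _))] with q hq
  have hl := t.linear ℝ hq
  let T : A (a q).1 →ₗ[ℝ] F := hl.mk' _
  change T ((a q).2 + ∑ i, c i q • X i (a q).1) = T (a q).2 + ∑ i, c i q • T (X i (a q).1)
  simp

variable {EG : Type*} [NormedAddCommGroup EG] [NormedSpace ℝ EG] [FiniteDimensional ℝ EG]
  {G : Type*} [Group G] [TopologicalSpace G] [ChartedSpace EG G] [LieGroup 𝓘(ℝ, EG) ∞ G]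

/-- An equivariant linear map from the Lie algebra to the sections extends an action of `G` by
vector bundle automorphisms to an affine action of `TG`. -/
theorem exists_tangentAffineAction (Φ : BundleAction (E := E) (EG := EG) F A G)
    (χ : GroupLieAlgebra 𝓘(ℝ, EG) G →ₗ[ℝ] Sec (E := E) F A)
    (hχ : ∀ (g : G) (ξ : EG) (x : M), Φ.fib g x (onModel χ ξ x) =
      onModel χ (Ad (EG := EG) g ξ) (Φ.base g x)) :
    ∃ Θ : TangentAffineAction (E := E) (EG := EG) F A G,
      ∀ v a, Θ.map v a = Φ.map v.1 ⟨a.1, a.2 + χ (leftTriv v) a.1⟩ := by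
  let τ : ∀ (_ : TangentBundle 𝓘(ℝ, EG) G) (x : M), A x := fun v x =>
    onModel χ (leftTrivModel v) x
  refine ⟨⟨fun v x => Φ.base v.1 x, fun v x =>
    { toFun := fun a => Φ.fib v.1 x (a + τ v x)
      linear := Φ.fib v.1 x
      map_vadd' := fun a b => by simp only [vadd_eq_add, map_add]; abel }, ?_, ?_, ?_⟩,
    fun v a => rfl⟩
  · let b := Module.finBasis ℝ EG
    have h1 := contMDiff_add_sum (I := 𝓘(ℝ, EG).tangent.prod (𝓘(ℝ, E).prod 𝓘(ℝ, F)))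
      (a := fun p : TangentBundle 𝓘(ℝ, EG) G × TotalSpace F A => p.2) contMDiff_snd
      (c := fun i p => (b.coord i).toContinuousLinearMap (leftTrivModel p.1))
      (fun i => ((b.coord i).toContinuousLinearMap.contMDiff).comp
        (contMDiff_leftTrivModel.comp contMDiff_fst)) (fun i => onModel χ (b i))
    have h2 : ContMDiff (𝓘(ℝ, EG).tangent.prod (𝓘(ℝ, E).prod 𝓘(ℝ, F))) 𝓘(ℝ, EG) ∞
        (fun p : TangentBundle 𝓘(ℝ, EG) G × TotalSpace F A => p.1.1) :=
      (contMDiff_proj (TangentSpace 𝓘(ℝ, EG) (M := G))).comp contMDiff_fst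
    refine (Φ.contMDiff.comp (h2.prodMk h1)).congr fun p => ?_
    change Φ.map p.1.1 ⟨p.2.1, p.2.2 + τ p.1 p.2.1⟩ = Φ.map p.1.1 _
    congr 3
    change onModel χ (leftTrivModel p.1) p.2.1 = _
    conv_lhs => rw [← b.sum_repr (leftTrivModel p.1), map_sum, sec_sum_apply]
    simp
  · intro a
    have h1 : τ (⟨1, 0⟩ : TangentBundle 𝓘(ℝ, EG) G) a.1 = 0 := by
      change onModel χ (leftTrivModel _) a.1 = 0
      rw [leftTrivModel_one_zero, map_zero]
      rfl
    change Φ.map 1 ⟨a.1, a.2 + τ _ a.1⟩ = a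
    rw [h1, add_zero]
    exact Φ.map_one_eq a
  · intro v w a
    change Φ.map (v.1 * w.1) ⟨a.1, a.2 + τ (tangentMul v w) a.1⟩ =
      Φ.map v.1 ⟨Φ.base w.1 a.1, Φ.fib w.1 a.1 (a.2 + τ w a.1) + τ v (Φ.base w.1 a.1)⟩
    rw [Φ.map_mul_eq]
    congr 1
    change (⟨Φ.base w.1 a.1, Φ.fib w.1 a.1 (a.2 + τ (tangentMul v w) a.1)⟩ : TotalSpace F A) = _
    congr 1
    -- The product contributes Ad_{h⁻¹}ξ at x, with h the base point of w and ξ the trivialization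
    -- of v. By equivariance Φ_h carries it to χ(ξ) at hx, which is the translation made by v.
    have h1 := hχ w.1 (Ad (EG := EG) (w.1)⁻¹ (leftTrivModel v)) a.1
    have h2 : τ (tangentMul v w) a.1 =
        onModel χ (Ad (EG := EG) (w.1)⁻¹ (leftTrivModel v)) a.1 + τ w a.1 := by
      change onModel χ (leftTrivModel (tangentMul v w)) a.1 = _
      rw [leftTrivModel_tangentMul, map_add]
      rfl
    rw [Ad_mul_inv_apply] at h1
    rw [h2, add_comm (onModel χ _ a.1), ← add_assoc, map_add (Φ.fib w.1 a.1), h1]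

end AffineAction

/-! ### The restricted action on the level bundle -/

section Reduction

variable {E : Type*} [NormedAddCommGroup E] [NormedSpace ℝ E] [FiniteDimensional ℝ E]
  {M : Type*} [TopologicalSpace M] [T2Space M] [SigmaCompactSpace M] [ChartedSpace E M]
  [IsManifold 𝓘(ℝ, E) ∞ M]
  {F : Type*} [NormedAddCommGroup F] [NormedSpace ℝ F] [FiniteDimensional ℝ F]
  {A : M → Type*} [∀ x, AddCommGroup (A x)] [∀ x, Module ℝ (A x)] [∀ x, TopologicalSpace (A x)]
  [TopologicalSpace (TotalSpace F A)] [FiberBundle F A] [VectorBundle ℝ F A]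
  [ContMDiffVectorBundle ∞ F A 𝓘(ℝ, E)]
  {EG : Type*} [NormedAddCommGroup EG] [NormedSpace ℝ EG] [FiniteDimensional ℝ EG]
  [CompleteSpace EG]
  {G : Type*} [Group G] [TopologicalSpace G] [ChartedSpace EG G] [LieGroup 𝓘(ℝ, EG) ∞ G]
  [ConnectedSpace G]
  {L : LieAlgebroid (E := E) F A} {Φ : BundleAction (E := E) (EG := EG) F A G}
  {ψ : GroupLieAlgebra 𝓘(ℝ, EG) G →ₗ[ℝ] Sec (E := E) F A}
  {J : M → (EG →L[ℝ] ℝ)} {μ : EG →L[ℝ] ℝ} {Ω : Form A 2}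
  {E₁ : Type*} [NormedAddCommGroup E₁] [NormedSpace ℝ E₁] [ChartedSpace E₁ (J ⁻¹' {μ})]
  [IsManifold 𝓘(ℝ, E₁) ∞ (J ⁻¹' {μ})]
  {F₁ : Type*} [NormedAddCommGroup F₁] [NormedSpace ℝ F₁]
  [TopologicalSpace (TotalSpace F₁ (LevelBundle L J μ))] [FiberBundle F₁ (LevelBundle L J μ)]
  [VectorBundle ℝ F₁ (LevelBundle L J μ)]
  {E₂ : Type*} [NormedAddCommGroup E₂] [NormedSpace ℝ E₂] [ChartedSpace E₂ (isotropyGroup G μ)]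
  [LieGroup 𝓘(ℝ, E₂) ∞ (isotropyGroup G μ)]

/-- The restriction of `ψ` to the isotropy algebra, with values in the sections of the level
bundle. -/
def levelPsi (hS : IsSubmanifold (E := E) E₁ (J ⁻¹' {μ}))
    (hB : IsSubbundle E F E₁ (F₁ := F₁) (levelFiber L J μ))
    (hΦ : IsActionByCompleteLifts L Φ ψ) (hJ : IsEquivariantMomentumMap L Ω Φ ψ J) :
    isotropyAlgebra G μ →ₗ[ℝ] Sec (E := E₁) F₁ (LevelBundle L J μ) where
  toFun ξ := secRestrict hS hB (ψ ξ) (psi_mem_levelFiber hΦ hJ ξ.2)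
  map_add' ξ η := ContMDiffSection.ext fun x => by
    apply Subtype.ext
    change ψ (ξ + η : GroupLieAlgebra 𝓘(ℝ, EG) G) x = ψ ξ x + ψ η x
    rw [map_add]
    rfl
  map_smul' c ξ := ContMDiffSection.ext fun x => by
    apply Subtype.ext
    change ψ (c • ξ : GroupLieAlgebra 𝓘(ℝ, EG) G) x = c • ψ ξ x
    rw [map_smul]
    rfl

theorem subIncl_injective {S : Set M} {B : ∀ x : S, Submodule ℝ (A x)} :
    Function.Injective (subIncl (F := F) F₁ B) := by
  rintro ⟨⟨x, hx⟩, a, ha⟩ ⟨⟨y, hy⟩, b, hb⟩ h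
  obtain rfl : x = y := congrArg TotalSpace.proj h
  obtain rfl : a = b := TotalSpace.mk_inj.1 h
  rfl

/-- The restriction of the action `Φ` to the isotropy group and the level bundle. -/
def levelAction (hS : IsSubmanifold (E := E) E₁ (J ⁻¹' {μ}))
    (hB : IsSubbundle E F E₁ (F₁ := F₁) (levelFiber L J μ))
    (hH : ContMDiff 𝓘(ℝ, E₂) 𝓘(ℝ, EG) ∞ (Subtype.val : isotropyGroup G μ → G))
    (hΦ : IsActionByCompleteLifts L Φ ψ) (hJ : IsEquivariantMomentumMap L Ω Φ ψ J) :
    BundleAction (E := E₁) (EG := E₂) F₁ (LevelBundle L J μ) (isotropyGroup G μ) where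
  base g x := ⟨Φ.base g x, base_mem_level hJ g.2 x.2⟩
  fib g x := (Φ.fib g x).restrict fun _ ha => fib_mem_levelFiber hΦ hJ g.2 ha
  contMDiff := (hB.contMDiff_iff hS).2
    (Φ.contMDiff.comp ((hH.comp contMDiff_fst).prodMk (hB.contMDiff_incl.comp contMDiff_snd)))
  map_one a := subIncl_injective (F := F) (Φ.map_one (subIncl F₁ _ a))
  map_mul g h a := subIncl_injective (F := F) (Φ.map_mul g h (subIncl F₁ _ a))

section

variable {hS : IsSubmanifold (E := E) E₁ (J ⁻¹' {μ})}
  {hB : IsSubbundle E F E₁ (F₁ := F₁) (levelFiber L J μ)}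
  {hH : ContMDiff 𝓘(ℝ, E₂) 𝓘(ℝ, EG) ∞ (Subtype.val : isotropyGroup G μ → G)}
  {hΦ : IsActionByCompleteLifts L Φ ψ} {hJ : IsEquivariantMomentumMap L Ω Φ ψ J}
  [ContMDiffVectorBundle ∞ F₁ (LevelBundle L J μ) 𝓘(ℝ, E₁)]

/-- This differentiates the fact that the inclusion of the level set intertwines the actions of G_μ
and G. -/
theorem mfderiv_val_baseGenerator_levelAction {T : E₂ →L[ℝ] EG}
    (hT : HasMFDerivAt 𝓘(ℝ, E₂) 𝓘(ℝ, EG) (Subtype.val : isotropyGroup G μ → G) 1 T) (ξ : E₂)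
    (x : J ⁻¹' {μ}) :
    (mfderiv 𝓘(ℝ, E₁) 𝓘(ℝ, E) (Subtype.val : J ⁻¹' {μ} → M) x
      ((levelAction hS hB hH hΦ hJ).baseGenerator ξ x) : E) = Φ.baseGenerator (T ξ) (x : M) := by
  set Φ₁ := levelAction hS hB hH hΦ hJ with hΦ₁
  obtain ⟨D, hD, hDξ⟩ := Φ.hasMFDerivAt_base (x : M)
  obtain ⟨D₁, hD₁, hDξ₁⟩ := Φ₁.hasMFDerivAt_base x
  obtain ⟨V, hV, hVw⟩ : ∃ V : E₁ →L[ℝ] E,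
      HasMFDerivAt 𝓘(ℝ, E₁) 𝓘(ℝ, E) (Subtype.val : J ⁻¹' {μ} → M) x V ∧ ∀ w : E₁,
        (mfderiv 𝓘(ℝ, E₁) 𝓘(ℝ, E) (Subtype.val : J ⁻¹' {μ} → M) x w : E) = V w :=
    ⟨_, (hS.mdifferentiableAt_val x).hasMFDerivAt, fun _ => rfl⟩
  have hV1 : HasMFDerivAt 𝓘(ℝ, E₁) 𝓘(ℝ, E) (Subtype.val : J ⁻¹' {μ} → M) (Φ₁.base 1 x) V := by
    rw [Φ₁.base_one]; exact hV
  have h1 := hV1.comp 1 hD₁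
  have hD' : HasMFDerivAt 𝓘(ℝ, EG) 𝓘(ℝ, E) (fun g : G => Φ.base g (x : M))
    ((1 : isotropyGroup G μ) : G) D := hD
  have h2 : HasMFDerivAt 𝓘(ℝ, E₂) 𝓘(ℝ, E) (fun g : isotropyGroup G μ => Φ.base g (x : M)) 1
    (D.comp T) := hD'.comp 1 hT
  have key : ∀ T T' : E₂ →L[ℝ] E, T = T' → T ξ = T' ξ := by rintro T _ rfl; rfl
  have h3 : V (D₁ ξ) = D (T ξ) := key _ _ (hasMFDerivAt_unique h1 h2)
  exact (hVw _).trans ((congrArg V (hDξ₁ ξ)).trans (h3.trans (hDξ (T ξ)).symm))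

/-- For group elements in G_μ the pull-backs of Y and of its extension Z are the same vector. Only
the trivializations of the two bundles differ, by the fixed linear map K. -/
theorem dotPullback_levelAction {T : E₂ →L[ℝ] EG}
    (hT : HasMFDerivAt 𝓘(ℝ, E₂) 𝓘(ℝ, EG) (Subtype.val : isotropyGroup G μ → G) 1 T) (ξ : E₂)
    [FiniteDimensional ℝ F₁] {Y : Sec (E := E₁) F₁ (LevelBundle L J μ)} {Z : Sec (E := E) F A}
    (hZ : ∀ x : J ⁻¹' {μ}, Z x = Y x) (x : J ⁻¹' {μ}) :
    ((levelAction hS hB hH hΦ hJ).dotPullback Y ξ x : A x) = Φ.dotPullback Z (T ξ) (x : M) := by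
  set Φ₁ := levelAction hS hB hH hΦ hJ with hΦ₁
  set t := trivializationAt F A (x : M) with ht
  set t₁ := trivializationAt F₁ (LevelBundle L J μ) x with ht₁
  have hx : (x : M) ∈ t.baseSet := FiberBundle.mem_baseSet_trivializationAt' _
  have hx₁ : x ∈ t₁.baseSet := FiberBundle.mem_baseSet_trivializationAt' _
  let K : F₁ →L[ℝ] F := LinearMap.toContinuousLinearMap
    ((t.linearMapAt ℝ (x : M)).comp ((levelFiber L J μ x).subtype.comp (t₁.symmₗ ℝ x)))
  have hK : ∀ u, K u = (t ⟨x, (t₁.symm x u : A x)⟩).2 := fun u => by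
    change t.linearMapAt ℝ (x : M) (t₁.symmₗ ℝ x u : A x) = _
    rw [t₁.symmₗ_apply hx₁, t.linearMapAt_apply, if_pos hx]
  have hpull : ∀ h : isotropyGroup G μ, Φ.pullback Z (x : M) h = K (Φ₁.pullback Y x h) := by
    intro h
    have h1 : subIncl (F := F) F₁ (levelFiber L J μ) (Φ₁.map h⁻¹ ⟨Φ₁.base h x, Y (Φ₁.base h x)⟩) =
        Φ.map (h : G)⁻¹ ⟨Φ.base h x, Z (Φ.base h x)⟩ := by
      change Φ.map (h : G)⁻¹ (subIncl (F := F) F₁ (levelFiber L J μ)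
        ⟨Φ₁.base h x, Y (Φ₁.base h x)⟩) = _
      exact congrArg (Φ.map (h : G)⁻¹) (congrArg (TotalSpace.mk _) (hZ (Φ₁.base h x)).symm)
    rw [Φ₁.map_inv_sec] at h1
    rw [hK]
    exact congrArg (fun b => (t b).2) h1.symm
  obtain ⟨D, hD, hDξ⟩ := Φ.hasMFDerivAt_pullback Z (x : M)
  obtain ⟨D₁, hD₁, hDξ₁⟩ := Φ₁.hasMFDerivAt_pullback Y x
  have hD' : HasMFDerivAt 𝓘(ℝ, EG) 𝓘(ℝ, F) (Φ.pullback Z (x : M) : G → F)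
    ((1 : isotropyGroup G μ) : G) D := hD
  have h1 : HasMFDerivAt 𝓘(ℝ, E₂) 𝓘(ℝ, F)
      (fun h : isotropyGroup G μ => Φ.pullback Z (x : M) (h : G)) 1 (D.comp T) := hD'.comp 1 hT
  have h2 : HasMFDerivAt 𝓘(ℝ, E₂) 𝓘(ℝ, F)
      (fun h : isotropyGroup G μ => Φ.pullback Z (x : M) (h : G)) 1 (K.comp D₁) :=
    HasMFDerivAt.congr_of_eventuallyEq (f' := K.comp D₁) (K.hasMFDerivAt.comp 1 hD₁)
      (Filter.Eventually.of_forall hpull)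
  have key : ∀ T T' : E₂ →L[ℝ] F, T = T' → T ξ = T' ξ := by rintro T _ rfl; rfl
  have h3 : D (T ξ) = K (D₁ ξ) := key _ _ (hasMFDerivAt_unique h1 h2)
  rw [hDξ, hDξ₁, h3, hK]
  exact (t.symm_apply_apply_mk hx _).symm

variable [FiniteDimensional ℝ E₁] [FiniteDimensional ℝ F₁] [FiniteDimensional ℝ E₂]
  [CompleteSpace E₂] [SigmaCompactSpace (J ⁻¹' {μ})]

/-- Both conditions of `isCompleteLift_generator` can be checked after inclusion into M and A. There
they are the known properties of the generator of T ξ, applied to an extension of Y. -/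
theorem isActionByCompleteLifts_levelAction
    {L₁ : LieAlgebroid (E := E₁) F₁ (LevelBundle L J μ)} (hL : IsRestriction L₁ L)
    (hSc : IsClosed (J ⁻¹' {μ}))
    (ι : GroupLieAlgebra 𝓘(ℝ, E₂) (isotropyGroup G μ) ≃ₗ⁅ℝ⁆ isotropyAlgebra G μ)
    {T : E₂ →L[ℝ] EG}
    (hT : HasMFDerivAt 𝓘(ℝ, E₂) 𝓘(ℝ, EG) (Subtype.val : isotropyGroup G μ → G) 1 T)
    (hι : ∀ ξ : E₂, (ι ξ : GroupLieAlgebra 𝓘(ℝ, EG) G) = T ξ) :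
    IsActionByCompleteLifts L₁ (levelAction hS hB hH hΦ hJ)
      (levelPsi hS hB hΦ hJ ∘ₗ (ι : _ →ₗ[ℝ] _)) := by
  refine ⟨fun ξ η => ContMDiffSection.ext fun x => ?_, fun ξ => ?_⟩
  · apply Subtype.ext
    change ψ (ι ⁅ξ, η⁆) x = -(L₁.bracket (levelPsi hS hB hΦ hJ (ι ξ)) (levelPsi hS hB hΦ hJ (ι η)) x : A x)
    rw [hL.bracket _ _ (ψ (ι ξ)) (ψ (ι η)) (fun _ => rfl) (fun _ => rfl), LieEquiv.map_lie,
      LieSubalgebra.coe_bracket, hΦ.anti]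
    rfl
  · have hψ : ∀ x : J ⁻¹' {μ}, onModel ψ (T ξ) x = (levelPsi hS hB hΦ hJ (ι ξ) x : A x) :=
      fun x => congrArg (fun X : Sec (E := E) F A => X x) (congrArg ψ (hι ξ).symm)
    refine isCompleteLift_generator (fun x => hS.injective_mfderiv_val x ?_) fun Y x => ?_
    · refine (mfderiv_val_baseGenerator_levelAction hT ξ x).trans ?_
      refine (baseGenerator_eq_anchor (hΦ.generator (T ξ)) (x : M)).trans ?_
      refine Eq.trans ?_ (hL.anchor x _).symm
      exact congrArg (L.anchor x) (hψ x)
    · obtain ⟨Z, hZ⟩ := exists_extension hSc hS hB Y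
      apply Subtype.ext
      refine (dotPullback_levelAction hT ξ hZ x).trans ?_
      refine (dotPullback_eq_bracket (hΦ.generator (T ξ)) Z (x : M)).trans ?_
      exact (hL.bracket (levelPsi hS hB hΦ hJ (ι ξ)) Y (onModel ψ (T ξ)) Z hψ hZ x).symm

/-- The required equivariance is that of ψ, because the inclusion intertwines the adjoint actions of
G_μ and G. -/
theorem exists_tangentAffineAction_level
    (ι : GroupLieAlgebra 𝓘(ℝ, E₂) (isotropyGroup G μ) ≃ₗ⁅ℝ⁆ isotropyAlgebra G μ)
    {T : E₂ →L[ℝ] EG}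
    (hT : HasMFDerivAt 𝓘(ℝ, E₂) 𝓘(ℝ, EG) (Subtype.val : isotropyGroup G μ → G) 1 T)
    (hι : ∀ ξ : E₂, (ι ξ : GroupLieAlgebra 𝓘(ℝ, EG) G) = T ξ) :
    ∃ Θ : TangentAffineAction (E := E₁) (EG := E₂) F₁ (LevelBundle L J μ) (isotropyGroup G μ),
      ∀ v a, Θ.map v a = (levelAction hS hB hH hΦ hJ).map v.1
        ⟨a.1, a.2 + levelPsi hS hB hΦ hJ (ι (leftTriv v)) a.1⟩ := by
  let χ : GroupLieAlgebra 𝓘(ℝ, E₂) (isotropyGroup G μ) →ₗ[ℝ]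
    Sec (E := E₁) F₁ (LevelBundle L J μ) := levelPsi hS hB hΦ hJ ∘ₗ (ι : _ →ₗ[ℝ] _)
  have hχ : ∀ (ξ : E₂) (x : J ⁻¹' {μ}), (onModel χ ξ x : A x) = onModel ψ (T ξ) x :=
    fun ξ x => congrArg (fun X : Sec (E := E) F A => X x) (congrArg ψ (hι ξ))
  refine exists_tangentAffineAction (levelAction hS hB hH hΦ hJ) χ fun g ξ x => ?_
  apply Subtype.ext
  refine (congrArg (Φ.fib g x) (hχ ξ x)).trans ?_
  refine (fib_psi hΦ (g : G) (T ξ) (x : M)).trans ?_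
  rw [← hasMFDerivAt_val_Ad hT g ξ]
  exact (hχ (Ad (EG := E₂) g ξ) ((levelAction hS hB hH hΦ hJ).base g x)).symm

end

end Reduction

/-! ### Coordinates on the level bundle -/

section Level

variable {E : Type*} [NormedAddCommGroup E] [NormedSpace ℝ E] [FiniteDimensional ℝ E]
  {M : Type*} [TopologicalSpace M] [ChartedSpace E M]
  [IsManifold 𝓘(ℝ, E) ∞ M]
  {F : Type*} [NormedAddCommGroup F] [NormedSpace ℝ F] [FiniteDimensional ℝ F]
  {A : M → Type*} [∀ x, AddCommGroup (A x)] [∀ x, Module ℝ (A x)] [∀ x, TopologicalSpace (A x)]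
  [TopologicalSpace (TotalSpace F A)] [FiberBundle F A] [VectorBundle ℝ F A]
  [ContMDiffVectorBundle ∞ F A 𝓘(ℝ, E)]
  {EG : Type*} [NormedAddCommGroup EG] [NormedSpace ℝ EG] [FiniteDimensional ℝ EG]
  {L : LieAlgebroid (E := E) F A} {J : M → (EG →L[ℝ] ℝ)} {μ : EG →L[ℝ] ℝ}

/-- If `TJ ∘ ρ` has constant rank on `J⁻¹(μ)`, its kernel is a subbundle. -/
theorem exists_subbundleChart_levelFiber [T2Space M] [SigmaCompactSpace M]
    (hJ : ContMDiff 𝓘(ℝ, E) 𝓘(ℝ, EG →L[ℝ] ℝ) ∞ J)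
    (hrank : ∃ r : ℕ, ∀ x : M, J x = μ →
      Module.finrank ℝ (LinearMap.range (tangentJ (E := E) J x ∘ₗ L.anchor x)) = r) :
    ∃ k : ℕ, ∀ x₀ : J ⁻¹' {μ},
      Nonempty (SubbundleChart E F (EuclideanSpace ℝ (Fin k)) (levelFiber L J μ) x₀) := by
  obtain ⟨r, hr⟩ := hrank
  -- Given a point x₀ of the level set, r is at most dim F and the subtraction is a true one;
  -- without such a point there is nothing to prove.
  refine ⟨Module.finrank ℝ F - r, fun x₀ => ?_⟩
  have hσ : ContMDiff (𝓘(ℝ, E).prod 𝓘(ℝ, F)) 𝓘(ℝ, EG →L[ℝ] ℝ) ∞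
      (fun a : TotalSpace F A => (tangentJ (E := E) J a.1 ∘ₗ L.anchor a.1) a.2) :=
    (contMDiff_snd_tangentBundle_modelSpace (EG →L[ℝ] ℝ) 𝓘(ℝ, EG →L[ℝ] ℝ)).comp
      ((hJ.contMDiff_tangentMap (m := ∞) (by simp)).comp L.contMDiff_anchor)
  have hle : r ≤ Module.finrank ℝ F := by
    rw [← hr x₀ x₀.2]
    let ε := (trivializationAt F A (x₀ : M)).linearEquivAt ℝ (x₀ : M)
      (FiberBundle.mem_baseSet_trivializationAt' _)
    have : FiniteDimensional ℝ (A x₀) := ε.symm.finiteDimensional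
    rw [← ε.finrank_eq]
    exact LinearMap.finrank_range_le _
  exact exists_subbundleChart_ker _ hσ (fun x a => mem_levelFiber_iff) (fun x hx => hr x hx)
    (by rw [finrank_euclideanSpace_fin, Nat.sub_add_cancel hle]) x₀

theorem range_levelIncl {F₁ : Type*} :
    Set.range (levelIncl F₁ L J μ) = JT L J ⁻¹' {(0, μ)} := by
  ext ⟨x, a⟩
  constructor
  · rintro ⟨⟨y, b⟩, hb⟩
    rw [← hb]
    exact b.2
  · intro h
    exact ⟨⟨⟨x, congrArg Prod.snd h⟩, ⟨a, h⟩⟩, rfl⟩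

end Level
end LieAlgd
end

theorem mainTheorem8
    {E : Type*} [NormedAddCommGroup E] [NormedSpace ℝ E] [FiniteDimensional ℝ E]
    {M : Type*} [TopologicalSpace M] [T2Space M] [SecondCountableTopology M]
    [ChartedSpace E M] [IsManifold 𝓘(ℝ, E) ∞ M]
    {F : Type*} [NormedAddCommGroup F] [NormedSpace ℝ F] [FiniteDimensional ℝ F]
    {A : M → Type*} [∀ x, AddCommGroup (A x)] [∀ x, Module ℝ (A x)] [∀ x, TopologicalSpace (A x)]
    [TopologicalSpace (TotalSpace F A)] [FiberBundle F A] [VectorBundle ℝ F A]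
    [ContMDiffVectorBundle ∞ F A 𝓘(ℝ, E)]
    {EG : Type*} [NormedAddCommGroup EG] [NormedSpace ℝ EG] [FiniteDimensional ℝ EG]
    [CompleteSpace EG]
    {G : Type*} [Group G] [TopologicalSpace G] [T2Space G] [ConnectedSpace G]
    [ChartedSpace EG G] [LieGroup 𝓘(ℝ, EG) ∞ G]
    (L : LieAlgd.LieAlgebroid (E := E) F A)
    (Ω : LieAlgd.Form A 2) (hΩ : L.IsSymplectic Ω)
    (Φ : LieAlgd.BundleAction (E := E) (EG := EG) F A G)
    (ψ : GroupLieAlgebra 𝓘(ℝ, EG) G →ₗ[ℝ] LieAlgd.Sec (E := E) F A)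
    (hΦ : LieAlgd.IsActionByCompleteLifts L Φ ψ)
    (J : M → (EG →L[ℝ] ℝ)) (hJ : LieAlgd.IsEquivariantMomentumMap L Ω Φ ψ J)
    (μ : EG →L[ℝ] ℝ)
    (hreg : ∀ x : M, J x = μ → Function.Surjective (LieAlgd.tangentJ (E := E) J x))
    (hrank : ∃ r : ℕ, ∀ x : M, J x = μ →
      Module.finrank ℝ (LinearMap.range (LieAlgd.tangentJ (E := E) J x ∘ₗ L.anchor x)) = r) :
    -- `J⁻¹(μ)` is an embedded submanifold and `(J^T)⁻¹(0, μ)` is a vector bundle over it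
    ∃ (d k : ℕ)
      (_ : ChartedSpace (EuclideanSpace ℝ (Fin d)) (J ⁻¹' {μ}))
      (_ : IsManifold 𝓘(ℝ, EuclideanSpace ℝ (Fin d)) ∞ (J ⁻¹' {μ}))
      (_ : TopologicalSpace
        (TotalSpace (EuclideanSpace ℝ (Fin k)) (LieAlgd.LevelBundle L J μ)))
      (_ : FiberBundle (EuclideanSpace ℝ (Fin k)) (LieAlgd.LevelBundle L J μ))
      (_ : VectorBundle ℝ (EuclideanSpace ℝ (Fin k)) (LieAlgd.LevelBundle L J μ))
      (_ : ContMDiffVectorBundle ∞ (EuclideanSpace ℝ (Fin k)) (LieAlgd.LevelBundle L J μ)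
        𝓘(ℝ, EuclideanSpace ℝ (Fin d)))
      (Lμ : LieAlgd.LieAlgebroid (E := EuclideanSpace ℝ (Fin d))
        (EuclideanSpace ℝ (Fin k)) (LieAlgd.LevelBundle L J μ)),
      IsSmoothEmbedding 𝓘(ℝ, EuclideanSpace ℝ (Fin d)) 𝓘(ℝ, E) ∞
        (Subtype.val : J ⁻¹' {μ} → M) ∧
      Set.range (LieAlgd.levelIncl (EuclideanSpace ℝ (Fin k)) L J μ) =
        LieAlgd.JT L J ⁻¹' {(0, μ)} ∧
      -- `(J^T)⁻¹(0, μ)` is a Lie subalgebroid of `A` over `J⁻¹(μ)`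
      LieAlgd.IsLieSubalgebroid Lμ L (Subtype.val : J ⁻¹' {μ} → M)
        (fun x => (LieAlgd.levelFiber L J μ x).subtype) ∧
      -- `ψ` restricted to `𝔤_μ` takes values in the sections of `(J^T)⁻¹(0, μ)`
      ∃ ψμ : LieAlgd.isotropyAlgebra G μ →ₗ[ℝ]
          LieAlgd.Sec (E := EuclideanSpace ℝ (Fin d)) (EuclideanSpace ℝ (Fin k))
            (LieAlgd.LevelBundle L J μ),
        (∀ (ξ : LieAlgd.isotropyAlgebra G μ) (x : J ⁻¹' {μ}), (ψμ ξ x : A x) = ψ ξ x) ∧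
        -- `G_μ` is an embedded Lie subgroup with Lie algebra `𝔤_μ`
        ∃ (e : ℕ)
          (_ : ChartedSpace (EuclideanSpace ℝ (Fin e)) (LieAlgd.isotropyGroup G μ))
          (_ : LieGroup 𝓘(ℝ, EuclideanSpace ℝ (Fin e)) ∞ (LieAlgd.isotropyGroup G μ))
          (ι : GroupLieAlgebra 𝓘(ℝ, EuclideanSpace ℝ (Fin e)) (LieAlgd.isotropyGroup G μ)
            ≃ₗ⁅ℝ⁆ LieAlgd.isotropyAlgebra G μ),
          IsSmoothEmbedding 𝓘(ℝ, EuclideanSpace ℝ (Fin e)) 𝓘(ℝ, EG) ∞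
            (Subtype.val : LieAlgd.isotropyGroup G μ → G) ∧
          (∀ ξ, (ι ξ : GroupLieAlgebra 𝓘(ℝ, EG) G) =
            mfderiv 𝓘(ℝ, EuclideanSpace ℝ (Fin e)) 𝓘(ℝ, EG)
              (Subtype.val : LieAlgd.isotropyGroup G μ → G) 1 ξ) ∧
          -- `Φ` restricts to an action of `G_μ` by complete lifts with respect to `ψ_μ`
          ∃ Φμ : LieAlgd.BundleAction (E := EuclideanSpace ℝ (Fin d))
              (EG := EuclideanSpace ℝ (Fin e)) (EuclideanSpace ℝ (Fin k))
              (LieAlgd.LevelBundle L J μ) (LieAlgd.isotropyGroup G μ),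
            (∀ g a, LieAlgd.levelIncl (EuclideanSpace ℝ (Fin k)) L J μ (Φμ.map g a) =
              Φ.map g (LieAlgd.levelIncl (EuclideanSpace ℝ (Fin k)) L J μ a)) ∧
            LieAlgd.IsActionByCompleteLifts Lμ Φμ (ψμ ∘ₗ (ι : _ →ₗ[ℝ] _)) ∧
            -- the induced affine action of `TG_μ`
            ∃ Θ : LieAlgd.TangentAffineAction (E := EuclideanSpace ℝ (Fin d))
                (EG := EuclideanSpace ℝ (Fin e)) (EuclideanSpace ℝ (Fin k))
                (LieAlgd.LevelBundle L J μ) (LieAlgd.isotropyGroup G μ),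
              ∀ v a, Θ.map v a =
                Φμ.map v.1 ⟨a.1, a.2 + ψμ (ι (LieAlgd.leftTriv v)) a.1⟩ := by
  -- Local compactness and second countability make M σ-compact, and its closed subset J⁻¹(μ) too.
  -- Partitions of unity are used on both.
  have : LocallyCompactSpace M := Manifold.locallyCompact_of_finiteDimensional 𝓘(ℝ, E)
  have hSc : IsClosed (J ⁻¹' {μ}) := isClosed_singleton.preimage hJ.contMDiff.continuous
  have : SigmaCompactSpace (J ⁻¹' {μ}) := hSc.isClosedEmbedding_subtypeVal.sigmaCompactSpace
  obtain ⟨d, i1, i2, hS, ht⟩ := LieAlgd.exists_isSubmanifold_preimage hJ.contMDiff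
    (J' := fun x => mfderiv 𝓘(ℝ, E) 𝓘(ℝ, EG →L[ℝ] ℝ) J x)
    (fun x => ((hJ.contMDiff x).mdifferentiableAt (by simp)).hasMFDerivAt) μ hreg
  obtain ⟨k, hk⟩ := LieAlgd.exists_subbundleChart_levelFiber hJ.contMDiff hrank
  obtain ⟨i3, i4, i5, i6, hB⟩ := LieAlgd.exists_isSubbundle (fun x => (hk x).some) hS
  obtain ⟨Lμ, hL⟩ := LieAlgd.exists_isRestriction hSc hS hB
    (LieAlgd.isInvolutive_levelFiber (L := L) hJ.contMDiff hS ht)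
  obtain ⟨e, i7, i8, ι, hemb, hι⟩ := LieAlgd.exists_lieGroup_isotropyGroup (G := G) μ
  obtain ⟨T, hT, hTξ⟩ := LieAlgd.hasMFDerivAt_subgroup_val hemb.contMDiff
  have hιT : ∀ ξ : EuclideanSpace ℝ (Fin e), (ι ξ : GroupLieAlgebra 𝓘(ℝ, EG) G) = T ξ :=
    fun ξ => (hι ξ).trans (hTξ ξ)
  exact ⟨d, k, i1, i2, i3, i4, i5, i6, Lμ, hS.isSmoothEmbedding, LieAlgd.range_levelIncl,
    hL.isLieSubalgebroid hSc hS hB, LieAlgd.levelPsi hS hB hΦ hJ, fun _ _ => rfl,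
    e, i7, i8, ι, hemb, hι, LieAlgd.levelAction hS hB hemb.contMDiff hΦ hJ, fun _ _ => rfl,
    LieAlgd.isActionByCompleteLifts_levelAction hL hSc ι hT hιT,
    LieAlgd.exists_tangentAffineAction_level ι hT hιT⟩
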